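/- Conventions. Manifolds are $C^\infty$, second countable, finite-dimensional (of pure dimension), without boundary, not necessarily Hausdorff. A Lie groupoid $X_\bullet=(X_1\rightrightarrows X_0)$ has source $s$, target $t$ (surjective submersions) and unit map $u$. It is a *foliation groupoid* if $X_0$ is Hausdorff and all isotropy groups are discrete; then $T_x\mathcal F=T_{u(x)}t\,(\ker T_{u(x)}s)$ defines a foliation $\mathcal F$ of $X_0$. A *Lie $2$-group* $G_\bullet$ is a Lie groupoid with $G_0$, $G_1$ Lie groups and all structure maps homomorphisms; put $G=G_0$, $H=\ker s\subseteq G_1$, $\partial=t|_H\colon H\to G$, $\mathfrak g=\mathrm{Lie}(G)$, $\mathfrak h=\mathrm{Lie}(H)$. It is a *foliation $2$-group* if it is a foliation groupoid; then $\mathrm{Lie}(\partial)$ is injective and identifies $\mathfrak h$ with an ideal of $\mathfrak g$. A (strict) *action* of $G_\bullet$ on $X_\bullet$ is a Lie groupoid morphism $G_\bullet\times X_\bullet\to X_\bullet$ whose components $(g,x)\mapsto g\cdot x$ and $(k,f)\mapsto k*f$ are Lie group actions. For $\xi\in\mathfrak g$ let $\xi_{X_0}$ be the fundamental vector field on $X_0$.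 A *Hamiltonian $G_\bullet$-groupoid* $(X_\bullet,\omega_\bullet,G_\bullet,\mu_\bullet)$ consists of a foliation $2$-group $G_\bullet$ whose coarse quotient $G_0/G_1$ is connected, a foliation groupoid $X_\bullet$ with a strict $G_\bullet$-action, a closed form $\omega_0\in\Omega^2(X_0)$ with $s^*\omega_0=t^*\omega_0=:\omega_1$ and $\ker\omega_0=T\mathcal F$, and a smooth map $\mu_0\colon X_0\to(\mathfrak g/\mathfrak h)^*=\mathrm{ann}(\mathfrak h)$ with $\mu_0\circ s=\mu_0\circ t=:\mu_1$, $d\langle\mu_0,\xi\rangle=\iota_{\xi_{X_0}}\omega_0$ for all $\xi\in\mathfrak g$, and $\mu_0(g\cdot x)=\mathrm{Ad}^*_g\mu_0(x)$ for all $g\in G$, $x\in X_0$. An action of $G_\bullet$ on a foliation groupoid $R_\bullet$ is *regular* if (i) it is locally leafwise transitive: for every $x\in R_0$ the image of $\mathfrak h\to T_xR_0$, $\eta\mapsto(\partial(\eta)_{R_0})_x$, is $T_x\mathcal F$; (ii) $G$ acts freely on $R_0$; (iii) if $h\in H$ satisfies $h*f=f$ for some $f\in R_1$, then $\partial(h)=1$.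 A morphism $\phi_\bullet\colon R_\bullet\to Z_\bullet$ is a *Morita morphism* if $Z_1\times_{s,Z_0,\phi_0}R_0\to Z_0$, $(g,x)\mapsto t(g)$, is a surjective submersion and the square formed by $\phi_1$, $\phi_0\times\phi_0$ and the maps $(s,t)$ is a fibred product of manifolds. **Proposition.** Let $(X_\bullet,\omega_\bullet,G_\bullet,\mu_\bullet)$ be a Hamiltonian $G_\bullet$-groupoid such that $0$ is a regular value of $\mu_0$. Then the zero fibre $Z_\bullet=\mu_\bullet^{-1}(0)=(\mu_1^{-1}(0)\rightrightarrows\mu_0^{-1}(0))$ is an embedded, $G_\bullet$-invariant Lie subgroupoid of $X_\bullet$, and it admits a regular form, i.e. a foliation groupoid $R_\bullet$ with a regular $G_\bullet$-action together with a strictly $G_\bullet$-equivariant Morita morphism $\phi_\bullet\colon R_\bullet\to Z_\bullet$, such that $\phi_0^*\omega_0\in\Omega^2(R_0)$ has constant rank and its null foliation is given by the $G_0$-orbits: for every $y\in R_0$, the kernel of $\phi_0^*\omega_0$ at $y$ is $T_y(G_0\cdot y)$ and the leaf through $y$ is the orbit of $y$ under the identity component of $G_0$. In particular, if $G_0$ is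 connected, the $G_0$-orbits in $R_0$ are exactly the leaves of the null foliation of $\phi_0^*\omega_0$. -/

import Mathlib

open scoped Manifold ContDiff Topology

universe u

noncomputable section

namespace HamGpd

/-! ### Manifolds, tangent maps and differential forms -/

/-- A smooth (`C^∞`), second countable, finite-dimensional manifold without boundary, modelled on a
finite-dimensional normed space `Model`. It is not required to be Hausdorff. -/
structure SmoothMfd : Type (u + 1) where
  carrier : Type u
  Model : Type
  [normedModel : NormedAddCommGroup Model]
  [spaceModel : NormedSpace ℝ Model]
  [finModel : FiniteDimensional ℝ Model]
  [top : TopologicalSpace carrier]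
  [charted : ChartedSpace Model carrier]
  [mfd : IsManifold 𝓘(ℝ, Model) ∞ carrier]
  [secondCountable : SecondCountableTopology carrier]

attribute [instance] SmoothMfd.normedModel SmoothMfd.spaceModel SmoothMfd.finModel SmoothMfd.top
  SmoothMfd.charted SmoothMfd.mfd SmoothMfd.secondCountable

instance : CoeSort SmoothMfd.{u} (Type u) := ⟨SmoothMfd.carrier⟩

/-- The model with corners of a manifold (no corners). -/
abbrev SmoothMfd.I (M : SmoothMfd.{u}) : ModelWithCorners ℝ M.Model M.Model := 𝓘(ℝ, M.Model)

/-- Smooth maps between manifolds. -/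
def Smooth {M N : SmoothMfd.{u}} (f : M → N) : Prop := ContMDiff M.I N.I ∞ f

/-- Smooth maps of two variables, i.e. smooth maps on a product manifold. -/
def Smooth₂ {M M' N : SmoothMfd.{u}} (f : M → M' → N) : Prop :=
  ContMDiff (M.I.prod M'.I) N.I ∞ (fun p : M × M' => f p.1 p.2)

/-- The tangent map `T_x f : T_x M → T_{f x} N`. In Mathlib every tangent space `T_x M` is, by
definition, the model space (through the preferred chart at `x`). -/
def tangentMap {M N : SmoothMfd.{u}} (f : M → N) (x : M) : M.Model →L[ℝ] N.Model :=
  mfderiv M.I N.I f x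

/-- Submersions: smooth maps with surjective tangent maps. -/
def IsSubmersion {M N : SmoothMfd.{u}} (f : M → N) : Prop :=
  Smooth f ∧ ∀ x, Function.Surjective (tangentMap f x)

/-- Smooth embeddings: smooth topological embeddings with injective tangent maps. -/
def IsEmbedding {M N : SmoothMfd.{u}} (f : M → N) : Prop :=
  Smooth f ∧ Topology.IsEmbedding f ∧ ∀ x, Function.Injective (tangentMap f x)

/-- The square `f ∘ p = g ∘ q` exhibits `P` as the fibred product `A ×_C B` in the category of
(possibly non-Hausdorff) manifolds. -/
structure IsFibredProduct {A B C P : SmoothMfd.{u}} (f : A → C) (g : B → C) (p : P → A) (q : P → B) :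
    Prop where
  smooth_fst : Smooth p
  smooth_snd : Smooth q
  comm : ∀ z, f (p z) = g (q z)
  universal : ∀ (M : SmoothMfd.{u}) (a : M → A) (b : M → B), Smooth a → Smooth b →
    (∀ m, f (a m) = g (b m)) → ∃! c : M → P, Smooth c ∧ (∀ m, p (c m) = a m) ∧ ∀ m, q (c m) = b m

/-- A (not yet smooth) differential `k`-form: an alternating `k`-form on each tangent space. -/
abbrev PreForm (M : SmoothMfd.{u}) (k : ℕ) : Type u := M → M.Model [⋀^Fin k]→L[ℝ] ℝ

/-- Pullback of a differential form along a map. -/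
def PreForm.pullback {M N : SmoothMfd.{u}} {k : ℕ} (σ : PreForm N k) (f : M → N) : PreForm M k :=
  fun x => (σ (f x)).compContinuousLinearMap (tangentMap f x)

/-- The expression of a differential form in the chart at `x₀`: a form on the model space, to be
looked at on the target of that chart. -/
def PreForm.localRep {M : SmoothMfd.{u}} {k : ℕ} (σ : PreForm M k) (x₀ : M) (y : M.Model) :
    M.Model [⋀^Fin k]→L[ℝ] ℝ :=
  (σ ((chartAt M.Model x₀).symm y)).compContinuousLinearMap
    (mfderiv 𝓘(ℝ, M.Model) M.I (chartAt M.Model x₀).symm y : M.Model →L[ℝ] M.Model)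

/-- `σ` is a smooth differential form. -/
def PreForm.IsSmooth {M : SmoothMfd.{u}} {k : ℕ} (σ : PreForm M k) : Prop :=
  ∀ x₀ : M, ContDiffOn ℝ ∞ (σ.localRep x₀) (chartAt M.Model x₀).target

/-- `dσ = 0`. -/
def PreForm.IsClosed {M : SmoothMfd.{u}} {k : ℕ} (σ : PreForm M k) : Prop :=
  ∀ x₀ : M, ∀ y ∈ (chartAt M.Model x₀).target, extDeriv (σ.localRep x₀) y = 0

/-- The kernel of a `2`-form at a point: the tangent vectors `v` with `ι_v σ = 0`. -/
def PreForm.ker {M : SmoothMfd.{u}} (σ : PreForm M 2) (x : M) : Submodule ℝ M.Model where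
  carrier := {v | ∀ w, σ x ![v, w] = 0}
  zero_mem' w := (σ x).map_coord_zero (0 : Fin 2) rfl
  add_mem' {v v'} hv hv' w := by
    have h := (σ x).toMultilinearMap.map_update_add ![v, w] 0 v v'
    have e : ∀ z : M.Model, Function.update ![v, w] 0 z = ![z, w] := fun z => by
      ext i; fin_cases i <;> simp
    simp only [e] at h
    exact h.trans ((congrArg₂ (· + ·) (hv w) (hv' w)).trans (add_zero 0))
  smul_mem' c v hv w := by
    have h := (σ x).toMultilinearMap.map_update_smul ![v, w] 0 c v
    have e : ∀ z : M.Model, Function.update ![v, w] 0 z = ![z, w] := fun z => by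
      ext i; fin_cases i <;> simp
    simp only [e] at h
    exact h.trans ((congrArg (c • ·) (hv w)).trans (smul_zero c))

/-- The set of points that can be joined to `x` by a smooth path tangent to the null distribution of
`σ`. When `σ` is closed of constant rank, so that its null distribution is integrable, this is the
leaf through `x` of the null foliation of `σ`. -/
def PreForm.nullLeaf {M : SmoothMfd.{u}} (σ : PreForm M 2) (x : M) : Set M :=
  {y | ∃ γ : ℝ → M, ContMDiff 𝓘(ℝ, ℝ) M.I ∞ γ ∧
    (∀ τ : ℝ, (mfderiv 𝓘(ℝ, ℝ) M.I γ τ : ℝ →L[ℝ] M.Model) 1 ∈ σ.ker (γ τ)) ∧ γ 0 = x ∧ γ 1 = y}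

/-! ### Lie groupoids -/

/-- A Lie groupoid. The composition `comp f g = f ∘ g` is meaningful only if `src f = tgt g`; its
values on other pairs are irrelevant. -/
structure LieGroupoid : Type (u + 1) where
  Obj : SmoothMfd.{u}
  Arr : SmoothMfd.{u}
  src : Arr → Obj
  tgt : Arr → Obj
  unit : Obj → Arr
  inv : Arr → Arr
  comp : Arr → Arr → Arr
  src_unit : ∀ x, src (unit x) = x
  tgt_unit : ∀ x, tgt (unit x) = x
  src_comp : ∀ f g, src f = tgt g → src (comp f g) = src g
  tgt_comp : ∀ f g, src f = tgt g → tgt (comp f g) = tgt f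
  comp_assoc : ∀ f g h, src f = tgt g → src g = tgt h → comp (comp f g) h = comp f (comp g h)
  unit_comp : ∀ f, comp (unit (tgt f)) f = f
  comp_unit : ∀ f, comp f (unit (src f)) = f
  src_inv : ∀ f, src (inv f) = tgt f
  tgt_inv : ∀ f, tgt (inv f) = src f
  inv_comp : ∀ f, comp (inv f) f = unit (src f)
  comp_inv : ∀ f, comp f (inv f) = unit (tgt f)
  src_submersion : IsSubmersion src
  tgt_submersion : IsSubmersion tgt
  smooth_unit : Smooth unit
  smooth_inv : Smooth inv
  smooth_comp : ContMDiffOn (Arr.I.prod Arr.I) Arr.I ∞ (fun p : Arr × Arr => comp p.1 p.2)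
    {p | src p.1 = tgt p.2}

namespace LieGroupoid

/-- The isotropy group of `x`. -/
def isotropy (X : LieGroupoid.{u}) (x : X.Obj) : Set X.Arr := {f | X.src f = x ∧ X.tgt f = x}

/-- Foliation groupoids: the object manifold is Hausdorff and the isotropy groups are discrete. -/
def IsFoliation (X : LieGroupoid.{u}) : Prop :=
  T2Space X.Obj ∧ ∀ x, DiscreteTopology (X.isotropy x)

/-- The image at `x` of the anchor map of the Lie algebroid, i.e. `Tt (ker Ts)` at the unit `u(x)`.
If `X` is a foliation groupoid, this is the tangent space `T_x F` of the foliation `F` of the object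
manifold by the connected components of the orbits. -/
def anchorImage (X : LieGroupoid.{u}) (x : X.Obj) : Submodule ℝ X.Obj.Model :=
  (LinearMap.ker (tangentMap X.src (X.unit x) : X.Arr.Model →ₗ[ℝ] X.Obj.Model)).map
    (tangentMap X.tgt (X.unit x) : X.Arr.Model →ₗ[ℝ] X.Obj.Model)

/-- The orbit space (coarse quotient space) of a Lie groupoid, with the quotient topology. -/
abbrev OrbitSpace (X : LieGroupoid.{u}) : Type u :=
  Quot (fun x y : X.Obj => ∃ f, X.src f = x ∧ X.tgt f = y)

/-- The `2`-form `σ` on the objects defines a basic form `(σ, s^*σ)` with `s^*σ = t^*σ` that is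
`0`-symplectic: it is closed and its kernel is the tangent bundle of the foliation. -/
structure IsZeroSymplectic (X : LieGroupoid.{u}) (σ : PreForm X.Obj 2) : Prop where
  smooth : σ.IsSmooth
  basic : σ.pullback X.src = σ.pullback X.tgt
  closed : σ.IsClosed
  nondegenerate : ∀ x, σ.ker x = X.anchorImage x

/-- Morphisms of Lie groupoids: smooth functors. -/
structure Hom (X Y : LieGroupoid.{u}) where
  obj : X.Obj → Y.Obj
  arr : X.Arr → Y.Arr
  smooth_obj : Smooth obj
  smooth_arr : Smooth arr
  src_arr : ∀ f, Y.src (arr f) = obj (X.src f)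
  tgt_arr : ∀ f, Y.tgt (arr f) = obj (X.tgt f)
  arr_unit : ∀ x, arr (X.unit x) = Y.unit (obj x)
  arr_comp : ∀ f g, X.src f = X.tgt g → arr (X.comp f g) = Y.comp (arr f) (arr g)

/-- Essential surjectivity: `t ∘ pr₁ : Y₁ ×_{s, Y₀, φ₀} X₀ → Y₀` is a surjective submersion. (As `s`
is a submersion, the fibred product exists, and it is unique up to diffeomorphism.) -/
def Hom.EssentiallySurjective {X Y : LieGroupoid.{u}} (φ : Hom X Y) : Prop :=
  ∃ (P : SmoothMfd.{u}) (p : P → Y.Arr) (q : P → X.Obj), IsFibredProduct Y.src φ.obj p q ∧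
    IsSubmersion (fun z => Y.tgt (p z)) ∧ Function.Surjective (fun z => Y.tgt (p z))

/-- Full faithfulness: the square formed by `φ₁`, `(s, t) : X₁ → X₀ × X₀`, `φ₀ × φ₀` and
`(s, t) : Y₁ → Y₀ × Y₀` is a fibred product of manifolds. A smooth map to `X₀ × X₀` is written as
a pair of smooth maps to `X₀`. -/
def Hom.FullyFaithful {X Y : LieGroupoid.{u}} (φ : Hom X Y) : Prop :=
  ∀ (M : SmoothMfd.{u}) (a : M → Y.Arr) (b b' : M → X.Obj), Smooth a → Smooth b → Smooth b' →
    (∀ m, Y.src (a m) = φ.obj (b m)) → (∀ m, Y.tgt (a m) = φ.obj (b' m)) →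
    ∃! c : M → X.Arr, Smooth c ∧ (∀ m, φ.arr (c m) = a m) ∧ (∀ m, X.src (c m) = b m) ∧
      ∀ m, X.tgt (c m) = b' m

/-- Morita morphisms (weak equivalences). -/
def Hom.IsMorita {X Y : LieGroupoid.{u}} (φ : Hom X Y) : Prop :=
  φ.EssentiallySurjective ∧ φ.FullyFaithful

end LieGroupoid

/-! ### Lie `2`-groups and their actions -/

/-- A (strict) Lie `2`-group: a Lie groupoid whose object and arrow manifolds are Lie groups and
whose structure maps are Lie group homomorphisms. The associated crossed module `(G, H, ∂, α)` has
`G = Obj`, `H = ker s ⊆ Arr` and `∂ = t|_H`. -/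
structure LieTwoGroup : Type (u + 1) extends LieGroupoid.{u} where
  [groupObj : Group Obj]
  [groupArr : Group Arr]
  [lieObj : LieGroup Obj.I ∞ Obj]
  [lieArr : LieGroup Arr.I ∞ Arr]
  src_mul : ∀ k l, src (k * l) = src k * src l
  tgt_mul : ∀ k l, tgt (k * l) = tgt k * tgt l
  unit_mul : ∀ g h, unit (g * h) = unit g * unit h
  inv_mul : ∀ k l, inv (k * l) = inv k * inv l
  comp_mul : ∀ k k' l l', src k = tgt k' → src l = tgt l' →
    comp (k * l) (k' * l') = comp k k' * comp l l'

attribute [instance] LieTwoGroup.groupObj LieTwoGroup.groupArr LieTwoGroup.lieObj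
  LieTwoGroup.lieArr

namespace LieTwoGroup

/-- The ideal `𝔥 = Lie(t) (ker Lie(s))` of `𝔤 = Lie(G₀) = T₁G₀`, i.e. the image of
`Lie(∂) : 𝔥 → 𝔤`. -/
def lieIdeal (G : LieTwoGroup.{u}) : Submodule ℝ G.Obj.Model :=
  (LinearMap.ker (tangentMap G.src 1 : G.Arr.Model →ₗ[ℝ] G.Obj.Model)).map
    (tangentMap G.tgt 1 : G.Arr.Model →ₗ[ℝ] G.Obj.Model)

/-- The annihilator of `𝔥` in `𝔤^*`, i.e. the dual space `(𝔤/𝔥)^*`. -/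
def ann (G : LieTwoGroup.{u}) : Submodule ℝ (StrongDual ℝ G.Obj.Model) where
  carrier := {l | ∀ η ∈ G.lieIdeal, l η = 0}
  zero_mem' := by intro η _; simp
  add_mem' := by intro a b ha hb η hη; simp [ha η hη, hb η hη]
  smul_mem' := by intro c a ha η hη; simp [ha η hη]

/-- The adjoint action of `G₀` on `𝔤 = T₁G₀`. -/
def Ad (G : LieTwoGroup.{u}) (g : G.Obj) : G.Obj.Model →L[ℝ] G.Obj.Model :=
  tangentMap (fun a : G.Obj => g * a * g⁻¹) 1

end LieTwoGroup

/-- A strict action of a Lie `2`-group `G` on a Lie groupoid `X`: a morphism of Lie groupoids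
`G × X → X` whose components on objects and on arrows are Lie group actions. -/
structure StrictAction (G : LieTwoGroup.{u}) (X : LieGroupoid.{u}) where
  obj : G.Obj → X.Obj → X.Obj
  arr : G.Arr → X.Arr → X.Arr
  smooth_obj : Smooth₂ obj
  smooth_arr : Smooth₂ arr
  one_obj : ∀ x, obj 1 x = x
  mul_obj : ∀ g h x, obj (g * h) x = obj g (obj h x)
  one_arr : ∀ f, arr 1 f = f
  mul_arr : ∀ k l f, arr (k * l) f = arr k (arr l f)
  src_arr : ∀ k f, X.src (arr k f) = obj (G.src k) (X.src f)
  tgt_arr : ∀ k f, X.tgt (arr k f) = obj (G.tgt k) (X.tgt f)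
  arr_unit : ∀ g x, arr (G.unit g) (X.unit x) = X.unit (obj g x)
  arr_comp : ∀ k k' f f', G.src k = G.tgt k' → X.src f = X.tgt f' →
    arr (G.comp k k') (X.comp f f') = X.comp (arr k f) (arr k' f')

namespace StrictAction

variable {G : LieTwoGroup.{u}} {X Y : LieGroupoid.{u}}

/-- The infinitesimal action `𝔤 → T_x X₀`, `ξ ↦ (ξ_{X₀})_x`, where `ξ_{X₀}` is the fundamental
vector field of `ξ`. -/
def infinitesimal (a : StrictAction G X) (x : X.Obj) : G.Obj.Model →L[ℝ] X.Obj.Model :=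
  tangentMap (fun g : G.Obj => a.obj g x) 1

/-- Locally leafwise transitive actions: the image of `𝔥 → T_x X₀` is `T_x F` for all `x`. -/
def LocallyLeafwiseTransitive (a : StrictAction G X) : Prop :=
  ∀ x, G.lieIdeal.map (a.infinitesimal x : G.Obj.Model →ₗ[ℝ] X.Obj.Model) = X.anchorImage x

/-- Regular actions: locally leafwise transitive, free on objects, and every `h ∈ H = ker s` that
fixes some arrow is in the kernel of `∂ = t|_H`. -/
structure IsRegular (a : StrictAction G X) : Prop where
  locallyLeafwiseTransitive : a.LocallyLeafwiseTransitive
  free : ∀ g x, a.obj g x = x → g = 1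
  stabilizer : ∀ h : G.Arr, G.src h = 1 → ∀ f, a.arr h f = f → G.tgt h = 1

/-- Strict equivariance of a morphism of Lie groupoids. -/
def Equivariant (a : StrictAction G X) (b : StrictAction G Y) (φ : LieGroupoid.Hom X Y) : Prop :=
  (∀ g x, φ.obj (a.obj g x) = b.obj g (φ.obj x)) ∧ ∀ k f, φ.arr (a.arr k f) = b.arr k (φ.arr f)

end StrictAction

/-! ### Hamiltonian groupoids, the zero fibre and its regular forms -/

/-- A moment map for a strict action of `G` on a Lie groupoid `X` with `2`-form `σ`: a morphism of
Lie groupoids from `X` to the identity groupoid of the manifold `(𝔤/𝔥)^* = ann 𝔥`, i.e. a smooth map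
`μ₀` with `μ₀ ∘ s = μ₀ ∘ t` (and then `μ₁ = μ₀ ∘ s`), that is Hamiltonian and equivariant for the
coadjoint action. (An arrow `k` of `G` acts on `𝔤/𝔥` by `Ad (t k)`, so equivariance on arrows is
a consequence of equivariance on objects.) -/
structure MomentMap {G : LieTwoGroup.{u}} {X : LieGroupoid.{u}} (σ : PreForm X.Obj 2)
    (a : StrictAction G X) where
  toFun : X.Obj → G.ann
  smooth : ContMDiff X.Obj.I 𝓘(ℝ, G.ann) ∞ toFun
  invariant : ∀ f, toFun (X.src f) = toFun (X.tgt f)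
  hamilton : ∀ (ξ : G.Obj.Model) (x : X.Obj) (v : X.Obj.Model),
    (mfderiv X.Obj.I 𝓘(ℝ, ℝ) (fun y => (toFun y : StrongDual ℝ G.Obj.Model) ξ) x :
      X.Obj.Model →L[ℝ] ℝ) v = σ x ![a.infinitesimal x ξ, v]
  equivariant : ∀ (g : G.Obj) (x : X.Obj) (ξ : G.Obj.Model),
    (toFun (a.obj g x) : StrongDual ℝ G.Obj.Model) ξ =
      (toFun x : StrongDual ℝ G.Obj.Model) (G.Ad g⁻¹ ξ)

section

variable {G : LieTwoGroup.{u}} {X : LieGroupoid.{u}} {σ : PreForm X.Obj 2} {a : StrictAction G X}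

/-- `0` is a regular value of the moment map. -/
def MomentMap.ZeroIsRegularValue (μ : MomentMap σ a) : Prop :=
  ∀ x, μ.toFun x = 0 →
    Function.Surjective (mfderiv X.Obj.I 𝓘(ℝ, G.ann) μ.toFun x : X.Obj.Model →L[ℝ] G.ann)

/-- The zero fibre of the moment map as a Lie groupoid with `G`-action: the embedded Lie subgroupoid
of `X` with objects `μ₀⁻¹(0)` and arrows `μ₁⁻¹(0)`, and with the restricted action. (The manifold
structure of an embedded submanifold is unique.) -/
structure ZeroFibre (μ : MomentMap σ a) where
  gpd : LieGroupoid.{u}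
  incl : LieGroupoid.Hom gpd X
  embedding_obj : IsEmbedding incl.obj
  embedding_arr : IsEmbedding incl.arr
  range_obj : Set.range incl.obj = {x | μ.toFun x = 0}
  range_arr : Set.range incl.arr = {f | μ.toFun (X.src f) = 0}
  action : StrictAction G gpd
  equivariant : action.Equivariant a incl

/-- The form `σ` has constant rank, and the leaves of its null foliation are given by the orbits of
`G₀`: the null space at `y` is the tangent space at `y` of the orbit of `y`, the leaf through `y` is
the orbit of `y` under the identity component of `G₀`, and hence it is the orbit of `y` under
`G₀` if `G₀` is connected. -/
structure OrbitsAreNullLeaves {R : LieGroupoid.{u}} (c : StrictAction G R) (σ : PreForm R.Obj 2) :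
    Prop where
  constant_rank : ∃ r : ℕ, ∀ y, Module.finrank ℝ (σ.ker y) = r
  tangent : ∀ y, σ.ker y =
    LinearMap.range (c.infinitesimal y : G.Obj.Model →ₗ[ℝ] R.Obj.Model)
  leaf : ∀ y, σ.nullLeaf y = (fun g => c.obj g y) '' connectedComponent (1 : G.Obj)
  leaf_of_connected : ConnectedSpace G.Obj → ∀ y, σ.nullLeaf y = Set.range fun g => c.obj g y

/-- A regular form of the zero fibre `Z`: a foliation groupoid `gpd` with a regular `G`-action and
a strictly equivariant Morita morphism `φ : gpd → Z` such that the leaves of the null foliation of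
`φ₀^*σ₀` are the `G₀`-orbits. -/
structure RegularForm {μ : MomentMap σ a} (Z : ZeroFibre μ) where
  gpd : LieGroupoid.{u}
  foliation : gpd.IsFoliation
  action : StrictAction G gpd
  regular : action.IsRegular
  φ : LieGroupoid.Hom gpd Z.gpd
  equivariant : action.Equivariant Z.action φ
  morita : φ.IsMorita
  nullLeaves : OrbitsAreNullLeaves action (σ.pullback fun y => Z.incl.obj (φ.obj y))

end

end HamGpd

end

open HamGpd

/-!
The zero fibre `Z` is the restriction of `X` to the regular level set `μ₀⁻¹(0)`. The kernel of the
restricted form at a zero `z` is computed by linear algebra: as `d⟨μ₀, ξ⟩ = ι_ξ ω₀`, the kernel of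
`dμ₀` is the `ω₀`-orthogonal of the orbit direction, so that the kernel of the restricted form is
the sum `D_z` of the tangent space of the foliation and of that of the orbit. Moreover, regularity
of `0` says exactly that a fundamental vector at a zero is tangent to the foliation only if it
comes from `𝔥`, hence `D` has constant rank (`MomentMap.exists_zeroFibre`,
`StrictAction.finrank_distribution`).

The regular form is the pullback of `Z` along a map `φ₀ : G₀ × T → Z₀`, `(g, τ) ↦ g ⬝ ψ(τ)`, where
`ψ : T → Z₀` is a countable disjoint union of discs complementary to `D` whose sweeps by `G₀` meet
all isomorphism classes (`StrictAction.exists_isCompleteSlice`); the group acts by left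
multiplication on `G₀ × T`. As `φ₀` is transverse to the foliation, the pullback is a Lie groupoid
and its projection to `Z` is a Morita morphism (`transversePullback`,
`isMorita_hom_transversePullback`). As `ψ` is complementary to `D`, the inverse image of `D` under
the tangent map of `φ₀` is the tangent space of `G₀ × {τ}`
(`StrictAction.IsCompleteSlice.tangentMap_mem_distribution_iff`). This gives regularity of the
action (`StrictAction.IsCompleteSlice.isRegular`), and it identifies the kernel of `φ₀^*ω₀` with
the tangent spaces of the `G₀`-orbits. The null leaves are therefore the sets `G' g × {τ}`, where
`G'` is the identity component of `G₀`; the elements of `G'` are the ends of smooth paths from `1`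
(`StrictAction.IsCompleteSlice.orbitsAreNullLeaves`).

The foundations that this needs for manifolds that may fail to be Hausdorff are the equalizer of
transverse maps as an embedded submanifold (`exists_submanifold_equalizer`) and the fact that the
discreteness of the isotropy groups makes the anchor injective
(`LieGroupoid.IsFoliation.eq_zero_of_mem_ker`). To avoid a theory of foliations and of subbundles,
transversality of `φ` to the foliation is expressed as the submersion property of the target map
of a fibred product, which shows that it is an open condition (`LieGroupoid.isOpen_transverseAt`).
-/

noncomputable section

namespace HamGpd

/-! ### Calculus of smooth maps -/

section Calculus

variable {M N P : SmoothMfd.{u}}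

theorem Smooth.mdiff {f : M → N} (hf : Smooth f) (x : M) : MDifferentiableAt M.I N.I f x :=
  (hf x).mdifferentiableAt (by simp)

theorem Smooth.comp {g : N → P} {f : M → N} (hg : Smooth g) (hf : Smooth f) :
    Smooth (fun x => g (f x)) :=
  ContMDiff.comp (I' := N.I) hg hf

theorem smooth_id : Smooth (fun x : M => x) := contMDiff_id

theorem smooth_const (c : N) : Smooth (fun _ : M => c) := contMDiff_const

theorem tangentMap_comp {g : N → P} {f : M → N} (hg : Smooth g) (hf : Smooth f) (x : M) :
    tangentMap (fun x => g (f x)) x = (tangentMap g (f x)).comp (tangentMap f x) :=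
  mfderiv_comp x (hg.mdiff (f x)) (hf.mdiff x)

theorem tangentMap_comp_apply {g : N → P} {f : M → N} (hg : Smooth g) (hf : Smooth f) (x : M)
    (v : M.Model) : tangentMap (fun x => g (f x)) x v = tangentMap g (f x) (tangentMap f x v) := by
  rw [tangentMap_comp hg hf]; rfl

theorem tangentMap_id (x : M) : tangentMap (fun x : M => x) x = ContinuousLinearMap.id ℝ M.Model :=
  mfderiv_id

theorem tangentMap_const (c : N) (x : M) : tangentMap (fun _ : M => c) x = 0 :=
  mfderiv_const

end Calculus

/-! ### Products, vector spaces and discrete manifolds -/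

/-- The product of two manifolds. -/
def SmoothMfd.prod (M N : SmoothMfd.{u}) : SmoothMfd.{u} where
  carrier := M × N
  Model := M.Model × N.Model
  charted := prodChartedSpace M.Model M N.Model N
  mfd := by
    rw [modelWithCornersSelf_prod]
    exact IsManifold.prod M N

section Prod

variable {M N P Q : SmoothMfd.{u}}

/-- The point of a product manifold with given components. -/
def SmoothMfd.pair (x : M) (y : N) : M.prod N := ((x, y) : M × N)

/-- The first projection of a product manifold. -/
def SmoothMfd.fst (p : M.prod N) : M := Prod.fst (α := M) (β := N) p

/-- The second projection of a product manifold. -/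
def SmoothMfd.snd (p : M.prod N) : N := Prod.snd (α := M) (β := N) p

/-- The tangent vector to a product manifold with given components. -/
def tangentPair (v : M.Model) (w : N.Model) : (M.prod N).Model := ((v, w) : M.Model × N.Model)

open SmoothMfd

@[simp] theorem fst_pair (x : M) (y : N) : fst (pair x y) = x := rfl

@[simp] theorem snd_pair (x : M) (y : N) : snd (pair x y) = y := rfl

@[simp] theorem pair_fst_snd (p : M.prod N) : pair (fst p) (snd p) = p := rfl

theorem exists_eq_tangentPair (v : (M.prod N).Model) :
    ∃ (v₁ : M.Model) (v₂ : N.Model), v = tangentPair v₁ v₂ := ⟨v.1, v.2, rfl⟩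

theorem tangentPair_inj {v v' : M.Model} {w w' : N.Model} :
    tangentPair v w = tangentPair v' w' ↔ v = v' ∧ w = w' :=
  Prod.mk_inj

theorem tangentPair_sub (v v' : M.Model) (w w' : N.Model) :
    tangentPair v w - tangentPair v' w' = tangentPair (v - v') (w - w') := rfl

theorem tangentPair_add (v v' : M.Model) (w w' : N.Model) :
    tangentPair v w + tangentPair v' w' = tangentPair (v + v') (w + w') := rfl

theorem tangentPair_zero : tangentPair (0 : M.Model) (0 : N.Model) = 0 := rfl

theorem Smooth.pair {f : M → N} {g : M → P} (hf : Smooth f) (hg : Smooth g) :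
    Smooth (fun x => pair (f x) (g x)) :=
  ContMDiff.prodMk (I' := N.I) (J' := P.I) hf hg

theorem smooth_fst : Smooth (fst : M.prod N → M) :=
  contMDiff_fst (I := M.I) (J := N.I)

theorem smooth_snd : Smooth (snd : M.prod N → N) :=
  contMDiff_snd (I := M.I) (J := N.I)

theorem smooth₂_iff {f : M → N → P} :
    Smooth₂ f ↔ Smooth (fun p : M.prod N => f (fst p) (snd p)) := Iff.rfl

theorem Smooth₂.comp {f : M → N → P} (hf : Smooth₂ f) {g : Q → M} {h : Q → N} (hg : Smooth g)
    (hh : Smooth h) : Smooth (fun x => f (g x) (h x)) :=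
  Smooth.comp (smooth₂_iff.1 hf) (hg.pair hh)

theorem tangentMap_pair {f : M → N} {g : M → P} (hf : Smooth f) (hg : Smooth g) (x : M)
    (v : M.Model) : tangentMap (fun x => SmoothMfd.pair (f x) (g x)) x v =
      tangentPair (tangentMap f x v) (tangentMap g x v) :=
  DFunLike.congr_fun ((hf.mdiff x).mfderiv_prod (hg.mdiff x)) v

theorem tangentMap_fst (x : M.prod N) (v : M.Model) (w : N.Model) :
    tangentMap (fst : M.prod N → M) x (tangentPair v w) = v :=
  DFunLike.congr_fun (mfderiv_fst (I := M.I) (I' := N.I)) _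

theorem tangentMap_snd (x : M.prod N) (v : M.Model) (w : N.Model) :
    tangentMap (snd : M.prod N → N) x (tangentPair v w) = w :=
  DFunLike.congr_fun (mfderiv_snd (I := M.I) (I' := N.I)) _

theorem tangentMap_comp_fst {f : M → P} (hf : Smooth f) (x : M.prod N) (v : M.Model)
    (w : N.Model) : tangentMap (fun x : M.prod N => f (fst x)) x (tangentPair v w) =
      tangentMap f (fst x) v := by
  rw [tangentMap_comp_apply hf smooth_fst, tangentMap_fst]

theorem tangentMap_comp_snd {f : N → P} (hf : Smooth f) (x : M.prod N) (v : M.Model)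
    (w : N.Model) : tangentMap (fun x : M.prod N => f (snd x)) x (tangentPair v w) =
      tangentMap f (snd x) w := by
  rw [tangentMap_comp_apply hf smooth_snd, tangentMap_snd]

/-- The partial derivatives of a smooth map on a product add up to its tangent map. -/
theorem tangentMap_prod_apply {f : M.prod N → P} (hf : Smooth f) (x : M) (y : N) (v : M.Model)
    (w : N.Model) : tangentMap f (pair x y) (tangentPair v w) =
      tangentMap (fun x' : M => f (pair x' y)) x v +
        tangentMap (fun y' : N => f (pair x y')) y w := by
  rw [tangentMap_comp_apply hf (smooth_id.pair (smooth_const y)),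
    tangentMap_pair smooth_id (smooth_const y),
    tangentMap_comp_apply hf ((smooth_const x).pair smooth_id),
    tangentMap_pair (smooth_const x) smooth_id, tangentMap_id, tangentMap_const, tangentMap_id,
    tangentMap_const, ← map_add, tangentPair_add]
  change _ = tangentMap f (pair x y) (tangentPair (v + 0) (0 + w))
  rw [add_zero, zero_add]

end Prod

/-- A finite-dimensional normed space as a manifold in an arbitrary universe. -/
def vecMfd (E : Type) [NormedAddCommGroup E] [NormedSpace ℝ E] [FiniteDimensional ℝ E] :
    SmoothMfd.{u} where
  carrier := ULift.{u} E
  Model := E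
  charted := (Homeomorph.ulift.isOpenEmbedding : Topology.IsOpenEmbedding
    (ULift.down : ULift.{u} E → E)).singletonChartedSpace
  mfd := (Homeomorph.ulift.isOpenEmbedding : Topology.IsOpenEmbedding
    (ULift.down : ULift.{u} E → E)).isManifold_singleton
  secondCountable := (Homeomorph.ulift.{u, 0} (X := E)).secondCountableTopology

/-- A countable set as a `0`-dimensional manifold. -/
def discreteMfd (ι : Type u) [Countable ι] : SmoothMfd.{u} :=
  letI : TopologicalSpace ι := ⊥
  haveI : DiscreteTopology ι := ⟨rfl⟩
  { carrier := ι
    Model := PUnit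
    finModel := inferInstance
    charted := ChartedSpace.ofDiscreteTopology
    mfd := IsManifold.of_discreteTopology ∞
    secondCountable := inferInstance }

instance (ι : Type u) [Countable ι] : DiscreteTopology (discreteMfd ι) := ⟨rfl⟩

instance (ι : Type u) [Countable ι] : Subsingleton (discreteMfd ι).Model :=
  inferInstanceAs (Subsingleton PUnit)

section Vec

variable (E : Type) [NormedAddCommGroup E] [NormedSpace ℝ E] [FiniteDimensional ℝ E]

instance : T2Space (vecMfd.{u} E) :=
  (Homeomorph.ulift.{u, 0} (X := E)).symm.t2Space

variable {E}

/-- The identity map of a vector space as a map to the manifold that it defines. -/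
def vecUp (x : E) : vecMfd.{u} E := ULift.up x

/-- The identity map of a vector space as a map from the manifold that it defines. -/
def vecDown (x : vecMfd.{u} E) : E := ULift.down x

theorem contMDiff_vecDown :
    ContMDiff (vecMfd.{u} E).I 𝓘(ℝ, E) ∞ (vecDown : vecMfd.{u} E → E) := by
  intro x
  exact contMDiffAt_extChartAt (I := (vecMfd.{u} E).I) (x := x)

theorem contMDiff_vecUp :
    ContMDiff 𝓘(ℝ, E) (vecMfd.{u} E).I ∞ (vecUp : E → vecMfd.{u} E) := by
  intro x
  let x' : vecMfd.{u} E := ULift.up x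
  have h := contMDiffOn_chart_symm (I := (vecMfd.{u} E).I) (n := ∞) (x := x')
  have ht : (chartAt (vecMfd.{u} E).Model x').target = Set.univ :=
    ((Homeomorph.ulift.isOpenEmbedding : Topology.IsOpenEmbedding
      (ULift.down : ULift.{u} E → E)).toOpenPartialHomeomorph_target ULift.down).trans
        (Set.range_eq_univ.2 ULift.down_surjective)
  rw [ht, contMDiffOn_univ] at h
  refine (h x).congr_of_eventuallyEq (Filter.Eventually.of_forall fun y => ?_)
  have := (chartAt (vecMfd.{u} E).Model x').left_inv
    (x := (ULift.up y : ULift.{u} E)) trivial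
  exact this.symm

end Vec

/-! ### Submersions -/

/-- Surjectivity is an open condition: if `f ∘ g = 1`, then `f' ∘ g` is a unit for `f'` near `f`.
-/
theorem isOpen_setOf_surjective_clm {E F : Type*} [NormedAddCommGroup E] [NormedSpace ℝ E]
    [NormedAddCommGroup F] [NormedSpace ℝ F] [FiniteDimensional ℝ F] :
    IsOpen {f : E →L[ℝ] F | Function.Surjective f} := by
  rw [isOpen_iff_mem_nhds]
  intro f hf
  obtain ⟨g, hg⟩ := (f : E →ₗ[ℝ] F).exists_rightInverse_of_surjective (LinearMap.range_eq_top.2 hf)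
  have hc : Continuous fun f' : E →L[ℝ] F => f'.comp (LinearMap.toContinuousLinearMap g) := by
    fun_prop
  have hU : {a : F →L[ℝ] F | IsUnit a} ∈ 𝓝 (f.comp (LinearMap.toContinuousLinearMap g)) := by
    refine Units.isOpen.mem_nhds ?_
    have : f.comp (LinearMap.toContinuousLinearMap g) = 1 := by
      ext x; exact LinearMap.congr_fun hg x
    rw [this]; exact isUnit_one
  filter_upwards [hc.continuousAt hU] with f' hf' y
  obtain ⟨u, hu⟩ : IsUnit _ := hf'
  refine ⟨g ((↑u⁻¹ : F →L[ℝ] F) y), ?_⟩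
  have h : ((u : F →L[ℝ] F) * (↑u⁻¹ : F →L[ℝ] F)) y = y := by simp
  rw [hu] at h
  exact h

section Submersion

variable {M N : SmoothMfd.{u}}

/-- The expression of a map in the preferred charts at `x₀` and at its image. -/
def chartRep (f : M → N) (x₀ : M) (y : M.Model) : N.Model :=
  chartAt N.Model (f x₀) (f ((chartAt M.Model x₀).symm y))

theorem chartRep_contDiffAt {f : M → N} (hf : Smooth f) {x₀ x : M}
    (hx : x ∈ (chartAt M.Model x₀).source) (hfx : f x ∈ (chartAt N.Model (f x₀)).source) :
    ContDiffAt ℝ ∞ (chartRep f x₀) (chartAt M.Model x₀ x) := by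
  rw [← contMDiffAt_iff_contDiffAt]
  have h1 : ContMDiffAt 𝓘(ℝ, M.Model) M.I ∞ (chartAt M.Model x₀).symm (chartAt M.Model x₀ x) :=
    (contMDiffOn_chart_symm (I := M.I)).contMDiffAt
      ((chartAt M.Model x₀).open_target.mem_nhds ((chartAt M.Model x₀).map_source hx))
  have e : (chartAt M.Model x₀).symm (chartAt M.Model x₀ x) = x := (chartAt M.Model x₀).left_inv hx
  have h2 : ContMDiffAt N.I 𝓘(ℝ, N.Model) ∞ (chartAt N.Model (f x₀)) (f x) :=
    (contMDiffOn_chart (I := N.I)).contMDiffAt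
      ((chartAt N.Model (f x₀)).open_source.mem_nhds hfx)
  have h3 : ContMDiffAt M.I 𝓘(ℝ, N.Model) ∞ (fun z => chartAt N.Model (f x₀) (f z)) x :=
    h2.comp x (hf x)
  rw [← e] at h3
  exact h3.comp _ h1

/-- In charts, the tangent map becomes the derivative, up to linear isomorphisms. -/
theorem exists_fderiv_chartRep {f : M → N} (hf : Smooth f) {x₀ x : M}
    (hx : x ∈ (chartAt M.Model x₀).source) (hfx : f x ∈ (chartAt N.Model (f x₀)).source) :
    ∃ (A : M.Model →L[ℝ] M.Model) (B : N.Model →L[ℝ] N.Model), Function.Bijective A ∧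
      Function.Bijective B ∧ fderiv ℝ (chartRep f x₀) (chartAt M.Model x₀ x) =
        B.comp ((tangentMap f x).comp A) := by
  have d1 := mdifferentiable_chart (I := M.I) x₀
  have d2 := mdifferentiable_chart (I := N.I) (f x₀)
  have hx' := (chartAt M.Model x₀).map_source hx
  have e : (chartAt M.Model x₀).symm (chartAt M.Model x₀ x) = x := (chartAt M.Model x₀).left_inv hx
  have hfd : HasMFDerivAt M.I N.I f ((chartAt M.Model x₀).symm (chartAt M.Model x₀ x))
      (tangentMap f x) := by
    rw [e]; exact (hf.mdiff x).hasMFDerivAt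
  have hgd : HasMFDerivAt N.I 𝓘(ℝ, N.Model) (chartAt N.Model (f x₀))
      (f ((chartAt M.Model x₀).symm (chartAt M.Model x₀ x)))
      (mfderiv N.I 𝓘(ℝ, N.Model) (chartAt N.Model (f x₀)) (f x)) := by
    rw [e]; exact (d2.mdifferentiableAt hfx).hasMFDerivAt
  have hc := HasMFDerivAt.comp _ hfd (d1.mdifferentiableAt_symm hx').hasMFDerivAt
  have h := HasMFDerivAt.comp (f := f ∘ (chartAt M.Model x₀).symm) (chartAt M.Model x₀ x) hgd hc
  let A : M.Model →L[ℝ] M.Model :=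
    mfderiv 𝓘(ℝ, M.Model) M.I (chartAt M.Model x₀).symm (chartAt M.Model x₀ x)
  let B : N.Model →L[ℝ] N.Model := mfderiv N.I 𝓘(ℝ, N.Model) (chartAt N.Model (f x₀)) (f x)
  have h' : HasFDerivAt (chartRep f x₀) (B.comp ((tangentMap f x).comp A))
      (chartAt M.Model x₀ x) := hasMFDerivAt_iff_hasFDerivAt.1 h
  have hb1 : Function.Bijective A := d1.symm.mfderiv_bijective hx'
  have hb2 : Function.Bijective B := d2.mfderiv_bijective hfx
  exact ⟨A, B, hb1, hb2, h'.fderiv⟩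

theorem chartRep_surjective_iff {f : M → N} (hf : Smooth f) {x₀ x : M}
    (hx : x ∈ (chartAt M.Model x₀).source) (hfx : f x ∈ (chartAt N.Model (f x₀)).source) :
    Function.Surjective (fderiv ℝ (chartRep f x₀) (chartAt M.Model x₀ x)) ↔
      Function.Surjective (tangentMap f x) := by
  obtain ⟨A, B, hb1, hb2, h'⟩ := exists_fderiv_chartRep hf hx hfx
  rw [h']
  constructor
  · intro hs y
    obtain ⟨z, hz⟩ := hs (B y)
    exact ⟨A z, hb2.injective hz⟩
  · intro hs
    exact hb2.surjective.comp (hs.comp hb1.surjective)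

theorem isOpen_setOf_surjective_tangentMap {f : M → N} (hf : Smooth f) :
    IsOpen {x | Function.Surjective (tangentMap f x)} := by
  rw [isOpen_iff_mem_nhds]
  intro x hx
  have hs := mem_chart_source M.Model x
  have ht := mem_chart_source N.Model (f x)
  have hc : ContinuousAt (fun z => fderiv ℝ (chartRep f x) (chartAt M.Model x z)) x :=
    ContinuousAt.comp (f := chartAt M.Model x)
      ((chartRep_contDiffAt hf hs ht).continuousAt_fderiv (by simp))
      ((chartAt M.Model x).continuousAt hs)
  filter_upwards [(chartAt M.Model x).open_source.mem_nhds hs,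
    hf.continuous.continuousAt ((chartAt N.Model (f x)).open_source.mem_nhds ht),
    hc (isOpen_setOf_surjective_clm.mem_nhds ((chartRep_surjective_iff hf hs ht).2 hx))]
    with z h1 h2 h3
  exact (chartRep_surjective_iff hf h1 h2).1 h3

/-- A smooth map is open at the points at which it is a submersion. -/
theorem image_mem_nhds_of_surjective_tangentMap {f : M → N} (hf : Smooth f) {x : M}
    (hx : Function.Surjective (tangentMap f x)) {U : Set M} (hU : U ∈ 𝓝 x) : f '' U ∈ 𝓝 (f x) := by
  have hs := mem_chart_source M.Model x
  have ht := mem_chart_source N.Model (f x)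
  have hF := (chartRep_contDiffAt hf hs ht).hasStrictFDerivAt (by simp)
  have hm := hF.map_nhds_eq_of_surj
    (LinearMap.range_eq_top.2 ((chartRep_surjective_iff hf hs ht).2 hx))
  have e : chartRep f x (chartAt M.Model x x) = chartAt N.Model (f x) (f x) := by
    simp only [chartRep]
    rw [(chartAt M.Model x).left_inv hs]
  rw [e] at hm
  have h0 : (fun z => chartAt N.Model (f x) (f z)) =ᶠ[𝓝 x]
      (fun z => chartRep f x (chartAt M.Model x z)) := by
    filter_upwards [(chartAt M.Model x).open_source.mem_nhds hs] with z hz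
    simp only [chartRep]
    rw [(chartAt M.Model x).left_inv hz]
  have h1 : Filter.map (fun z => chartAt N.Model (f x) (f z)) (𝓝 x) =
      𝓝 (chartAt N.Model (f x) (f x)) := by
    rw [Filter.map_congr h0, ← hm, ← (chartAt M.Model x).map_nhds_eq hs, Filter.map_map]
    rfl
  have h2 : Filter.map f (𝓝 x) = 𝓝 (f x) := by
    have h3 : Filter.map (chartAt N.Model (f x)).symm
        (Filter.map (fun z => chartAt N.Model (f x) (f z)) (𝓝 x)) = Filter.map f (𝓝 x) := by
      rw [Filter.map_map]
      refine Filter.map_congr ?_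
      filter_upwards [hf.continuous.continuousAt
        ((chartAt N.Model (f x)).open_source.mem_nhds ht)] with z hz
      exact (chartAt N.Model (f x)).left_inv hz
    rw [← h3, h1]
    exact (chartAt N.Model (f x)).symm_map_nhds_eq ht
  rw [← h2]
  exact Filter.image_mem_map hU

end Submersion

/-! ### Embedded submanifolds -/

/-- A slice of a subset `S` of a manifold: mutually inverse smooth maps between an open piece `S ∩
O` of `S` and an open subset `V` of a normed space `K`, the first one being the restriction of a
smooth map on `O`. -/
structure SlicePatch (M : SmoothMfd.{u}) (S : Set M) (K : Type) [NormedAddCommGroup K]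
    [NormedSpace ℝ K] where
  O : Set M
  V : Set K
  r : M → K
  j : K → M
  open_O : IsOpen O
  open_V : IsOpen V
  smooth_r : ContMDiffOn M.I 𝓘(ℝ, K) ∞ r O
  smooth_j : ContMDiffOn 𝓘(ℝ, K) M.I ∞ j V
  j_mem : ∀ v ∈ V, j v ∈ S
  j_mem_O : ∀ v ∈ V, j v ∈ O
  r_mem : ∀ x ∈ S, x ∈ O → r x ∈ V
  r_j : ∀ v ∈ V, r (j v) = v
  j_r : ∀ x ∈ S, x ∈ O → j (r x) = x

/-- The map `i : N → M` is a smooth embedding with image `S`, and a map into `N` is smooth as soon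
as its composition with `i` is. -/
structure IsSubmanifold {M N : SmoothMfd.{u}} (i : N → M) (S : Set M) : Prop where
  isEmbedding : IsEmbedding i
  range_eq : Set.range i = S
  lift : ∀ {E' : Type} [NormedAddCommGroup E'] [NormedSpace ℝ E'] {H' : Type} [TopologicalSpace H']
    {I' : ModelWithCorners ℝ E' H'} {M' : Type u} [TopologicalSpace M'] [ChartedSpace H' M']
    {c : M' → N} {A : Set M'},
    ContMDiffOn I' M.I ∞ (fun y => i (c y)) A → ContMDiffOn I' N.I ∞ c A

namespace IsSubmanifold

variable {M N Q : SmoothMfd.{u}} {i : N → M} {S : Set M}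

theorem smooth (h : IsSubmanifold i S) : Smooth i := h.isEmbedding.1

theorem injective (h : IsSubmanifold i S) : Function.Injective i := h.isEmbedding.2.1.injective

theorem mem (h : IsSubmanifold i S) (x : N) : i x ∈ S := h.range_eq ▸ Set.mem_range_self x

theorem exists_eq (h : IsSubmanifold i S) {y : M} (hy : y ∈ S) : ∃ x, i x = y := by
  rw [← h.range_eq] at hy; exact hy

theorem smooth_of_comp (h : IsSubmanifold i S) {c : Q → N} (hc : Smooth (fun y => i (c y))) :
    Smooth c :=
  contMDiffOn_univ.1 (h.lift (contMDiffOn_univ.2 hc))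

end IsSubmanifold

namespace SlicePatch

variable {M : SmoothMfd.{u}} {S : Set M} {K : Type} [NormedAddCommGroup K] [NormedSpace ℝ K]

open Classical in
/-- The chart of `S` given by a slice. -/
def chart (P : SlicePatch M S K) (p : S) : OpenPartialHomeomorph S K where
  toFun x := P.r x
  invFun v := if h : P.j v ∈ S then ⟨P.j v, h⟩ else p
  source := {x | x.1 ∈ P.O}
  target := P.V
  map_source' x hx := P.r_mem _ x.2 hx
  map_target' v hv := by
    simp only [dif_pos (P.j_mem v hv)]
    exact P.j_mem_O v hv
  left_inv' x hx := by
    have h : P.j (P.r x) ∈ S := P.j_mem _ (P.r_mem _ x.2 hx)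
    rw [dif_pos h]
    exact Subtype.ext (P.j_r _ x.2 hx)
  right_inv' v hv := by
    simp only [dif_pos (P.j_mem v hv)]
    exact P.r_j v hv
  open_source := P.open_O.preimage continuous_subtype_val
  open_target := P.open_V
  continuousOn_toFun := P.smooth_r.continuousOn.comp continuous_subtype_val.continuousOn
    fun _ hx => hx
  continuousOn_invFun := by
    rw [Topology.IsInducing.subtypeVal.continuousOn_iff]
    refine P.smooth_j.continuousOn.congr fun v hv => ?_
    simp only [Function.comp, dif_pos (P.j_mem v hv)]

theorem coe_chart_symm (P : SlicePatch M S K) (p : S) {v : K} (hv : v ∈ P.V) :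
    ((P.chart p).symm v : M) = P.j v := by
  classical
  exact congrArg Subtype.val (dif_pos (P.j_mem v hv))

variable [FiniteDimensional ℝ K]

/-- A subset that is covered by slices is a manifold. -/
def toMfd (P : S → SlicePatch M S K) (hP : ∀ p, p.1 ∈ (P p).O) : SmoothMfd.{u} :=
  letI : ChartedSpace K S :=
    { atlas := Set.range fun p => (P p).chart p
      chartAt := fun p => (P p).chart p
      mem_chart_source := hP
      chart_mem_atlas := fun p => Set.mem_range_self p }
  { carrier := S
    Model := K
    mfd := by
      apply isManifold_of_contDiffOn
      rintro _ _ ⟨p, rfl⟩ ⟨q, rfl⟩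
      simp only [modelWithCornersSelf_coe, modelWithCornersSelf_coe_symm, Function.comp_id,
        Function.id_comp, Set.range_id, Set.inter_univ, Set.preimage_id]
      rw [← contMDiffOn_iff_contDiffOn]
      have h : ContMDiffOn 𝓘(ℝ, K) 𝓘(ℝ, K) ∞ (fun v => (P q).r ((P p).j v))
          (((P p).chart p).symm ≫ₕ (P q).chart q).source := by
        refine (P q).smooth_r.comp ((P p).smooth_j.mono ?_) ?_
        · intro v hv
          exact hv.1
        · intro v hv
          have h2 : (((P p).chart p).symm v : M) ∈ (P q).O := hv.2
          rwa [coe_chart_symm _ _ hv.1] at h2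
      refine h.congr fun v hv => ?_
      change (P q).r (((P p).chart p).symm v : M) = _
      rw [coe_chart_symm _ _ hv.1] }

/-- The inclusion of the manifold defined by slices. -/
def incl (P : S → SlicePatch M S K) (hP : ∀ p, p.1 ∈ (P p).O) : toMfd P hP → M :=
  fun x => Subtype.val (p := (· ∈ S)) x

/-- Smoothness of a map into the manifold defined by slices is tested after inclusion, since the
charts are restrictions of smooth maps of the ambient manifold. -/
theorem isSubmanifold_incl (P : S → SlicePatch M S K) (hP : ∀ p, p.1 ∈ (P p).O) :
    IsSubmanifold (incl P hP) S := by
  have hemb : Topology.IsEmbedding (incl P hP) := Topology.IsEmbedding.subtypeVal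
  have hsm : Smooth (incl P hP) := by
    intro p
    have h1 := (contMDiffOn_chart (I := (toMfd P hP).I) (n := ∞) (x := p)).contMDiffAt
      ((chartAt (toMfd P hP).Model p).open_source.mem_nhds (mem_chart_source _ p))
    have hpO : (p.1 : M) ∈ (P p).O := hP p
    have h2 : ContMDiffAt 𝓘(ℝ, K) M.I ∞ (P p).j (chartAt (toMfd P hP).Model p p) :=
      (P p).smooth_j.contMDiffAt ((P p).open_V.mem_nhds ((P p).r_mem _ p.2 hpO))
    refine (ContMDiffAt.comp p h2 h1).congr_of_eventuallyEq ?_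
    filter_upwards [(chartAt (toMfd P hP).Model p).open_source.mem_nhds (mem_chart_source _ p)]
      with x hx
    exact ((P p).j_r _ x.2 hx).symm
  refine ⟨⟨hsm, hemb, fun p => ?_⟩, Subtype.range_coe, ?_⟩
  · have hpO : incl P hP p ∈ (P p).O := hP p
    have hr : MDifferentiableAt M.I 𝓘(ℝ, K) (P p).r (incl P hP p) :=
      ((P p).smooth_r.contMDiffAt ((P p).open_O.mem_nhds hpO)).mdifferentiableAt (by simp)
    have hc := mfderiv_comp p hr (hsm.mdiff p)
    have hinj : Function.Injective (mfderiv (toMfd P hP).I 𝓘(ℝ, K)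
        ((P p).r ∘ incl P hP) p) :=
      (mdifferentiable_chart (I := (toMfd P hP).I) p).mfderiv_injective (mem_chart_source _ p)
    rw [hc] at hinj
    exact Function.Injective.of_comp (f := mfderiv M.I 𝓘(ℝ, K) (P p).r (incl P hP p)) hinj
  · intro E' _ _ H' _ I' M' _ _ c A hc x hx
    have hcont : ContinuousWithinAt c A x :=
      hemb.isInducing.continuousWithinAt_iff.2 (hc x hx).continuousWithinAt
    have hpO : incl P hP (c x) ∈ (P (c x)).O := hP (c x)
    have h1 : ContMDiffWithinAt I' 𝓘(ℝ, K) ∞ (fun y => (P (c x)).r (incl P hP (c y))) A x :=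
      ((P (c x)).smooth_r.contMDiffAt ((P (c x)).open_O.mem_nhds hpO)).comp_contMDiffWithinAt x
        (hc x hx)
    have h2 := (contMDiffOn_chart_symm (I := (toMfd P hP).I) (n := ∞) (x := c x)).contMDiffAt
      ((chartAt (toMfd P hP).Model (c x)).open_target.mem_nhds (mem_chart_target _ (c x)))
    have hs := (chartAt (toMfd P hP).Model (c x)).open_source.mem_nhds (mem_chart_source _ (c x))
    refine (ContMDiffAt.comp_contMDiffWithinAt x h2 h1).congr_of_eventuallyEq ?_ ?_
    · filter_upwards [hcont hs] with y hy
      exact ((chartAt (toMfd P hP).Model (c x)).left_inv hy).symm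
    · exact ((chartAt (toMfd P hP).Model (c x)).left_inv (mem_chart_source _ (c x))).symm

end SlicePatch

/-! ### Equalizers of transverse maps -/

section Equalizer

/-- A surjective linear map is the first component of an isomorphism with a product. -/
theorem exists_prod_equiv_of_surjective {V E : Type*} [NormedAddCommGroup V] [NormedSpace ℝ V]
    [FiniteDimensional ℝ V] [NormedAddCommGroup E] [NormedSpace ℝ E] [FiniteDimensional ℝ E]
    (A : V →L[ℝ] E) (hA : Function.Surjective A) (K : Type*) [NormedAddCommGroup K]
    [NormedSpace ℝ K] [FiniteDimensional ℝ K]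
    (hK : Module.finrank ℝ K = Module.finrank ℝ V - Module.finrank ℝ E) :
    ∃ (Q : V →L[ℝ] K) (L : V ≃L[ℝ] E × K), (L : V →L[ℝ] E × K) = A.prod Q := by
  have hrk := LinearMap.finrank_range_add_finrank_ker (A : V →ₗ[ℝ] E)
  rw [LinearMap.range_eq_top.2 hA, finrank_top] at hrk
  obtain ⟨π, hπ⟩ := (LinearMap.ker (A : V →ₗ[ℝ] E)).subtype.exists_leftInverse_of_injective
    (Submodule.ker_subtype _)
  have hK' : Module.finrank ℝ (LinearMap.ker (A : V →ₗ[ℝ] E)) = Module.finrank ℝ K := by omega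
  let Q' : V →ₗ[ℝ] K := (LinearEquiv.ofFinrankEq _ _ hK').toLinearMap ∘ₗ π
  have hinj : Function.Injective ((A : V →ₗ[ℝ] E).prod Q') := by
    rw [injective_iff_map_eq_zero]
    intro v hv
    have h1 : A v = 0 := congrArg Prod.fst hv
    have h2 : Q' v = 0 := congrArg Prod.snd hv
    have h3 : π v = 0 := (LinearEquiv.map_eq_zero_iff _).1 h2
    have h4 := LinearMap.congr_fun hπ ⟨v, h1⟩
    simp only [LinearMap.comp_apply, Submodule.subtype_apply, LinearMap.id_apply] at h4
    rw [h3] at h4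
    exact (congrArg Subtype.val h4).symm
  have hfr : Module.finrank ℝ V = Module.finrank ℝ (E × K) := by
    rw [Module.finrank_prod]; omega
  refine ⟨LinearMap.toContinuousLinearMap Q',
    (LinearEquiv.ofInjectiveOfFinrankEq _ hinj hfr).toContinuousLinearEquiv, ?_⟩
  ext v <;> rfl

variable {M : SmoothMfd.{u}} {E : Type*} [NormedAddCommGroup E] [NormedSpace ℝ E]
  [FiniteDimensional ℝ E] {C : Type*} [TopologicalSpace C] [ChartedSpace E C]
  [IsManifold 𝓘(ℝ, E) ∞ C]

variable (E) in
/-- The tangent map of a map from a manifold `M` to any manifold modelled on `E`, the preferred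
charts being used to identify tangent spaces with model spaces. -/
def derivAt (a : M → C) (p : M) : M.Model →L[ℝ] E := mfderiv M.I 𝓘(ℝ, E) a p

/-- The inverse function theorem provides the slices: near `p`, the difference of `a` and `b` in
charts and a linear map `Q` to `K` make up a local diffeomorphism `Φ` to `E × K`, and `a = b` is
the inverse image of `0 × K`. -/
theorem exists_slicePatch_equalizer {a b : M → C} (ha : ContMDiff M.I 𝓘(ℝ, E) ∞ a)
    (hb : ContMDiff M.I 𝓘(ℝ, E) ∞ b) {p : M} (hp : a p = b p)
    (hs : Function.Surjective (derivAt E a p - derivAt E b p))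
    (K : Type) [NormedAddCommGroup K] [NormedSpace ℝ K] [FiniteDimensional ℝ K]
    (hK : Module.finrank ℝ K = Module.finrank ℝ M.Model - Module.finrank ℝ E) :
    ∃ P : SlicePatch M {x | a x = b x} K, p ∈ P.O := by
  set e := chartAt M.Model p with he
  set e' := chartAt E (a p) with he'
  have hpe : p ∈ e.source := mem_chart_source _ p
  have hae : a p ∈ e'.source := mem_chart_source _ _
  let W : Set M.Model := e.target ∩ e.symm ⁻¹' (a ⁻¹' e'.source ∩ b ⁻¹' e'.source)
  have hWo : IsOpen W := e.isOpen_inter_preimage_symm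
    ((e'.open_source.preimage ha.continuous).inter (e'.open_source.preimage hb.continuous))
  have hpW : e p ∈ W := by
    refine ⟨e.map_source hpe, ?_⟩
    rw [Set.mem_preimage, e.left_inv hpe]
    exact ⟨hae, (hp ▸ hae : b p ∈ e'.source)⟩
  let F : (M → C) → M.Model → E := fun a y => e' (a (e.symm y))
  have hF : ∀ a' : M → C, ContMDiff M.I 𝓘(ℝ, E) ∞ a' → ∀ y ∈ e.target,
      a' (e.symm y) ∈ e'.source → ContDiffAt ℝ ∞ (F a') y := by
    intro a' ha' y hy hy'
    rw [← contMDiffAt_iff_contDiffAt]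
    have h1 : ContMDiffAt 𝓘(ℝ, M.Model) M.I ∞ e.symm y :=
      (contMDiffOn_chart_symm (I := M.I)).contMDiffAt (e.open_target.mem_nhds hy)
    have h2 : ContMDiffAt 𝓘(ℝ, E) 𝓘(ℝ, E) ∞ e' (a' (e.symm y)) :=
      (contMDiffOn_chart (I := 𝓘(ℝ, E))).contMDiffAt (e'.open_source.mem_nhds hy')
    exact ContMDiffAt.comp y (g := fun z => e' (a' z)) (ContMDiffAt.comp _ h2 (ha' _)) h1
  have d1 := mdifferentiable_chart (I := M.I) p
  have d2 := mdifferentiable_chart (I := 𝓘(ℝ, E)) (a p)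
  have hpe' := e.map_source hpe
  let T : M.Model →L[ℝ] M.Model := mfderiv 𝓘(ℝ, M.Model) M.I e.symm (e p)
  let B : E →L[ℝ] E := mfderiv 𝓘(ℝ, E) 𝓘(ℝ, E) e' (a p)
  have hT : Function.Surjective T := (d1.symm.mfderiv_bijective hpe').surjective
  have hB : Function.Surjective B := (d2.mfderiv_bijective hae).surjective
  have hFd : ∀ a' : M → C, ContMDiff M.I 𝓘(ℝ, E) ∞ a' → a' p = a p →
      HasFDerivAt (F a') (B.comp ((derivAt E a' p).comp T)) (e p) := by
    intro a' ha' hap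
    have el : e.symm (e p) = p := e.left_inv hpe
    have hfd : HasMFDerivAt M.I 𝓘(ℝ, E) a' (e.symm (e p))
        (derivAt E a' p) := by
      rw [el]; exact ((ha' p).mdifferentiableAt (by simp)).hasMFDerivAt
    have hgd : HasMFDerivAt 𝓘(ℝ, E) 𝓘(ℝ, E) e' (a' (e.symm (e p))) B := by
      rw [el, hap]; exact (d2.mdifferentiableAt hae).hasMFDerivAt
    have hc := HasMFDerivAt.comp _ hfd (d1.mdifferentiableAt_symm hpe').hasMFDerivAt
    exact hasMFDerivAt_iff_hasFDerivAt.1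
      (HasMFDerivAt.comp (f := a' ∘ e.symm) (e p) hgd hc)
  let A : M.Model →L[ℝ] E := B.comp ((derivAt E a p - derivAt E b p).comp T)
  have hAs : Function.Surjective A := hB.comp (hs.comp hT)
  obtain ⟨Q, L, hL⟩ := exists_prod_equiv_of_surjective A hAs K hK
  let Φ : M.Model → E × K := fun y => (F a y - F b y, Q y)
  have hΦ : ∀ y ∈ W, ContDiffAt ℝ ∞ Φ y := fun y hy =>
    ((hF a ha y hy.1 hy.2.1).sub (hF b hb y hy.1 hy.2.2)).prodMk Q.contDiff.contDiffAt
  have hΦd : HasFDerivAt Φ (L : M.Model →L[ℝ] E × K) (e p) := by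
    rw [hL]
    refine HasFDerivAt.prodMk ?_ Q.hasFDerivAt
    have := (hFd a ha rfl).sub (hFd b hb hp.symm)
    rw [← ContinuousLinearMap.comp_sub, ← ContinuousLinearMap.sub_comp] at this
    exact this
  -- On `W'` the derivative of `Φ` stays invertible, hence the inverse of `Φ` is smooth there.
  let W' : Set M.Model := W ∩ (fderiv ℝ Φ) ⁻¹'
    Set.range ((↑) : (M.Model ≃L[ℝ] E × K) → M.Model →L[ℝ] E × K)
  have hW'o : IsOpen W' := by
    refine ContinuousOn.isOpen_inter_preimage ?_ hWo ContinuousLinearEquiv.isOpen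
    intro y hy
    exact ((hΦ y hy).continuousAt_fderiv (by simp)).continuousWithinAt
  have hpW' : e p ∈ W' := ⟨hpW, L, hΦd.fderiv.symm⟩
  let Ψ := ((hΦ _ hpW).toOpenPartialHomeomorph Φ hΦd (by simp)).restrOpen W' hW'o
  have hΨ : ∀ y, Ψ y = Φ y := fun _ => rfl
  have hpΨ : e p ∈ Ψ.source :=
    ⟨(hΦ _ hpW).mem_toOpenPartialHomeomorph_source hΦd (by simp), hpW'⟩
  have hΨs : ∀ y ∈ Ψ.source, y ∈ W' := fun y hy => hy.2
  have hΨsm : ∀ z ∈ Ψ.target, ContDiffAt ℝ ∞ Ψ.symm z := by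
    intro z hz
    obtain ⟨hy, L', hL'⟩ := hΨs _ (Ψ.map_target hz)
    refine Ψ.contDiffAt_symm hz (f₀' := L') ?_ (hΦ _ hy)
    rw [hL']
    exact ((hΦ _ hy).differentiableAt (by simp)).hasFDerivAt
  have hzero : ∀ y ∈ W, (F a y - F b y = 0 ↔ a (e.symm y) = b (e.symm y)) := by
    intro y hy
    rw [sub_eq_zero]
    exact ⟨fun h => e'.injOn hy.2.1 hy.2.2 h, fun h => congrArg e' h⟩
  have hj0 : ∀ v : K, ((0 : E), v) ∈ Ψ.target → Φ (Ψ.symm ((0 : E), v)) = (0, v) :=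
    fun v hv => Ψ.right_inv hv
  have hjW : ∀ v : K, ((0 : E), v) ∈ Ψ.target → Ψ.symm ((0 : E), v) ∈ W :=
    fun v hv => (hΨs _ (Ψ.map_target hv)).1
  have hee : ∀ v : K, ((0 : E), v) ∈ Ψ.target →
      e (e.symm (Ψ.symm ((0 : E), v))) = Ψ.symm ((0 : E), v) :=
    fun v hv => e.right_inv (hjW v hv).1
  have hrx : ∀ x, a x = b x → x ∈ e.source ∩ e ⁻¹' Ψ.source → Φ (e x) = (0, Q (e x)) := by
    intro x hx hxO
    refine Prod.ext ?_ rfl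
    rw [hzero _ (hΨs _ hxO.2).1, e.left_inv hxO.1]
    exact hx
  refine ⟨{
    O := e.source ∩ e ⁻¹' Ψ.source
    V := {v | ((0 : E), v) ∈ Ψ.target}
    r := fun x => Q (e x)
    j := fun v => e.symm (Ψ.symm ((0 : E), v))
    open_O := e.isOpen_inter_preimage Ψ.open_source
    open_V := Ψ.open_target.preimage (by fun_prop)
    smooth_r := ?_
    smooth_j := ?_
    j_mem := fun v hv => ?_
    j_mem_O := fun v hv => ?_
    r_mem := fun x hx hxO => ?_
    r_j := fun v hv => ?_
    j_r := fun x hx hxO => ?_ }, hpe, hpΨ⟩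
  · exact (Q.contMDiff (n := ∞)).comp_contMDiffOn
      ((contMDiffOn_chart (I := M.I)).mono Set.inter_subset_left)
  · intro v hv
    have h1 : ContDiffAt ℝ ∞ (fun v : K => Ψ.symm ((0 : E), v)) v :=
      ContDiffAt.comp v (hΨsm _ hv) (contDiffAt_const.prodMk contDiffAt_id)
    have h2 : ContMDiffAt 𝓘(ℝ, M.Model) M.I ∞ e.symm (Ψ.symm ((0 : E), v)) :=
      (contMDiffOn_chart_symm (I := M.I)).contMDiffAt (e.open_target.mem_nhds (hjW v hv).1)
    exact (ContMDiffAt.comp v h2 h1.contMDiffAt).contMDiffWithinAt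
  · exact (hzero _ (hjW v hv)).1 (congrArg Prod.fst (hj0 v hv))
  · refine ⟨e.map_target (hjW v hv).1, ?_⟩
    rw [Set.mem_preimage, hee v hv]
    exact Ψ.map_target hv
  · have := Ψ.map_source hxO.2
    rw [hΨ, hrx x hx hxO] at this
    exact this
  · simp only [hee v hv]
    exact congrArg Prod.snd (hj0 v hv)
  · simp only [← hrx x hx hxO]
    rw [← hΨ, Ψ.left_inv hxO.2, e.left_inv hxO.1]

/-- The equalizer of two smooth maps whose difference is infinitesimally surjective along it is an
embedded submanifold, and its tangent spaces are the equalizers of the tangent maps. -/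
theorem exists_submanifold_equalizer {a b : M → C} (ha : ContMDiff M.I 𝓘(ℝ, E) ∞ a)
    (hb : ContMDiff M.I 𝓘(ℝ, E) ∞ b)
    (hs : ∀ p, a p = b p → Function.Surjective (derivAt E a p - derivAt E b p)) :
    ∃ (N : SmoothMfd.{u}) (i : N → M), IsSubmanifold i {x | a x = b x} ∧
      ∀ (x : N) (v : M.Model), v ∈ Set.range (tangentMap i x) ↔
        derivAt E a (i x) v = derivAt E b (i x) v := by
  let K := EuclideanSpace ℝ (Fin (Module.finrank ℝ M.Model - Module.finrank ℝ E))
  have hK : Module.finrank ℝ K = Module.finrank ℝ M.Model - Module.finrank ℝ E :=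
    finrank_euclideanSpace_fin
  choose P hP using fun p : {x | a x = b x} =>
    exists_slicePatch_equalizer ha hb p.2 (hs p.1 p.2) K hK
  have hsub := SlicePatch.isSubmanifold_incl P hP
  refine ⟨SlicePatch.toMfd P hP, SlicePatch.incl P hP, hsub, fun x => ?_⟩
  set i := SlicePatch.incl P hP
  set y := i x
  have hy : a y = b y := hsub.mem x
  let da : M.Model →L[ℝ] E := derivAt E a y
  let db : M.Model →L[ℝ] E := derivAt E b y
  have hle : LinearMap.range (tangentMap i x : (SlicePatch.toMfd P hP).Model →ₗ[ℝ] M.Model) ≤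
      LinearMap.ker ((da - db : M.Model →L[ℝ] E) : M.Model →ₗ[ℝ] E) := by
    rintro _ ⟨w, rfl⟩
    have h1 := mfderiv_comp x ((ha y).mdifferentiableAt (by simp)) (hsub.smooth.mdiff x)
    have h2 := mfderiv_comp x ((hb y).mdifferentiableAt (by simp)) (hsub.smooth.mdiff x)
    have h3 : a ∘ i = b ∘ i := funext fun z => hsub.mem z
    rw [h3] at h1
    have h4 := h1.symm.trans h2
    have h5 : da (tangentMap i x w) = db (tangentMap i x w) := DFunLike.congr_fun h4 w
    exact sub_eq_zero.2 h5
  have hrk := LinearMap.finrank_range_add_finrank_ker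
    ((da - db : M.Model →L[ℝ] E) : M.Model →ₗ[ℝ] E)
  rw [LinearMap.range_eq_top.2 (hs y hy), finrank_top] at hrk
  have hr : Module.finrank ℝ
      (LinearMap.range (tangentMap i x : (SlicePatch.toMfd P hP).Model →ₗ[ℝ] M.Model)) =
        Module.finrank ℝ K :=
    LinearMap.finrank_range_of_inj (hsub.isEmbedding.2.2 x)
  have heq := Submodule.eq_of_le_of_finrank_eq hle (by omega)
  intro v
  have hv : v ∈ LinearMap.range (tangentMap i x : (SlicePatch.toMfd P hP).Model →ₗ[ℝ] M.Model) ↔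
    v ∈ LinearMap.ker ((da - db : M.Model →L[ℝ] E) : M.Model →ₗ[ℝ] E) := by rw [heq]
  exact hv.trans sub_eq_zero

end Equalizer

section SmoothEqualizer

variable {M N C A B : SmoothMfd.{u}}

theorem exists_equalizer {a b : M → C} (ha : Smooth a) (hb : Smooth b)
    (hs : ∀ p, a p = b p → ∀ w, ∃ v, tangentMap a p v - tangentMap b p v = w) :
    ∃ (N : SmoothMfd.{u}) (i : N → M), IsSubmanifold i {x | a x = b x} ∧
      ∀ (x : N) (v : M.Model), v ∈ Set.range (tangentMap i x) ↔
        tangentMap a (i x) v = tangentMap b (i x) v :=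
  exists_submanifold_equalizer ha hb hs

theorem exists_fibre {a : M → C} (ha : IsSubmersion a) (c : C) :
    ∃ (N : SmoothMfd.{u}) (i : N → M), IsSubmanifold i {x | a x = c} ∧
      ∀ (x : N) (v : M.Model), v ∈ Set.range (tangentMap i x) ↔ tangentMap a (i x) v = 0 := by
  obtain ⟨N, i, h, ht⟩ := exists_equalizer ha.1 (smooth_const c) (by
    intro p _ w
    obtain ⟨v, hv⟩ := ha.2 p w
    refine ⟨v, ?_⟩
    rw [tangentMap_const, hv]
    exact sub_zero w)
  refine ⟨N, i, h, fun x v => ?_⟩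
  rw [ht, tangentMap_const]
  rfl

open SmoothMfd

/-- The fibred product of a submersion and a smooth map, with its tangent spaces. -/
theorem exists_fibredProduct {f : A → C} {g : B → C} (hf : IsSubmersion f) (hg : Smooth g) :
    ∃ (P : SmoothMfd.{u}) (p : P → A) (q : P → B), IsFibredProduct f g p q ∧
      (∀ a b, f a = g b → ∃ z, p z = a ∧ q z = b) ∧
      ∀ z v w, tangentMap f (p z) v = tangentMap g (q z) w →
        ∃ y, tangentMap p z y = v ∧ tangentMap q z y = w := by
  have hf' : Smooth (fun x : A.prod B => f (fst x)) := hf.1.comp smooth_fst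
  have hg' : Smooth (fun x : A.prod B => g (snd x)) := hg.comp smooth_snd
  obtain ⟨P, i, h, ht⟩ := exists_equalizer hf' hg' (by
    intro x _ w
    obtain ⟨v, hv⟩ := hf.2 (fst x) w
    refine ⟨tangentPair v 0, ?_⟩
    rw [tangentMap_comp_fst hf.1, tangentMap_comp_snd hg, hv, map_zero, sub_zero])
  have hp : Smooth (fun z => fst (i z)) := smooth_fst.comp h.smooth
  have hq : Smooth (fun z => snd (i z)) := smooth_snd.comp h.smooth
  refine ⟨P, fun z => fst (i z), fun z => snd (i z), ⟨hp, hq, fun z => h.mem z, ?_⟩, ?_, ?_⟩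
  · intro M a b ha hb hab
    choose c hc using fun m => h.exists_eq (y := pair (a m) (b m)) (hab m)
    refine ⟨c, ⟨h.smooth_of_comp ?_, fun m => by rw [hc]; rfl, fun m => by rw [hc]; rfl⟩, ?_⟩
    · rw [funext hc]
      exact ha.pair hb
    · rintro c' ⟨-, h1, h2⟩
      funext m
      apply h.injective
      rw [hc, ← h1, ← h2, pair_fst_snd]
  · intro a b hab
    obtain ⟨z, hz⟩ := h.exists_eq (y := pair a b) hab
    exact ⟨z, by simp only [hz, fst_pair], by simp only [hz, snd_pair]⟩
  · intro z v w hvw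
    obtain ⟨y, hy⟩ := (ht z (tangentPair v w)).2 (by
      rw [tangentMap_comp_fst hf.1, tangentMap_comp_snd hg]; exact hvw)
    refine ⟨y, ?_, ?_⟩
    · rw [tangentMap_comp_apply smooth_fst h.smooth, hy, tangentMap_fst]
    · rw [tangentMap_comp_apply smooth_snd h.smooth, hy, tangentMap_snd]

end SmoothEqualizer

/-! ### Maps of constant rank -/

/-- A map whose derivatives near `y₀` have kernels at least as large as at `y₀` and that takes its
value at `y₀` only there is immersive at `y₀`: otherwise it would be constant along a submanifold
tangent to the kernels. -/
theorem injective_fderiv_of_finrank_ker_le {E F : Type} [NormedAddCommGroup E] [NormedSpace ℝ E]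
    [FiniteDimensional ℝ E] [NormedAddCommGroup F] [NormedSpace ℝ F] [FiniteDimensional ℝ F]
    {f : E → F} {y₀ : E} (hf : ContDiffAt ℝ ∞ f y₀)
    (hk : ∀ᶠ y in 𝓝 y₀, Module.finrank ℝ (LinearMap.ker (fderiv ℝ f y₀ : E →ₗ[ℝ] F)) ≤
      Module.finrank ℝ (LinearMap.ker (fderiv ℝ f y : E →ₗ[ℝ] F)))
    (hi : ∀ᶠ y in 𝓝 y₀, f y = f y₀ → y = y₀) : Function.Injective (fderiv ℝ f y₀) := by
  set A := fderiv ℝ f y₀ with hA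
  let R := LinearMap.range (A : E →ₗ[ℝ] F)
  let K := LinearMap.ker (A : E →ₗ[ℝ] F)
  obtain ⟨π, hπ⟩ := R.subtype.exists_leftInverse_of_injective (Submodule.ker_subtype _)
  let P : F →L[ℝ] R := LinearMap.toContinuousLinearMap π
  have hPs : Function.Surjective (P.comp A) := by
    rintro ⟨_, v, rfl⟩
    exact ⟨v, LinearMap.congr_fun hπ ⟨A v, v, rfl⟩⟩
  have hrk := LinearMap.finrank_range_add_finrank_ker (A : E →ₗ[ℝ] F)
  obtain ⟨Q, L, hL⟩ := exists_prod_equiv_of_surjective (P.comp A) hPs K (by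
    change Module.finrank ℝ K = _ - Module.finrank ℝ R
    change Module.finrank ℝ R + Module.finrank ℝ K = _ at hrk
    omega)
  let Φ : E → R × K := fun y => (P (f y), Q y)
  have hev : ∀ᶠ y in 𝓝 y₀, ContDiffAt ℝ 1 f y :=
    (hf.of_le (by simp) : ContDiffAt ℝ 1 f y₀).eventually (by simp)
  have hΦ : ∀ y, ContDiffAt ℝ 1 f y → ContDiffAt ℝ 1 Φ y := fun y hy =>
    (P.contDiff.contDiffAt.comp y hy).prodMk Q.contDiff.contDiffAt
  have hΦ0 := hΦ y₀ hev.self_of_nhds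
  have hΦd : HasFDerivAt Φ (L : E →L[ℝ] R × K) y₀ := by
    rw [hL]
    exact (P.hasFDerivAt.comp y₀
      (hev.self_of_nhds.differentiableAt (by simp)).hasFDerivAt).prodMk Q.hasFDerivAt
  let Ψ := hΦ0.toOpenPartialHomeomorph Φ hΦd (by simp)
  have hy₀Ψ : y₀ ∈ Ψ.source := hΦ0.mem_toOpenPartialHomeomorph_source hΦd (by simp)
  have hΨΦ : ∀ y, Ψ y = Φ y := fun _ => rfl
  have hgood : ∀ᶠ y in 𝓝 y₀, y ∈ Ψ.source ∧ ContDiffAt ℝ 1 f y ∧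
      (∃ L' : E ≃L[ℝ] R × K, (L' : E →L[ℝ] R × K) = fderiv ℝ Φ y) ∧
      Function.Surjective (P.comp (fderiv ℝ f y)) ∧ Module.finrank ℝ K ≤
        Module.finrank ℝ (LinearMap.ker (fderiv ℝ f y : E →ₗ[ℝ] F)) ∧ (f y = f y₀ → y = y₀) := by
    refine Filter.Eventually.and (Ψ.open_source.mem_nhds hy₀Ψ) (hev.and (Filter.Eventually.and ?_
      (Filter.Eventually.and ?_ (hk.and hi))))
    · exact (hΦ0.continuousAt_fderiv (by simp)).preimage_mem_nhds
        (ContinuousLinearEquiv.isOpen.mem_nhds ⟨L, hΦd.fderiv.symm⟩)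
    · have hc : ContinuousAt (fun y => P.comp (fderiv ℝ f y)) y₀ :=
        (continuous_const.clm_comp continuous_id).continuousAt.comp
          (hev.self_of_nhds.continuousAt_fderiv (by simp))
      exact hc.preimage_mem_nhds (isOpen_setOf_surjective_clm.mem_nhds hPs)
  -- The points `j k` near `y₀` on which `P ∘ f` is constant, parametrized by the kernel.
  let c : K → R × K := fun k => (P (f y₀), Q y₀ + k)
  have hc0 : c 0 = Ψ y₀ := by rw [hΨΦ]; simp [c, Φ]
  let j : K → E := fun k => Ψ.symm (c k)
  have hj0 : j 0 = y₀ := by simp only [j, hc0]; exact Ψ.left_inv hy₀Ψ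
  have hccont : Continuous c := by fun_prop
  have hct : ∀ᶠ k in 𝓝 (0 : K), c k ∈ Ψ.target :=
    hccont.continuousAt.preimage_mem_nhds
      (Ψ.open_target.mem_nhds (hc0 ▸ Ψ.map_source hy₀Ψ))
  have hjc : ContinuousAt j 0 := by
    refine ContinuousAt.comp ?_ hccont.continuousAt
    rw [hc0]
    exact Ψ.continuousAt_symm (Ψ.map_source hy₀Ψ)
  have hjt : Filter.Tendsto j (𝓝 0) (𝓝 y₀) := by
    have h := hjc.tendsto
    rwa [hj0] at h
  have hjg := hjt.eventually hgood
  obtain ⟨ε, hε, hball⟩ := Metric.eventually_nhds_iff_ball.1 (hct.and hjg)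
  have hΦj : ∀ k ∈ Metric.ball (0 : K) ε, Φ (j k) = c k := fun k hk =>
    Ψ.right_inv (hball k hk).1
  have hderiv : ∀ k ∈ Metric.ball (0 : K) ε, HasFDerivAt (fun k => f (j k)) (0 : K →L[ℝ] F) k := by
    intro k hk
    obtain ⟨hct, hs, hfk, ⟨L', hL'⟩, hsur, hdim, -⟩ := hball k hk
    have hsymm : ContDiffAt ℝ 1 Ψ.symm (c k) := by
      refine Ψ.contDiffAt_symm hct (f₀' := L') ?_ (hΦ _ hfk)
      rw [hL']
      exact ((hΦ _ hfk).differentiableAt (by simp)).hasFDerivAt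
    have hjd : HasFDerivAt j (fderiv ℝ j k) k := by
      have : ContDiffAt ℝ 1 j k := hsymm.comp k (by fun_prop)
      exact (this.differentiableAt (by simp)).hasFDerivAt
    have hfj := (hfk.differentiableAt (by simp)).hasFDerivAt.comp k hjd
    have hP : (P.comp (fderiv ℝ f (j k))).comp (fderiv ℝ j k) = 0 := by
      have h1 := P.hasFDerivAt.comp k hfj
      have h2 : (P ∘ (f ∘ j)) =ᶠ[𝓝 k] fun _ => P (f y₀) := by
        filter_upwards [Metric.isOpen_ball.mem_nhds hk] with k' hk'
        exact congrArg Prod.fst (hΦj k' hk')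
      exact (h1.congr_of_eventuallyEq h2.symm).unique (hasFDerivAt_const _ _)
    -- The kernels of `df` and `d(P ∘ f)` have the same dimension, hence `f` is constant there too.
    have hker : LinearMap.ker (fderiv ℝ f (j k) : E →ₗ[ℝ] F) =
        LinearMap.ker (P.comp (fderiv ℝ f (j k)) : E →ₗ[ℝ] R) := by
      refine Submodule.eq_of_le_of_finrank_le (fun v hv => ?_) ?_
      · have hv' : fderiv ℝ f (j k) v = 0 := hv
        change P (fderiv ℝ f (j k) v) = 0
        rw [hv', map_zero]
      · have h3 := LinearMap.finrank_range_add_finrank_ker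
          (P.comp (fderiv ℝ f (j k)) : E →ₗ[ℝ] R)
        rw [LinearMap.range_eq_top.2 hsur, finrank_top] at h3
        change Module.finrank ℝ R + Module.finrank ℝ K = _ at hrk
        omega
    have h0 : (fderiv ℝ f (j k)).comp (fderiv ℝ j k) = 0 := by
      ext v
      have h4 : fderiv ℝ j k v ∈ LinearMap.ker (P.comp (fderiv ℝ f (j k)) : E →ₗ[ℝ] R) :=
        DFunLike.congr_fun hP v
      rw [← hker] at h4
      exact h4
    rw [h0] at hfj
    exact hfj
  have hconst : ∀ k ∈ Metric.ball (0 : K) ε, k = 0 := by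
    intro k hk
    have h0 : (0 : K) ∈ Metric.ball (0 : K) ε := Metric.mem_ball_self hε
    have h1 : f (j k) = f (j 0) :=
      (convex_ball (0 : K) ε).is_const_of_fderivWithin_eq_zero
        (fun k hk => (hderiv k hk).differentiableAt.differentiableWithinAt)
        (fun k hk => by
          rw [fderivWithin_of_isOpen Metric.isOpen_ball hk, (hderiv k hk).fderiv]) hk h0
    have h2 : j k = y₀ := (hball k hk).2.2.2.2.2.2 (h1.trans (congrArg f hj0))
    have h3 : Q (j k) = Q y₀ + k := congrArg Prod.snd (hΦj k hk)
    rw [h2] at h3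
    simpa using h3
  have hK : ∀ v : K, v = 0 := by
    intro v
    by_contra hv
    have hn : 0 < ‖v‖ := norm_pos_iff.2 hv
    have h1 := hconst ((ε / 2 / ‖v‖) • v) (by
      rw [mem_ball_zero_iff, norm_smul, Real.norm_of_nonneg (by positivity),
        div_mul_cancel₀ _ hn.ne']
      linarith)
    rw [smul_eq_zero] at h1
    rcases h1 with h1 | h1
    · have : 0 < ε / 2 / ‖v‖ := by positivity
      linarith
    · exact hv h1
  rw [injective_iff_map_eq_zero]
  intro v hv
  exact congrArg Subtype.val (hK ⟨v, hv⟩)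

/-! ### The tangent spaces of the foliation of a Lie groupoid -/

namespace LieGroupoid

variable (X : LieGroupoid.{u})

theorem inv_unit (x : X.Obj) : X.inv (X.unit x) = X.unit x := by
  have h1 := X.comp_unit (X.inv (X.unit x))
  have h2 := X.inv_comp (X.unit x)
  rw [X.src_inv, X.tgt_unit] at h1
  rw [X.src_unit] at h2
  exact h1.symm.trans h2

theorem inv_inv (f : X.Arr) : X.inv (X.inv f) = f := by
  have h1 := X.comp_assoc (X.inv (X.inv f)) (X.inv f) f (by rw [X.src_inv]) (X.src_inv f)
  rw [X.inv_comp, X.inv_comp, X.src_inv, X.unit_comp] at h1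
  have h2 := X.comp_unit (X.inv (X.inv f))
  rw [X.src_inv, X.tgt_inv] at h2
  exact h2.symm.trans h1.symm

variable {X}

theorem mem_anchorImage {x : X.Obj} {q : X.Obj.Model} : q ∈ X.anchorImage x ↔
    ∃ b, tangentMap X.src (X.unit x) b = 0 ∧ tangentMap X.tgt (X.unit x) b = q := Iff.rfl

theorem mem_anchorImage_iff_src {x : X.Obj} {q : X.Obj.Model} : q ∈ X.anchorImage x ↔
    ∃ b, tangentMap X.tgt (X.unit x) b = 0 ∧ tangentMap X.src (X.unit x) b = q := by
  have hs : ∀ b, tangentMap X.src (X.unit x) (tangentMap X.inv (X.unit x) b) =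
      tangentMap X.tgt (X.unit x) b := by
    intro b
    have h := tangentMap_comp_apply X.src_submersion.1 X.smooth_inv (X.unit x) b
    rw [X.inv_unit] at h
    rw [← h, funext X.src_inv]
  have ht : ∀ b, tangentMap X.tgt (X.unit x) (tangentMap X.inv (X.unit x) b) =
      tangentMap X.src (X.unit x) b := by
    intro b
    have h := tangentMap_comp_apply X.tgt_submersion.1 X.smooth_inv (X.unit x) b
    rw [X.inv_unit] at h
    rw [← h, funext X.tgt_inv]
  rw [mem_anchorImage]
  constructor
  · rintro ⟨b, h1, h2⟩
    exact ⟨_, (ht b).trans h1, (hs b).trans h2⟩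
  · rintro ⟨b, h1, h2⟩
    exact ⟨_, (hs b).trans h1, (ht b).trans h2⟩

/-- Left translation by `f` on the vectors tangent to the fibre of the target map. -/
theorem exists_leftTranslation (f : X.Arr) :
    ∃ Λ : LinearMap.ker (tangentMap X.tgt (X.unit (X.src f)) : X.Arr.Model →ₗ[ℝ] X.Obj.Model) →ₗ[ℝ]
        X.Arr.Model, Function.Injective Λ ∧ ∀ v, tangentMap X.tgt f (Λ v) = 0 ∧
          tangentMap X.src f (Λ v) = tangentMap X.src (X.unit (X.src f)) v := by
  obtain ⟨T, i, hi, hTi⟩ := exists_fibre X.tgt_submersion (X.src f)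
  obtain ⟨T', i', hi', -⟩ := exists_fibre X.tgt_submersion (X.tgt f)
  obtain ⟨k₀, hk₀⟩ := hi.exists_eq (y := X.unit (X.src f)) (X.tgt_unit _)
  have hcomp : ∀ {S : SmoothMfd.{u}} (g : X.Arr) (l : S → X.Arr), Smooth l →
      (∀ k, X.src g = X.tgt (l k)) → Smooth (fun k => X.comp g (l k)) := fun g l hl h =>
    X.smooth_comp.comp_contMDiff ((smooth_const g).pair hl) h
  have hit : ∀ k, X.tgt (i k) = X.src f := fun k => hi.mem k
  have hit' : ∀ k, X.tgt (i' k) = X.tgt f := fun k => hi'.mem k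
  have hL := hcomp f i hi.smooth (fun k => (hit k).symm)
  have hL' := hcomp (X.inv f) i' hi'.smooth (fun k => (X.src_inv f).trans (hit' k).symm)
  choose c hc using fun k => hi'.exists_eq (y := X.comp f (i k))
    (X.tgt_comp _ _ (hit k).symm)
  have hcs : Smooth c := hi'.smooth_of_comp (by rw [funext hc]; exact hL)
  have hLc : ∀ k, X.comp (X.inv f) (i' (c k)) = i k := by
    intro k
    rw [hc, ← X.comp_assoc _ _ _ (X.src_inv f) (hit k).symm, X.inv_comp, ← hit k, X.unit_comp]
  have hinj : Function.Injective (tangentMap (fun k => X.comp f (i k)) k₀) := by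
    have h1 : Function.Injective (tangentMap c k₀) := by
      have h2 := tangentMap_comp hL' hcs k₀
      rw [funext hLc] at h2
      have h3 := hi.isEmbedding.2.2 k₀
      rw [h2] at h3
      exact Function.Injective.of_comp h3
    have h4 := tangentMap_comp hi'.smooth hcs k₀
    rw [funext hc] at h4
    rw [h4]
    exact (hi'.isEmbedding.2.2 _).comp h1
  have hpt : X.comp f (i k₀) = f := by rw [hk₀, X.comp_unit]
  -- The tangent map of the inclusion of the fibre, as an isomorphism onto `ker dt`.
  have hrange : LinearMap.range (tangentMap i k₀ : T.Model →ₗ[ℝ] X.Arr.Model) =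
      LinearMap.ker (tangentMap X.tgt (X.unit (X.src f)) : X.Arr.Model →ₗ[ℝ] X.Obj.Model) := by
    ext v
    rw [← hk₀]
    exact hTi k₀ v
  let e := (LinearEquiv.ofInjective (tangentMap i k₀ : T.Model →ₗ[ℝ] X.Arr.Model)
    (hi.isEmbedding.2.2 k₀)).trans (LinearEquiv.ofEq _ _ hrange)
  have he : ∀ v, tangentMap i k₀ (e.symm v) = v := by
    intro v
    exact congrArg Subtype.val (e.apply_symm_apply v)
  refine ⟨(tangentMap (fun k => X.comp f (i k)) k₀ : T.Model →ₗ[ℝ] X.Arr.Model) ∘ₗ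
    e.symm.toLinearMap,
    hinj.comp e.symm.injective, fun v => ⟨?_, ?_⟩⟩
  · have h := tangentMap_comp_apply X.tgt_submersion.1 hL k₀ (e.symm v)
    rw [hpt, funext fun k => X.tgt_comp f (i k) (hit k).symm, tangentMap_const] at h
    exact h.symm
  · have h := tangentMap_comp_apply X.src_submersion.1 hL k₀ (e.symm v)
    rw [hpt, funext fun k => X.src_comp f (i k) (hit k).symm,
      tangentMap_comp_apply X.src_submersion.1 hi.smooth, he, hk₀] at h
    exact h.symm

/-- Vectors tangent to the foliation at the source of `f` lift to vectors at `f` tangent to the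
fibre of the target map. -/
theorem exists_of_mem_anchorImage_src {f : X.Arr} {q : X.Obj.Model}
    (hq : q ∈ X.anchorImage (X.src f)) :
    ∃ v, tangentMap X.tgt f v = 0 ∧ tangentMap X.src f v = q := by
  obtain ⟨b, h1, h2⟩ := mem_anchorImage_iff_src.1 hq
  obtain ⟨Λ, -, hΛ⟩ := exists_leftTranslation f
  exact ⟨Λ ⟨b, h1⟩, (hΛ _).1, (hΛ _).2.trans h2⟩

/-- The isotropy groups of a foliation groupoid are infinitesimally trivial. -/
theorem IsFoliation.eq_zero_of_mem_ker (hX : X.IsFoliation) (x : X.Obj) (v : X.Arr.Model)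
    (h1 : tangentMap X.src (X.unit x) v = 0) (h2 : tangentMap X.tgt (X.unit x) v = 0) : v = 0 := by
  obtain ⟨S, i, hi, hSi⟩ := exists_fibre X.src_submersion x
  obtain ⟨k₀, hk₀⟩ := hi.exists_eq (y := X.unit x) (X.src_unit _)
  have hti : Smooth fun k => X.tgt (i k) := X.tgt_submersion.1.comp hi.smooth
  have hs : ∀ k, X.src (i k) = x := fun k => hi.mem k
  -- The kernel of `d(t ∘ i)` at `k` is at least as large as at the unit, by left translation.
  have hker : ∀ k, Module.finrank ℝ (LinearMap.ker
      (tangentMap (fun k => X.tgt (i k)) k₀ : S.Model →ₗ[ℝ] X.Obj.Model)) ≤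
      Module.finrank ℝ (LinearMap.ker
        (tangentMap (fun k => X.tgt (i k)) k : S.Model →ₗ[ℝ] X.Obj.Model)) := by
    intro k
    have hΛex := exists_leftTranslation (i k)
    rw [hs] at hΛex
    obtain ⟨Λ, hΛi, hΛ⟩ := hΛex
    have hex : ∀ w : LinearMap.ker
        (tangentMap (fun k => X.tgt (i k)) k₀ : S.Model →ₗ[ℝ] X.Obj.Model),
        tangentMap X.tgt (X.unit x) (tangentMap i k₀ w) = 0 := by
      intro w
      rw [← hk₀, ← tangentMap_comp_apply X.tgt_submersion.1 hi.smooth]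
      exact w.2
    let ι : LinearMap.ker (tangentMap (fun k => X.tgt (i k)) k₀ : S.Model →ₗ[ℝ] X.Obj.Model) →ₗ[ℝ]
        LinearMap.ker (tangentMap X.tgt (X.unit x) : X.Arr.Model →ₗ[ℝ] X.Obj.Model) :=
      LinearMap.codRestrict _ ((tangentMap i k₀ : S.Model →ₗ[ℝ] X.Arr.Model) ∘ₗ
        Submodule.subtype _) hex
    have hιi : Function.Injective ι := by
      intro w w' h
      exact Subtype.ext (hi.isEmbedding.2.2 k₀ (congrArg Subtype.val h))
    have hle : LinearMap.range (Λ ∘ₗ ι) ≤ (LinearMap.ker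
        (tangentMap (fun k => X.tgt (i k)) k : S.Model →ₗ[ℝ] X.Obj.Model)).map
          (tangentMap i k : S.Model →ₗ[ℝ] X.Arr.Model) := by
      rintro _ ⟨w, rfl⟩
      have h3 : tangentMap X.src (i k) (Λ (ι w)) = 0 := by
        rw [(hΛ _).2]
        have := (hSi k₀ _).1 ⟨w.1, rfl⟩
        rw [hk₀] at this
        exact this
      obtain ⟨z, hz⟩ := (hSi k _).2 h3
      refine ⟨z, ?_, hz⟩
      change tangentMap (fun k => X.tgt (i k)) k z = 0
      rw [tangentMap_comp_apply X.tgt_submersion.1 hi.smooth, hz]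
      exact (hΛ _).1
    calc _ = Module.finrank ℝ (LinearMap.range (Λ ∘ₗ ι)) :=
          (LinearMap.finrank_range_of_inj (f := Λ ∘ₗ ι) (hΛi.comp hιi)).symm
      _ ≤ _ := Submodule.finrank_mono hle
      _ ≤ _ := Submodule.finrank_map_le _ _
  set e := chartAt S.Model k₀
  have hsrc := mem_chart_source S.Model k₀
  have htgt := mem_chart_source X.Obj.Model (X.tgt (i k₀))
  have hfr : ∀ k, k ∈ e.source → X.tgt (i k) ∈ (chartAt X.Obj.Model (X.tgt (i k₀))).source →
      Module.finrank ℝ (LinearMap.ker (fderiv ℝ (chartRep (fun k => X.tgt (i k)) k₀) (e k) :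
        S.Model →ₗ[ℝ] X.Obj.Model)) = Module.finrank ℝ (LinearMap.ker
        (tangentMap (fun k => X.tgt (i k)) k : S.Model →ₗ[ℝ] X.Obj.Model)) := by
    intro k hk hk'
    obtain ⟨A, B, hA, hB, h⟩ := exists_fderiv_chartRep hti hk hk'
    rw [h]
    let A' := LinearEquiv.ofBijective (A : S.Model →ₗ[ℝ] S.Model) hA
    have hmap : (LinearMap.ker ((B.comp ((tangentMap (fun k => X.tgt (i k)) k).comp A) :
        S.Model →L[ℝ] X.Obj.Model) : S.Model →ₗ[ℝ] X.Obj.Model)).map A'.toLinearMap = LinearMap.ker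
        (tangentMap (fun k => X.tgt (i k)) k : S.Model →ₗ[ℝ] X.Obj.Model) := by
      ext w
      constructor
      · rintro ⟨z, hz, rfl⟩
        exact hB.injective (Eq.trans hz (map_zero B).symm)
      · intro hw
        obtain ⟨z, rfl⟩ := A'.surjective w
        refine ⟨z, ?_, rfl⟩
        change B (tangentMap (fun k => X.tgt (i k)) k (A z)) = 0
        exact (congrArg B hw).trans (map_zero B)
    rw [← hmap]
    exact (LinearEquiv.finrank_map_eq A' _).symm
  have hnhds : ∀ {p : S → Prop}, (∀ᶠ k in 𝓝 k₀, p k) → ∀ᶠ y in 𝓝 (e k₀), p (e.symm y) := by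
    intro p hp
    exact (e.tendsto_symm hsrc).eventually hp
  have hmem : ∀ᶠ k in 𝓝 k₀, k ∈ e.source ∧
      X.tgt (i k) ∈ (chartAt X.Obj.Model (X.tgt (i k₀))).source :=
    Filter.Eventually.and (e.open_source.mem_nhds hsrc)
      (hti.continuous.continuousAt.preimage_mem_nhds
        ((chartAt X.Obj.Model (X.tgt (i k₀))).open_source.mem_nhds htgt))
  have hinj := injective_fderiv_of_finrank_ker_le (chartRep_contDiffAt hti hsrc htgt) (by
      filter_upwards [hnhds hmem, e.open_target.mem_nhds (e.map_source hsrc)] with y hy hye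
      have := hfr _ hy.1 hy.2
      rw [e.right_inv hye] at this
      rw [this, hfr k₀ hsrc htgt]
      exact hker _) (by
      -- Near the unit, an arrow in the isotropy group is the unit.
      have := hX.2 x
      have hu : X.unit x ∈ X.isotropy x := ⟨X.src_unit x, X.tgt_unit x⟩
      obtain ⟨U, hUo, hU⟩ := isOpen_induced_iff.1 (isOpen_discrete {(⟨_, hu⟩ : X.isotropy x)})
      have hUu : X.unit x ∈ U := by
        have : (⟨_, hu⟩ : X.isotropy x) ∈ Subtype.val ⁻¹' U := by rw [hU]; rfl
        exact this
      have hUk : ∀ᶠ k in 𝓝 k₀, i k ∈ U :=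
        hi.smooth.continuous.continuousAt.preimage_mem_nhds (hUo.mem_nhds (hk₀ ▸ hUu))
      filter_upwards [hnhds hmem, hnhds hUk, e.open_target.mem_nhds (e.map_source hsrc)]
        with y hy hyU hye heq
      have h3 : X.tgt (i (e.symm y)) = X.tgt (i k₀) := by
        refine (chartAt X.Obj.Model (X.tgt (i k₀))).injOn hy.2 htgt (Eq.trans heq ?_)
        simp only [chartRep]
        rw [show (chartAt S.Model k₀).symm (e k₀) = k₀ from e.left_inv hsrc]
      have h4 : i (e.symm y) ∈ X.isotropy x := ⟨hs _, by rw [h3, hk₀, X.tgt_unit]⟩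
      have h5 : (⟨_, h4⟩ : X.isotropy x) ∈ Subtype.val ⁻¹' U := hyU
      rw [hU] at h5
      have h6 : i (e.symm y) = i k₀ := (congrArg Subtype.val h5).trans hk₀.symm
      exact (e.right_inv hye).symm.trans (congrArg e (hi.injective h6)))
  have hzero := hfr k₀ hsrc htgt
  rw [LinearMap.ker_eq_bot.2 hinj, finrank_bot] at hzero
  have hbot := Submodule.finrank_eq_zero.1 hzero.symm
  obtain ⟨w, hw⟩ := (hSi k₀ v).2 (by rw [hk₀]; exact h1)
  have hwk : w ∈ LinearMap.ker
      (tangentMap (fun k => X.tgt (i k)) k₀ : S.Model →ₗ[ℝ] X.Obj.Model) := by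
    change tangentMap (fun k => X.tgt (i k)) k₀ w = 0
    rw [tangentMap_comp_apply X.tgt_submersion.1 hi.smooth, hw, hk₀, h2]
  rw [hbot, Submodule.mem_bot] at hwk
  rw [← hw, hwk, map_zero]

/-- The leaves of a foliation groupoid all have the dimension `dim X₁ - dim X₀`. -/
theorem IsFoliation.finrank_anchorImage (hX : X.IsFoliation) (x : X.Obj) :
    Module.finrank ℝ (X.anchorImage x) =
      Module.finrank ℝ X.Arr.Model - Module.finrank ℝ X.Obj.Model := by
  have h := LinearMap.finrank_range_add_finrank_ker
    (tangentMap X.src (X.unit x) : X.Arr.Model →ₗ[ℝ] X.Obj.Model)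
  rw [LinearMap.range_eq_top.2 (X.src_submersion.2 _), finrank_top] at h
  let D := (tangentMap X.tgt (X.unit x) : X.Arr.Model →ₗ[ℝ] X.Obj.Model).domRestrict
    (LinearMap.ker (tangentMap X.src (X.unit x) : X.Arr.Model →ₗ[ℝ] X.Obj.Model))
  have hD : Function.Injective D := by
    rw [injective_iff_map_eq_zero]
    intro v hv
    exact Subtype.ext (hX.eq_zero_of_mem_ker x v v.2 hv)
  have hr : LinearMap.range D = X.anchorImage x := LinearMap.range_domRestrict _ _
  rw [← hr, LinearMap.finrank_range_of_inj hD]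
  omega

end LieGroupoid

/-! ### Infinitesimal actions -/

namespace StrictAction

variable {G : LieTwoGroup.{u}} {X : LieGroupoid.{u}} (a : StrictAction G X)

theorem smooth_left (g : G.Obj) : Smooth (a.obj g) :=
  a.smooth_obj.comp (smooth_const g) smooth_id

theorem smooth_orbit (x : X.Obj) : Smooth (fun g => a.obj g x) :=
  a.smooth_obj.comp smooth_id (smooth_const x)

/-- The foliation is invariant under the action. -/
theorem tangentMap_mem_anchorImage (g : G.Obj) {x : X.Obj} {q : X.Obj.Model}
    (hq : q ∈ X.anchorImage x) : tangentMap (a.obj g) x q ∈ X.anchorImage (a.obj g x) := by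
  obtain ⟨b, h1, h2⟩ := hq
  have hφ : Smooth (a.arr (G.unit g)) := a.smooth_arr.comp (smooth_const _) smooth_id
  have hs : ∀ f, X.src (a.arr (G.unit g) f) = a.obj g (X.src f) := fun f => by
    rw [a.src_arr, G.src_unit]
  have ht : ∀ f, X.tgt (a.arr (G.unit g) f) = a.obj g (X.tgt f) := fun f => by
    rw [a.tgt_arr, G.tgt_unit]
  have h3 := tangentMap_comp_apply X.src_submersion.1 hφ (X.unit x) b
  have h4 := tangentMap_comp_apply X.tgt_submersion.1 hφ (X.unit x) b
  rw [a.arr_unit, funext hs, tangentMap_comp_apply (a.smooth_left g) X.src_submersion.1,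
    X.src_unit] at h3
  rw [a.arr_unit, funext ht, tangentMap_comp_apply (a.smooth_left g) X.tgt_submersion.1,
    X.tgt_unit] at h4
  refine ⟨tangentMap (a.arr (G.unit g)) (X.unit x) b, ?_, ?_⟩
  · exact h3.symm.trans ((congrArg _ h1).trans (map_zero _))
  · exact h4.symm.trans (congrArg _ h2)

/-- `L_g` maps the tangent space of the orbit at `x` into the one at `g x`, as
`g (h x) = (g h g⁻¹) (g x)`. -/
theorem tangentMap_infinitesimal (g : G.Obj) (x : X.Obj) (ξ : G.Obj.Model) :
    tangentMap (a.obj g) x (a.infinitesimal x ξ) = a.infinitesimal (a.obj g x) (G.Ad g ξ) := by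
  have hc : Smooth (fun h : G.Obj => g * h * g⁻¹) :=
    ((contMDiff_mul_left (I := G.Obj.I) (n := ∞) (a := g)).mul contMDiff_const : _)
  have h1 := tangentMap_comp_apply (a.smooth_left g) (a.smooth_orbit x) 1 ξ
  have h2 := tangentMap_comp_apply (a.smooth_orbit (a.obj g x)) hc 1 ξ
  have he : (fun h => a.obj g (a.obj h x)) = fun h => a.obj (g * h * g⁻¹) (a.obj g x) := by
    funext h
    rw [← a.mul_obj, ← a.mul_obj, inv_mul_cancel_right]
  rw [he, h2, a.one_obj, mul_one, mul_inv_cancel] at h1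
  exact h1.symm

theorem Equivariant.tangentMap_infinitesimal {a : StrictAction G X} {Y : LieGroupoid.{u}}
    {b : StrictAction G Y} {φ : LieGroupoid.Hom X Y} (h : a.Equivariant b φ) (x : X.Obj)
    (ξ : G.Obj.Model) :
    tangentMap φ.obj x (a.infinitesimal x ξ) = b.infinitesimal (φ.obj x) ξ := by
  have h1 := tangentMap_comp_apply φ.smooth_obj (a.smooth_orbit x) 1 ξ
  rw [funext fun g => h.1 g x, a.one_obj] at h1
  exact h1.symm

end StrictAction

/-! ### Pullbacks of Lie groupoids -/

/-- The pullback of a Lie groupoid `X` along a map `φ` to its object manifold, when it exists: a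
manifold `Arr` of triples `(α n, s n, t n)` consisting of an arrow of `X` and of lifts of its source
and its target, such that smoothness of maps into `Arr` is tested on the three components and the
tangent vectors are given by triples of tangent vectors. -/
structure PullbackData (X : LieGroupoid.{u}) where
  Obj : SmoothMfd.{u}
  φ : Obj → X.Obj
  smooth_φ : Smooth φ
  Arr : SmoothMfd.{u}
  α : Arr → X.Arr
  s : Arr → Obj
  t : Arr → Obj
  smooth_α : Smooth α
  smooth_s : Smooth s
  smooth_t : Smooth t
  src_α : ∀ n, X.src (α n) = φ (s n)
  tgt_α : ∀ n, X.tgt (α n) = φ (t n)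
  ext : ∀ n n', α n = α n' → s n = s n' → t n = t n' → n = n'
  exists_arr : ∀ f r r', X.src f = φ r → X.tgt f = φ r' → ∃ n, α n = f ∧ s n = r ∧ t n = r'
  lift : ∀ {E' : Type} [NormedAddCommGroup E'] [NormedSpace ℝ E'] {H' : Type} [TopologicalSpace H']
    {I' : ModelWithCorners ℝ E' H'} {M' : Type u} [TopologicalSpace M'] [ChartedSpace H' M']
    {c : M' → Arr} {A : Set M'},
    ContMDiffOn I' X.Arr.I ∞ (fun y => α (c y)) A → ContMDiffOn I' Obj.I ∞ (fun y => s (c y)) A →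
      ContMDiffOn I' Obj.I ∞ (fun y => t (c y)) A → ContMDiffOn I' Arr.I ∞ c A
  exists_tangent : ∀ n v w w', tangentMap X.src (α n) v = tangentMap φ (s n) w →
    tangentMap X.tgt (α n) v = tangentMap φ (t n) w' →
      ∃ y, tangentMap α n y = v ∧ tangentMap s n y = w ∧ tangentMap t n y = w'
  surjective_t : ∀ n, Function.Surjective (tangentMap t n)

namespace PullbackData

variable {X : LieGroupoid.{u}} (D : PullbackData X)

/-- The arrow with given components. -/
def arr (f : X.Arr) (r r' : D.Obj) (h : X.src f = D.φ r) (h' : X.tgt f = D.φ r') : D.Arr :=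
  (D.exists_arr f r r' h h').choose

section arr

variable {f : X.Arr} {r r' : D.Obj} (h : X.src f = D.φ r) (h' : X.tgt f = D.φ r')

@[simp] theorem α_arr : D.α (D.arr f r r' h h') = f := (D.exists_arr f r r' h h').choose_spec.1

@[simp] theorem s_arr : D.s (D.arr f r r' h h') = r := (D.exists_arr f r r' h h').choose_spec.2.1

@[simp] theorem t_arr : D.t (D.arr f r r' h h') = r' := (D.exists_arr f r r' h h').choose_spec.2.2

end arr

theorem smooth_of {M : SmoothMfd.{u}} {c : M → D.Arr} (h1 : Smooth fun y => D.α (c y))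
    (h2 : Smooth fun y => D.s (c y)) (h3 : Smooth fun y => D.t (c y)) : Smooth c :=
  contMDiffOn_univ.1 (D.lift (contMDiffOn_univ.2 h1) (contMDiffOn_univ.2 h2)
    (contMDiffOn_univ.2 h3))

theorem src_α_eq_tgt_α {n n' : D.Arr} (h : D.s n = D.t n') : X.src (D.α n) = X.tgt (D.α n') := by
  rw [D.src_α, D.tgt_α, h]

/-- The unit arrows of the pullback groupoid. -/
def unit (r : D.Obj) : D.Arr :=
  D.arr (X.unit (D.φ r)) r r (X.src_unit _) (X.tgt_unit _)

/-- The inversion of the pullback groupoid. -/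
def inv (n : D.Arr) : D.Arr :=
  D.arr (X.inv (D.α n)) (D.t n) (D.s n) ((X.src_inv _).trans (D.tgt_α n))
    ((X.tgt_inv _).trans (D.src_α n))

open Classical in
/-- The composition of the pullback groupoid; the value is irrelevant if the arrows are not
composable. -/
def comp (n n' : D.Arr) : D.Arr :=
  if h : D.s n = D.t n' then D.arr (X.comp (D.α n) (D.α n')) (D.s n') (D.t n)
    ((X.src_comp _ _ (D.src_α_eq_tgt_α h)).trans (D.src_α n'))
    ((X.tgt_comp _ _ (D.src_α_eq_tgt_α h)).trans (D.tgt_α n)) else n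

theorem comp_spec {n n' : D.Arr} (h : D.s n = D.t n') :
    D.α (D.comp n n') = X.comp (D.α n) (D.α n') ∧ D.s (D.comp n n') = D.s n' ∧
      D.t (D.comp n n') = D.t n := by
  rw [comp, dif_pos h]
  simp

theorem α_unit (r : D.Obj) : D.α (D.unit r) = X.unit (D.φ r) := D.α_arr _ _

theorem s_unit (r : D.Obj) : D.s (D.unit r) = r := D.s_arr _ _

theorem t_unit (r : D.Obj) : D.t (D.unit r) = r := D.t_arr _ _

theorem α_inv (n : D.Arr) : D.α (D.inv n) = X.inv (D.α n) := D.α_arr _ _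

theorem s_inv (n : D.Arr) : D.s (D.inv n) = D.t n := D.s_arr _ _

theorem t_inv (n : D.Arr) : D.t (D.inv n) = D.s n := D.t_arr _ _

theorem smooth_unit : Smooth D.unit := by
  refine D.smooth_of ?_ ?_ ?_
  · simp only [α_unit]; exact X.smooth_unit.comp D.smooth_φ
  · simp only [s_unit]; exact smooth_id
  · simp only [t_unit]; exact smooth_id

theorem smooth_inv : Smooth D.inv := by
  refine D.smooth_of ?_ ?_ ?_
  · simp only [α_inv]; exact X.smooth_inv.comp D.smooth_α
  · simp only [s_inv]; exact D.smooth_t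
  · simp only [t_inv]; exact D.smooth_s

theorem inv_inv (n : D.Arr) : D.inv (D.inv n) = n :=
  D.ext _ _ (by rw [α_inv, α_inv, X.inv_inv]) (by rw [s_inv, t_inv]) (by rw [t_inv, s_inv])

theorem surjective_s (n : D.Arr) : Function.Surjective (tangentMap D.s n) := by
  have h1 := tangentMap_comp D.smooth_t D.smooth_inv n
  rw [funext D.t_inv] at h1
  have h2 := tangentMap_comp D.smooth_inv D.smooth_inv (D.inv n)
  rw [funext D.inv_inv, tangentMap_id, D.inv_inv] at h2
  rw [h1]
  refine (D.surjective_t _).comp fun v => ?_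
  exact ⟨_, (DFunLike.congr_fun h2 v).symm⟩

/-- The pullback groupoid. -/
def gpd : LieGroupoid.{u} where
  Obj := D.Obj
  Arr := D.Arr
  src := D.s
  tgt := D.t
  unit := D.unit
  inv := D.inv
  comp := D.comp
  src_unit := D.s_unit
  tgt_unit := D.t_unit
  src_comp _ _ h := (D.comp_spec h).2.1
  tgt_comp _ _ h := (D.comp_spec h).2.2
  comp_assoc n n' n'' h h' := by
    have e1 := D.comp_spec h
    have e2 := D.comp_spec h'
    have e3 := D.comp_spec (e1.2.1.trans h')
    have e4 := D.comp_spec (h.trans e2.2.2.symm)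
    refine D.ext _ _ ?_ ?_ ?_
    · rw [e3.1, e4.1, e1.1, e2.1,
        X.comp_assoc _ _ _ (D.src_α_eq_tgt_α h) (D.src_α_eq_tgt_α h')]
    · rw [e3.2.1, e4.2.1, e2.2.1]
    · rw [e3.2.2, e4.2.2, e1.2.2]
  unit_comp n := by
    have e := D.comp_spec (D.s_unit (D.t n))
    refine D.ext _ _ ?_ ?_ ?_
    · rw [e.1, α_unit, ← D.tgt_α, X.unit_comp]
    · rw [e.2.1]
    · rw [e.2.2, t_unit]
  comp_unit n := by
    have e := D.comp_spec (D.t_unit (D.s n)).symm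
    refine D.ext _ _ ?_ ?_ ?_
    · rw [e.1, α_unit, ← D.src_α, X.comp_unit]
    · rw [e.2.1, s_unit]
    · rw [e.2.2]
  src_inv := D.s_inv
  tgt_inv := D.t_inv
  inv_comp n := by
    have e := D.comp_spec (D.s_inv n)
    refine D.ext _ _ ?_ ?_ ?_
    · rw [e.1, α_inv, α_unit, X.inv_comp, D.src_α]
    · rw [e.2.1, s_unit]
    · rw [e.2.2, t_inv, t_unit]
  comp_inv n := by
    have e := D.comp_spec (D.t_inv n).symm
    refine D.ext _ _ ?_ ?_ ?_
    · rw [e.1, α_inv, α_unit, X.comp_inv, D.tgt_α]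
    · rw [e.2.1, s_inv, s_unit]
    · rw [e.2.2, t_unit]
  src_submersion := ⟨D.smooth_s, D.surjective_s⟩
  tgt_submersion := ⟨D.smooth_t, D.surjective_t⟩
  smooth_unit := D.smooth_unit
  smooth_inv := D.smooth_inv
  smooth_comp := by
    refine D.lift ?_ ?_ ?_
    · have h : ContMDiffOn (D.Arr.I.prod D.Arr.I) X.Arr.I ∞
          (fun p : D.Arr × D.Arr => X.comp (D.α p.1) (D.α p.2)) {p | D.s p.1 = D.t p.2} := by
        refine ContMDiffOn.comp (I' := X.Arr.I.prod X.Arr.I) (M' := X.Arr × X.Arr)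
          (f := fun p : D.Arr × D.Arr => (D.α p.1, D.α p.2)) X.smooth_comp ?_
          (fun p hp => D.src_α_eq_tgt_α hp)
        exact ((ContMDiff.comp (I' := D.Arr.I) D.smooth_α contMDiff_fst).prodMk
          (ContMDiff.comp (I' := D.Arr.I) D.smooth_α contMDiff_snd)).contMDiffOn
      exact h.congr fun p hp => (D.comp_spec hp).1
    · have h : ContMDiff (D.Arr.I.prod D.Arr.I) D.Obj.I ∞
          (fun p : D.Arr × D.Arr => D.s p.2) :=
        ContMDiff.comp (I' := D.Arr.I) D.smooth_s contMDiff_snd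
      exact h.contMDiffOn.congr fun p hp => (D.comp_spec hp).2.1
    · have h : ContMDiff (D.Arr.I.prod D.Arr.I) D.Obj.I ∞
          (fun p : D.Arr × D.Arr => D.t p.1) :=
        ContMDiff.comp (I' := D.Arr.I) D.smooth_t contMDiff_fst
      exact h.contMDiffOn.congr fun p hp => (D.comp_spec hp).2.2

/-- The projection of the pullback groupoid. -/
def hom : LieGroupoid.Hom D.gpd X where
  obj := D.φ
  arr := D.α
  smooth_obj := D.smooth_φ
  smooth_arr := D.smooth_α
  src_arr := D.src_α
  tgt_arr := D.tgt_α
  arr_unit := D.α_unit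
  arr_comp _ _ h := (D.comp_spec h).1

theorem existsUnique_lift {M : SmoothMfd.{u}} {a : M → X.Arr} {b b' : M → D.Obj} (ha : Smooth a)
    (hb : Smooth b) (hb' : Smooth b') (h : ∀ m, X.src (a m) = D.φ (b m))
    (h' : ∀ m, X.tgt (a m) = D.φ (b' m)) :
    ∃! c : M → D.Arr, Smooth c ∧ (∀ m, D.α (c m) = a m) ∧ (∀ m, D.s (c m) = b m) ∧
      ∀ m, D.t (c m) = b' m := by
  refine ⟨fun m => D.arr (a m) (b m) (b' m) (h m) (h' m), ⟨D.smooth_of ?_ ?_ ?_, ?_, ?_, ?_⟩, ?_⟩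
  · simpa only [α_arr] using ha
  · simpa only [s_arr] using hb
  · simpa only [t_arr] using hb'
  · exact fun m => D.α_arr _ _
  · exact fun m => D.s_arr _ _
  · exact fun m => D.t_arr _ _
  · rintro c ⟨-, h1, h2, h3⟩
    funext m
    exact D.ext _ _ (by rw [α_arr, h1]) (by rw [s_arr, h2]) (by rw [t_arr, h3])

theorem fullyFaithful_hom : D.hom.FullyFaithful :=
  fun _ _ _ _ ha hb hb' h h' => D.existsUnique_lift ha hb hb' h h'

theorem mem_anchorImage_aux {r : D.Obj} {w : D.Obj.Model} :
    w ∈ D.gpd.anchorImage r ↔ tangentMap D.φ r w ∈ X.anchorImage (D.φ r) := by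
  have hs : ∀ y, tangentMap X.src (X.unit (D.φ r)) (tangentMap D.α (D.unit r) y) =
      tangentMap D.φ r (tangentMap D.s (D.unit r) y) := by
    intro y
    have h := tangentMap_comp_apply X.src_submersion.1 D.smooth_α (D.unit r) y
    rw [funext D.src_α, tangentMap_comp_apply D.smooth_φ D.smooth_s, α_unit, s_unit] at h
    exact h.symm
  have ht : ∀ y, tangentMap X.tgt (X.unit (D.φ r)) (tangentMap D.α (D.unit r) y) =
      tangentMap D.φ r (tangentMap D.t (D.unit r) y) := by
    intro y
    have h := tangentMap_comp_apply X.tgt_submersion.1 D.smooth_α (D.unit r) y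
    rw [funext D.tgt_α, tangentMap_comp_apply D.smooth_φ D.smooth_t, α_unit, t_unit] at h
    exact h.symm
  constructor
  · rintro ⟨y, h1, h2⟩
    have h1' : tangentMap D.s (D.unit r) y = 0 := h1
    have h2' : tangentMap D.t (D.unit r) y = w := h2
    exact ⟨tangentMap D.α (D.unit r) y, (hs y).trans (by rw [h1', map_zero]),
      (ht y).trans (by rw [h2'])⟩
  · rintro ⟨b, h1, h2⟩
    have h1' : tangentMap X.src (X.unit (D.φ r)) b = 0 := h1
    have h2' : tangentMap X.tgt (X.unit (D.φ r)) b = tangentMap D.φ r w := h2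
    obtain ⟨y, -, hy1, hy2⟩ := D.exists_tangent (D.unit r) b 0 w
      (by rw [α_unit, h1', map_zero]) (by rw [α_unit, t_unit, h2'])
    exact ⟨y, hy1, hy2⟩

/-- The foliation of the pullback groupoid is the pullback of the foliation. -/
theorem mem_anchorImage {r : D.gpd.Obj} {w : D.gpd.Obj.Model} : w ∈ D.gpd.anchorImage r ↔
    tangentMap D.hom.obj r w ∈ X.anchorImage (D.hom.obj r) :=
  D.mem_anchorImage_aux

theorem isFoliation (hX : X.IsFoliation) [hT : T2Space D.Obj] : D.gpd.IsFoliation := by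
  refine ⟨‹T2Space D.Obj›, fun r => ?_⟩
  have := hX.2 (D.φ r)
  let ι : D.gpd.isotropy r → X.isotropy (D.φ r) := fun n =>
    ⟨D.α n.1, (D.src_α n.1).trans (congrArg D.φ n.2.1), (D.tgt_α n.1).trans (congrArg D.φ n.2.2)⟩
  refine DiscreteTopology.of_continuous_injective (f := ι) ?_ ?_
  · exact (D.smooth_α.continuous.comp continuous_subtype_val).subtype_mk _
  · intro n n' h
    exact Subtype.ext (D.ext _ _ (congrArg Subtype.val h) (n.2.1.trans n'.2.1.symm)
      (n.2.2.trans n'.2.2.symm))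

section Action

variable {G : LieTwoGroup.{u}} {a : StrictAction G X} {b : G.Obj → D.Obj → D.Obj}

/-- The action on the arrows of the pullback groupoid. -/
def actArr (hφ : ∀ g x, D.φ (b g x) = a.obj g (D.φ x)) (k : G.Arr) (n : D.Arr) : D.Arr :=
  D.arr (a.arr k (D.α n)) (b (G.src k) (D.s n)) (b (G.tgt k) (D.t n))
    (by rw [a.src_arr, D.src_α, hφ]) (by rw [a.tgt_arr, D.tgt_α, hφ])

section

variable (hφ : ∀ g x, D.φ (b g x) = a.obj g (D.φ x)) (k : G.Arr) (n : D.Arr)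

theorem α_actArr : D.α (D.actArr hφ k n) = a.arr k (D.α n) := D.α_arr _ _

theorem s_actArr : D.s (D.actArr hφ k n) = b (G.src k) (D.s n) := D.s_arr _ _

theorem t_actArr : D.t (D.actArr hφ k n) = b (G.tgt k) (D.t n) := D.t_arr _ _

end

theorem smooth_actArr (hb : Smooth₂ b) (hφ : ∀ g x, D.φ (b g x) = a.obj g (D.φ x)) :
    Smooth₂ (D.actArr hφ) := by
  refine smooth₂_iff.2 (D.smooth_of ?_ ?_ ?_)
  · simp only [α_actArr]
    exact a.smooth_arr.comp smooth_fst (D.smooth_α.comp smooth_snd)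
  · simp only [s_actArr]
    exact hb.comp (G.src_submersion.1.comp smooth_fst) (D.smooth_s.comp smooth_snd)
  · simp only [t_actArr]
    exact hb.comp (G.tgt_submersion.1.comp smooth_fst) (D.smooth_t.comp smooth_snd)

theorem actArr_one (hφ : ∀ g x, D.φ (b g x) = a.obj g (D.φ x)) (hb1 : ∀ x, b 1 x = x)
    (n : D.Arr) : D.actArr hφ 1 n = n := by
  have h1 : G.src 1 = 1 := by simpa using G.src_mul 1 1
  have h2 : G.tgt 1 = 1 := by simpa using G.tgt_mul 1 1
  refine D.ext _ _ ?_ ?_ ?_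
  · rw [α_actArr, a.one_arr]
  · rw [s_actArr, h1, hb1]
  · rw [t_actArr, h2, hb1]

theorem actArr_mul (hφ : ∀ g x, D.φ (b g x) = a.obj g (D.φ x))
    (hbm : ∀ g h x, b (g * h) x = b g (b h x)) (k l : G.Arr) (n : D.Arr) :
    D.actArr hφ (k * l) n = D.actArr hφ k (D.actArr hφ l n) := by
  refine D.ext _ _ ?_ ?_ ?_
  · rw [α_actArr, α_actArr, α_actArr, a.mul_arr]
  · rw [s_actArr, s_actArr, s_actArr, G.src_mul, hbm]
  · rw [t_actArr, t_actArr, t_actArr, G.tgt_mul, hbm]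

theorem actArr_unit (hφ : ∀ g x, D.φ (b g x) = a.obj g (D.φ x)) (g : G.Obj) (x : D.Obj) :
    D.actArr hφ (G.unit g) (D.unit x) = D.unit (b g x) := by
  refine D.ext _ _ ?_ ?_ ?_
  · rw [α_actArr, α_unit, α_unit, a.arr_unit, hφ]
  · rw [s_actArr, s_unit, s_unit, G.src_unit]
  · rw [t_actArr, t_unit, t_unit, G.tgt_unit]

theorem actArr_comp (hφ : ∀ g x, D.φ (b g x) = a.obj g (D.φ x)) (k k' : G.Arr) (n n' : D.Arr)
    (hk : G.src k = G.tgt k') (hn : D.s n = D.t n') :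
    D.actArr hφ (G.comp k k') (D.comp n n') = D.comp (D.actArr hφ k n) (D.actArr hφ k' n') := by
  have e := D.comp_spec hn
  have h : D.s (D.actArr hφ k n) = D.t (D.actArr hφ k' n') := by
    rw [s_actArr, t_actArr, hk, hn]
  have e' := D.comp_spec h
  refine D.ext _ _ ?_ ?_ ?_
  · rw [α_actArr, e.1, e'.1, α_actArr, α_actArr, a.arr_comp _ _ _ _ hk (D.src_α_eq_tgt_α hn)]
  · rw [s_actArr, e.2.1, e'.2.1, s_actArr, G.src_comp _ _ hk]
  · rw [t_actArr, e.2.2, e'.2.2, t_actArr, G.tgt_comp _ _ hk]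

variable (a b) in
/-- The action on the pullback groupoid defined by an action on `X` and a compatible action on the
objects. -/
def action (hb : Smooth₂ b) (hb1 : ∀ x, b 1 x = x) (hbm : ∀ g h x, b (g * h) x = b g (b h x))
    (hφ : ∀ g x, D.φ (b g x) = a.obj g (D.φ x)) : StrictAction G D.gpd where
  obj := b
  arr := D.actArr hφ
  smooth_obj := hb
  smooth_arr := D.smooth_actArr hb hφ
  one_obj := hb1
  mul_obj := hbm
  one_arr := D.actArr_one hφ hb1
  mul_arr := D.actArr_mul hφ hbm
  src_arr := D.s_actArr hφ
  tgt_arr := D.t_actArr hφ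
  arr_unit := D.actArr_unit hφ
  arr_comp := D.actArr_comp hφ

theorem equivariant_hom {hb : Smooth₂ b} {hb1 : ∀ x, b 1 x = x}
    {hbm : ∀ g h x, b (g * h) x = b g (b h x)} {hφ : ∀ g x, D.φ (b g x) = a.obj g (D.φ x)} :
    (D.action a b hb hb1 hbm hφ).Equivariant a D.hom :=
  ⟨hφ, D.α_actArr hφ⟩

end Action

end PullbackData

/-! ### Linear algebra of the moment map at a zero -/

section Forms

variable {M N : SmoothMfd.{u}} (σ : PreForm M 2)

/-- A `2`-form at a point as a bilinear form. -/
def PreForm.bilin (x : M) : M.Model →ₗ[ℝ] M.Model →ₗ[ℝ] ℝ :=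
  LinearMap.mk₂ ℝ (fun v w => σ x ![v, w])
    (fun v v' w => by
      have h := congrArg (fun L => L ![w]) ((σ x).toAlternatingMap.curryLeft.map_add v v')
      exact h)
    (fun c v w => by
      have h := congrArg (fun L => L ![w]) ((σ x).toAlternatingMap.curryLeft.map_smul c v)
      exact h)
    (fun v w w' => by
      have h := (σ x).toMultilinearMap.map_update_add ![v, w] 1 w w'
      have e : ∀ z : M.Model, Function.update ![v, w] 1 z = ![v, z] := fun z => by
        ext i; fin_cases i <;> simp
      simp only [e] at h
      exact h)
    (fun c v w => by
      have h := (σ x).toMultilinearMap.map_update_smul ![v, w] 1 c w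
      have e : ∀ z : M.Model, Function.update ![v, w] 1 z = ![v, z] := fun z => by
        ext i; fin_cases i <;> simp
      simp only [e] at h
      exact h)

theorem PreForm.bilin_apply (x : M) (v w : M.Model) : σ.bilin x v w = σ x ![v, w] := rfl

theorem PreForm.bilin_swap (x : M) (v w : M.Model) : σ.bilin x v w = -σ.bilin x w v := by
  have h := (σ x).toAlternatingMap.map_swap ![w, v] (show (0 : Fin 2) ≠ 1 by decide)
  have e : (![w, v] ∘ (Equiv.swap (0 : Fin 2) 1)) = ![v, w] := by
    ext i; fin_cases i <;> simp
  rw [e] at h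
  exact h

theorem PreForm.mem_ker {x : M} {v : M.Model} : v ∈ σ.ker x ↔ ∀ w, σ.bilin x v w = 0 := Iff.rfl

theorem PreForm.bilin_pullback (f : N → M) (x : N) (v w : N.Model) :
    (σ.pullback f).bilin x v w = σ.bilin (f x) (tangentMap f x v) (tangentMap f x w) := by
  have e : (fun i => tangentMap f x (![v, w] i)) = ![tangentMap f x v, tangentMap f x w] :=
    funext (Fin.forall_fin_two.2 ⟨rfl, rfl⟩)
  rw [PreForm.bilin_apply, PreForm.bilin_apply, ← e]
  rfl

end Forms

theorem hasMFDerivAt_clm_comp {M : SmoothMfd.{u}} {E : Type*} [NormedAddCommGroup E]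
    [NormedSpace ℝ E] (L : E →L[ℝ] ℝ) {f : M → E} {x : M} {f' : M.Model →L[ℝ] E}
    (hf : HasMFDerivAt M.I 𝓘(ℝ, E) f x f') :
    HasMFDerivAt M.I 𝓘(ℝ, ℝ) (fun y => L (f y)) x (L.comp f') :=
  HasMFDerivAt.comp x (L.hasFDerivAt.hasMFDerivAt : HasMFDerivAt 𝓘(ℝ, E) 𝓘(ℝ, ℝ) L (f x) L) hf

namespace MomentMap

variable {G : LieTwoGroup.{u}} {X : LieGroupoid.{u}} {σ : PreForm X.Obj 2} {a : StrictAction G X}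
  (μ : MomentMap σ a)

/-- The derivative of the moment map. -/
def deriv (x : X.Obj) : X.Obj.Model →L[ℝ] G.ann := derivAt G.ann μ.toFun x

theorem deriv_apply (x : X.Obj) (v : X.Obj.Model) (ξ : G.Obj.Model) :
    (μ.deriv x v : StrongDual ℝ G.Obj.Model) ξ = σ.bilin x (a.infinitesimal x ξ) v := by
  have h := μ.hamilton ξ x v
  have h1 : HasMFDerivAt X.Obj.I 𝓘(ℝ, G.ann) μ.toFun x (μ.deriv x) :=
    ((μ.smooth x).mdifferentiableAt (by simp)).hasMFDerivAt
  have hc := hasMFDerivAt_clm_comp ((ContinuousLinearMap.apply ℝ ℝ ξ).comp G.ann.subtypeL) h1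
  have h2 : (mfderiv X.Obj.I 𝓘(ℝ, ℝ)
      (fun y => (μ.toFun y : StrongDual ℝ G.Obj.Model) ξ) x : X.Obj.Model →L[ℝ] ℝ) v =
        (μ.deriv x v : StrongDual ℝ G.Obj.Model) ξ :=
    DFunLike.congr_fun hc.mfderiv v
  exact h2.symm.trans h

/-- The orbits of zeros of the moment map consist of zeros. -/
theorem map_eq_zero (g : G.Obj) {x : X.Obj} (hx : μ.toFun x = 0) : μ.toFun (a.obj g x) = 0 := by
  refine Subtype.ext (ContinuousLinearMap.ext fun ξ => ?_)
  rw [μ.equivariant, hx]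
  rfl

/-- The fundamental vector of `ξ` at a regular zero of the moment map is in the kernel of the form
if and only if `ξ ∈ 𝔥`. -/
theorem infinitesimal_mem_ker_iff (hμ : μ.ZeroIsRegularValue) {x : X.Obj} (hx : μ.toFun x = 0)
    (ξ : G.Obj.Model) : a.infinitesimal x ξ ∈ σ.ker x ↔ ξ ∈ G.lieIdeal := by
  rw [σ.mem_ker]
  constructor
  · intro h
    by_contra hξ
    -- A functional in `ann 𝔥` that does not vanish at `ξ` is a value of `dμ₀`, by regularity.
    obtain ⟨f, hf, hfp⟩ := Submodule.exists_le_ker_of_notMem hξ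
    let l : G.ann := ⟨LinearMap.toContinuousLinearMap f, fun η hη => hfp hη⟩
    obtain ⟨v, hv⟩ := hμ x hx l
    have h1 := μ.deriv_apply x v ξ
    rw [h v, show μ.deriv x v = l from hv] at h1
    exact hf h1
  · intro h v
    rw [← μ.deriv_apply]
    exact (μ.deriv x v).2 ξ h

/-- The symplectic complement of `ker dμ` consists of the sums of a fundamental vector and of a
vector in the kernel of the form. -/
theorem exists_sub_mem_ker {x : X.Obj} {v : X.Obj.Model}
    (hv : ∀ w, μ.deriv x w = 0 → σ.bilin x v w = 0) :
    ∃ ξ, v - a.infinitesimal x ξ ∈ σ.ker x := by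
  let A : G.Obj.Model →ₗ[ℝ] Module.Dual ℝ X.Obj.Model :=
    (σ.bilin x) ∘ₗ (a.infinitesimal x : G.Obj.Model →ₗ[ℝ] X.Obj.Model)
  have h : σ.bilin x v ∈ (LinearMap.range A).dualCoannihilator.dualAnnihilator := by
    rw [Submodule.mem_dualAnnihilator]
    intro w hw
    rw [Submodule.mem_dualCoannihilator] at hw
    refine hv w (Subtype.ext (ContinuousLinearMap.ext fun ξ => ?_))
    rw [μ.deriv_apply]
    exact hw (A ξ) ⟨ξ, rfl⟩
  rw [Subspace.dualCoannihilator_dualAnnihilator_eq] at h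
  obtain ⟨ξ, hξ⟩ := h
  refine ⟨ξ, fun w => ?_⟩
  change σ.bilin x (v - a.infinitesimal x ξ) w = 0
  rw [map_sub, LinearMap.sub_apply, ← hξ]
  exact sub_self _

end MomentMap

/-! ### The zero fibre -/

namespace MomentMap

variable {G : LieTwoGroup.{u}} {X : LieGroupoid.{u}} {σ : PreForm X.Obj 2} {a : StrictAction G X}
  (μ : MomentMap σ a)

/-- Since `0` is a regular value of `μ₀`, hence of `μ₁ = μ₀ ∘ s`, the zero sets of `μ₀` and `μ₁`
are embedded submanifolds. They form the pullback of `X` along the inclusion of `μ₀⁻¹(0)`, since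
that set is a union of isomorphism classes. -/
theorem exists_pullbackData (hμ : μ.ZeroIsRegularValue) :
    ∃ D : PullbackData X, IsSubmanifold D.φ {x | μ.toFun x = 0} ∧
      IsSubmanifold D.α {f | μ.toFun (X.src f) = 0} ∧
      ∀ z v, v ∈ Set.range (tangentMap D.φ z) ↔ μ.deriv (D.φ z) v = 0 := by
  have hd0 : ∀ {M : SmoothMfd.{u}} (p : M), derivAt G.ann (fun _ : M => (0 : G.ann)) p = 0 :=
    fun _ => mfderiv_const
  have hμs : ContMDiff X.Arr.I 𝓘(ℝ, G.ann) ∞ fun f => μ.toFun (X.src f) :=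
    ContMDiff.comp (I' := X.Obj.I) μ.smooth X.src_submersion.1
  have hd1 : ∀ f v, derivAt G.ann (fun f => μ.toFun (X.src f)) f v =
      μ.deriv (X.src f) (tangentMap X.src f v) := by
    intro f v
    have h := mfderiv_comp f ((μ.smooth (X.src f)).mdifferentiableAt (by simp))
      (X.src_submersion.1.mdiff f)
    exact DFunLike.congr_fun h v
  obtain ⟨Z₀, i, hi, hti⟩ := exists_submanifold_equalizer (M := X.Obj) (C := G.ann) μ.smooth
    (contMDiff_const (c := (0 : G.ann))) (by
      intro x hx
      rw [hd0, sub_zero]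
      exact hμ x hx)
  obtain ⟨Z₁, j, hj, htj⟩ := exists_submanifold_equalizer (M := X.Arr) (C := G.ann) hμs
    (contMDiff_const (c := (0 : G.ann))) (by
      intro f hf w
      obtain ⟨v, hv⟩ := hμ _ hf w
      obtain ⟨v', rfl⟩ := X.src_submersion.2 f v
      refine ⟨v', ?_⟩
      rw [hd0, sub_zero, hd1]
      exact hv)
  have hti' : ∀ z v, v ∈ Set.range (tangentMap i z) ↔ μ.deriv (i z) v = 0 := by
    intro z v
    rw [hti, hd0]
    rfl
  have htj' : ∀ n v, v ∈ Set.range (tangentMap j n) ↔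
      μ.deriv (X.src (j n)) (tangentMap X.src (j n) v) = 0 := by
    intro n v
    rw [htj, hd0, hd1]
    rfl
  have hjs : ∀ n, μ.toFun (X.src (j n)) = 0 := fun n => hj.mem n
  have hjt : ∀ n, μ.toFun (X.tgt (j n)) = 0 := fun n => (μ.invariant _).symm.trans (hjs n)
  have hiμ : ∀ z, μ.toFun (i z) = 0 := fun z => hi.mem z
  choose s hs using fun n => hi.exists_eq (hjs n)
  choose t ht using fun n => hi.exists_eq (hjt n)
  have hss : Smooth s := hi.smooth_of_comp (by
    rw [funext hs]; exact X.src_submersion.1.comp hj.smooth)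
  have hts : Smooth t := hi.smooth_of_comp (by
    rw [funext ht]; exact X.tgt_submersion.1.comp hj.smooth)
  have hds : ∀ n y, tangentMap X.src (j n) (tangentMap j n y) =
      tangentMap i (s n) (tangentMap s n y) := by
    intro n y
    rw [← tangentMap_comp_apply X.src_submersion.1 hj.smooth,
      ← tangentMap_comp_apply hi.smooth hss, funext hs]
  have hdt : ∀ n y, tangentMap X.tgt (j n) (tangentMap j n y) =
      tangentMap i (t n) (tangentMap t n y) := by
    intro n y
    rw [← tangentMap_comp_apply X.tgt_submersion.1 hj.smooth,
      ← tangentMap_comp_apply hi.smooth hts, funext ht]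
  -- As `μ₀ ∘ s = μ₀ ∘ t`, the derivatives of `μ₁` may be computed at either end.
  have hdst : ∀ f v, μ.deriv (X.src f) (tangentMap X.src f v) =
      μ.deriv (X.tgt f) (tangentMap X.tgt f v) := by
    intro f v
    rw [← hd1, funext μ.invariant]
    have h := mfderiv_comp f ((μ.smooth (X.tgt f)).mdifferentiableAt (by simp))
      (X.tgt_submersion.1.mdiff f)
    exact DFunLike.congr_fun h v
  have hex : ∀ n v w w', tangentMap X.src (j n) v = tangentMap i (s n) w →
      tangentMap X.tgt (j n) v = tangentMap i (t n) w' →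
        ∃ y, tangentMap j n y = v ∧ tangentMap s n y = w ∧ tangentMap t n y = w' := by
    intro n v w w' h h'
    obtain ⟨y, rfl⟩ := (htj' n v).2 (by
      rw [h, ← hs]
      exact (hti' _ _).1 ⟨w, rfl⟩)
    refine ⟨y, rfl, hi.isEmbedding.2.2 (s n) ?_, hi.isEmbedding.2.2 (t n) ?_⟩
    · rw [← hds, h]
    · rw [← hdt, h']
  refine ⟨{
    Obj := Z₀
    φ := i
    smooth_φ := hi.smooth
    Arr := Z₁
    α := j
    s := s
    t := t
    smooth_α := hj.smooth
    smooth_s := hss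
    smooth_t := hts
    src_α := fun n => (hs n).symm
    tgt_α := fun n => (ht n).symm
    ext := fun n n' h _ _ => hj.injective h
    exists_arr := ?_
    lift := fun h _ _ => hj.lift h
    exists_tangent := hex
    surjective_t := ?_ }, hi, hj, hti'⟩
  · intro f r r' h h'
    obtain ⟨n, hn⟩ := hj.exists_eq (y := f) (by
      change μ.toFun (X.src f) = 0
      rw [h]; exact hiμ r)
    refine ⟨n, hn, hi.injective ?_, hi.injective ?_⟩
    · rw [hs, hn, h]
    · rw [ht, hn, h']
  · intro n w'
    obtain ⟨v, hv⟩ := X.tgt_submersion.2 (j n) (tangentMap i (t n) w')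
    have h0 : μ.deriv (i (s n)) (tangentMap X.src (j n) v) = 0 := by
      rw [hs, hdst, hv, ← ht]
      exact (hti' _ _).1 ⟨w', rfl⟩
    obtain ⟨w, hw⟩ := (hti' _ _).2 h0
    obtain ⟨y, -, -, hy⟩ := hex n v w w' hw.symm hv
    exact ⟨y, hy⟩

/-- The zero fibre exists; it is a foliation groupoid in which `𝔥` consists of the `ξ` whose
fundamental vectors are tangent to the foliation, and the null space of the restricted form is the
sum of the tangent spaces of the foliation and of the orbit. -/
theorem exists_zeroFibre (hX : X.IsFoliation) (hσ : X.IsZeroSymplectic σ)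
    (hμ : μ.ZeroIsRegularValue) :
    ∃ Z : ZeroFibre μ, Z.gpd.IsFoliation ∧
      (∀ z ξ, Z.action.infinitesimal z ξ ∈ Z.gpd.anchorImage z ↔ ξ ∈ G.lieIdeal) ∧
      ∀ z, (σ.pullback Z.incl.obj).ker z = Z.gpd.anchorImage z ⊔
        LinearMap.range (Z.action.infinitesimal z : G.Obj.Model →ₗ[ℝ] Z.gpd.Obj.Model) := by
  obtain ⟨D, hφ, hα, ht⟩ : ∃ D : PullbackData X,
      IsSubmanifold D.hom.obj {x | μ.toFun x = 0} ∧
      IsSubmanifold D.hom.arr {f | μ.toFun (X.src f) = 0} ∧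
      ∀ z v, v ∈ Set.range (tangentMap D.hom.obj z) ↔ μ.deriv (D.hom.obj z) v = 0 :=
    μ.exists_pullbackData hμ
  have hDμ : ∀ z, μ.toFun (D.hom.obj z) = 0 := fun z => hφ.mem z
  choose b hb using fun (g : G.Obj) (z : D.gpd.Obj) =>
    hφ.exists_eq (y := a.obj g (D.hom.obj z)) (μ.map_eq_zero g (hDμ z))
  have hbs : Smooth₂ b := smooth₂_iff.2 (hφ.smooth_of_comp (by
    simp only [hb]
    exact a.smooth_obj.comp smooth_fst (hφ.smooth.comp smooth_snd)))
  have hb1 : ∀ z, b 1 z = z := fun z => hφ.injective (by rw [hb, a.one_obj])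
  have hbm : ∀ g h z, b (g * h) z = b g (b h z) := fun g h z =>
    hφ.injective (by rw [hb, a.mul_obj, hb, hb])
  let c := D.action a b hbs hb1 hbm hb
  have hT2 : T2Space D.gpd.Obj := by
    have := hX.1
    exact hφ.isEmbedding.2.1.t2Space
  have hc : c.Equivariant a D.hom := D.equivariant_hom
  have hA : ∀ z ξ, c.infinitesimal z ξ ∈ D.gpd.anchorImage z ↔ ξ ∈ G.lieIdeal := by
    intro z ξ
    rw [D.mem_anchorImage, hc.tangentMap_infinitesimal, ← hσ.nondegenerate,
      μ.infinitesimal_mem_ker_iff hμ (hDμ z)]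
  refine ⟨{
    gpd := D.gpd
    incl := D.hom
    embedding_obj := hφ.isEmbedding
    embedding_arr := hα.isEmbedding
    range_obj := hφ.range_eq
    range_arr := hα.range_eq
    action := c
    equivariant := hc }, D.isFoliation (hT := hT2) hX, hA, fun z => ?_⟩
  have hker : ∀ v : D.gpd.Obj.Model, v ∈ (σ.pullback D.hom.obj).ker z ↔ ∃ ξ,
      v - c.infinitesimal z ξ ∈ D.gpd.anchorImage z := by
    intro v
    rw [PreForm.mem_ker]
    constructor
    · intro h
      obtain ⟨ξ, hξ⟩ := μ.exists_sub_mem_ker (x := D.hom.obj z) (v := tangentMap D.hom.obj z v) (by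
        intro w hw
        obtain ⟨w', rfl⟩ := (ht z w).2 hw
        rw [← σ.bilin_pullback]
        exact h w')
      refine ⟨ξ, ?_⟩
      rw [D.mem_anchorImage, ← hσ.nondegenerate]
      rw [map_sub, hc.tangentMap_infinitesimal]
      exact hξ
    · rintro ⟨ξ, hξ⟩ w
      rw [D.mem_anchorImage, ← hσ.nondegenerate] at hξ
      have h1 : tangentMap D.hom.obj z v = tangentMap D.hom.obj z (v - c.infinitesimal z ξ) +
          a.infinitesimal (D.hom.obj z) ξ := by
        rw [map_sub, hc.tangentMap_infinitesimal, sub_add_cancel]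
      rw [σ.bilin_pullback, h1, map_add, LinearMap.add_apply, ← μ.deriv_apply,
        (ht z _).1 ⟨w, rfl⟩]
      have h2 : σ.bilin (D.hom.obj z) (tangentMap D.hom.obj z (v - c.infinitesimal z ξ))
        (tangentMap D.hom.obj z w) = 0 := hξ _
      rw [h2]
      exact add_zero 0
  ext v
  refine (hker v).trans ?_
  rw [Submodule.mem_sup]
  constructor
  · rintro ⟨ξ, hξ⟩
    exact ⟨_, hξ, _, ⟨ξ, rfl⟩, sub_add_cancel _ _⟩
  · rintro ⟨q, hq, _, ⟨ξ, rfl⟩, rfl⟩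
    refine ⟨ξ, ?_⟩
    have e : q + c.infinitesimal z ξ - c.infinitesimal z ξ = q := add_sub_cancel_right _ _
    exact e.symm ▸ hq

end MomentMap

/-! ### Maps transverse to the foliation of a groupoid -/

section LinearAlgebra

variable {V W : Type*} [AddCommGroup V] [Module ℝ V] [FiniteDimensional ℝ V] [AddCommGroup W]
  [Module ℝ W] [FiniteDimensional ℝ W]

theorem finrank_sup_range_add (F : Submodule ℝ W) (A : V →ₗ[ℝ] W) :
    Module.finrank ℝ ↥(F ⊔ LinearMap.range A) + Module.finrank ℝ ↥(F.comap A) =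
      Module.finrank ℝ F + Module.finrank ℝ V := by
  have h1 := Submodule.finrank_sup_add_finrank_inf_eq F (LinearMap.range A)
  have h2 := A.finrank_range_add_finrank_ker
  have h3 := (A.domRestrict (F.comap A)).finrank_range_add_finrank_ker
  have e1 : LinearMap.range (A.domRestrict (F.comap A)) = F ⊓ LinearMap.range A := by
    rw [LinearMap.range_domRestrict, Submodule.map_comap_eq, inf_comm]
  have e2 : Module.finrank ℝ (LinearMap.ker (A.domRestrict (F.comap A))) =
      Module.finrank ℝ (LinearMap.ker A) := by
    have hle : LinearMap.ker A ≤ F.comap A := fun v hv => by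
      rw [Submodule.mem_comap, LinearMap.mem_ker.1 hv]
      exact F.zero_mem
    have e : LinearMap.ker (A.domRestrict (F.comap A)) =
        (LinearMap.ker A).comap (F.comap A).subtype := by
      ext v; rfl
    rw [e]
    exact (Submodule.comapSubtypeEquivOfLe hle).finrank_eq
  rw [e1, e2] at h3
  omega

/-- Counting dimensions, a linear map `A` that is transverse to `F` from a space whose dimension
is at most the codimension of `F` is complementary to `F`. -/
theorem eq_zero_of_sup_range_eq_top {F : Submodule ℝ W} {A : V →ₗ[ℝ] W}
    (h : F ⊔ LinearMap.range A = ⊤)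
    (hd : Module.finrank ℝ F + Module.finrank ℝ V ≤ Module.finrank ℝ W) {v : V} (hv : A v ∈ F) :
    v = 0 := by
  have h1 := finrank_sup_range_add F A
  rw [h, finrank_top] at h1
  have h2 : F.comap A = ⊥ := Submodule.finrank_eq_zero.1 (by omega)
  exact (Submodule.mem_bot ℝ).1 (h2 ▸ hv : v ∈ (⊥ : Submodule ℝ V))

end LinearAlgebra

section Transversal

variable {Y : LieGroupoid.{u}} {R : SmoothMfd.{u}}

/-- The map `φ` into the objects of a groupoid is transverse at `r` to the foliation. -/
def LieGroupoid.TransverseAt (Y : LieGroupoid.{u}) (φ : R → Y.Obj) (r : R) : Prop :=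
  ∀ w, ∃ v, w - tangentMap φ r v ∈ Y.anchorImage (φ r)

variable {φ : R → Y.Obj} {P : SmoothMfd.{u}} {p : P → Y.Arr} {q : P → R}

/-- Transversality of `φ` makes the target map of `Y₁ ×_{s, Y₀, φ} R` a submersion. -/
theorem LieGroupoid.TransverseAt.surjective (hP : IsFibredProduct Y.src φ p q)
    (hPt : ∀ z v w, tangentMap Y.src (p z) v = tangentMap φ (q z) w →
      ∃ y, tangentMap p z y = v ∧ tangentMap q z y = w) {z : P} (h : Y.TransverseAt φ (q z)) :
    Function.Surjective (tangentMap (fun z => Y.tgt (p z)) z) := by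
  intro w
  obtain ⟨v, rfl⟩ := Y.tgt_submersion.2 (p z) w
  obtain ⟨u, hu⟩ := h (tangentMap Y.src (p z) v)
  rw [← hP.comm] at hu
  -- Correct the lift `v` so that its source component becomes tangent to the image of `φ`.
  obtain ⟨v', hv', hv''⟩ := LieGroupoid.exists_of_mem_anchorImage_src hu
  obtain ⟨y, hy, -⟩ := hPt z (v - v') u (by rw [map_sub, hv'']; exact sub_sub_cancel _ _)
  refine ⟨y, ?_⟩
  rw [tangentMap_comp_apply Y.tgt_submersion.1 hP.smooth_fst, hy, map_sub, hv', sub_zero]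

/-- The converse of `LieGroupoid.TransverseAt.surjective` at the units. -/
theorem LieGroupoid.transverseAt_of_surjective (hP : IsFibredProduct Y.src φ p q)
    (hφ : Smooth φ) {z : P} (hz : p z = Y.unit (φ (q z)))
    (h : Function.Surjective (tangentMap (fun z => Y.tgt (p z)) z)) : Y.TransverseAt φ (q z) := by
  intro w
  obtain ⟨v, hv⟩ := Y.src_submersion.2 (p z) w
  obtain ⟨y, hy⟩ := h (tangentMap Y.tgt (p z) v)
  rw [tangentMap_comp_apply Y.tgt_submersion.1 hP.smooth_fst] at hy
  have hy' : tangentMap Y.src (p z) (tangentMap p z y) = tangentMap φ (q z) (tangentMap q z y) := by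
    rw [← tangentMap_comp_apply Y.src_submersion.1 hP.smooth_fst, funext hP.comm,
      tangentMap_comp_apply hφ hP.smooth_snd]
  refine ⟨tangentMap q z y, LieGroupoid.mem_anchorImage_iff_src.2 ⟨v - tangentMap p z y, ?_, ?_⟩⟩
  · rw [← hz, map_sub, hy, sub_self]
  · rw [← hz, map_sub, hy']
    exact congrArg (· - _) hv

/-- Transversality is an open condition, although the foliation is not known to be a subbundle: it
is the submersion property of the target map of `Y₁ ×_{s, Y₀, φ} R` along the units. -/
theorem LieGroupoid.isOpen_transverseAt (hφ : Smooth φ) : IsOpen {r | Y.TransverseAt φ r} := by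
  obtain ⟨P, p, q, hP, -, hPt⟩ := exists_fibredProduct Y.src_submersion hφ
  obtain ⟨c, ⟨hc, hcp, hcq⟩, -⟩ := hP.universal R (fun r => Y.unit (φ r)) (fun r => r)
    (Y.smooth_unit.comp hφ) smooth_id (fun r => Y.src_unit _)
  have ho := (isOpen_setOf_surjective_tangentMap
    (Y.tgt_submersion.1.comp hP.smooth_fst)).preimage hc.continuous
  convert ho using 1
  ext r
  constructor
  · intro h
    exact LieGroupoid.TransverseAt.surjective hP hPt (by rw [hcq]; exact h)
  · intro h
    have := LieGroupoid.transverseAt_of_surjective hP hφ (z := c r) (by rw [hcp, hcq]) h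
    rwa [hcq] at this

/-- The points isomorphic to points of the image of a transverse map form a neighbourhood. -/
theorem LieGroupoid.TransverseAt.mem_nhds (hφ : Smooth φ) {r : R} (h : Y.TransverseAt φ r) :
    {y | ∃ f r', Y.src f = φ r' ∧ Y.tgt f = y} ∈ 𝓝 (φ r) := by
  obtain ⟨P, p, q, hP, hPe, hPt⟩ := exists_fibredProduct Y.src_submersion hφ
  obtain ⟨z, hz, hz'⟩ := hPe (Y.unit (φ r)) r (Y.src_unit _)
  have h1 := image_mem_nhds_of_surjective_tangentMap (Y.tgt_submersion.1.comp hP.smooth_fst)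
    (LieGroupoid.TransverseAt.surjective hP hPt (by rw [hz']; exact h) : Function.Surjective
      (tangentMap (fun z => Y.tgt (p z)) z)) Filter.univ_mem
  rw [hz, Y.tgt_unit] at h1
  refine Filter.mem_of_superset h1 ?_
  rintro _ ⟨z', -, rfl⟩
  exact ⟨p z', q z', hP.comm z', rfl⟩

end Transversal

/-! ### Slices for an action -/

section Slice

open SmoothMfd

variable {G : LieTwoGroup.{u}} {Y : LieGroupoid.{u}} (b : StrictAction G Y) {T : SmoothMfd.{u}}

/-- The sum of the tangent spaces at `z` of the foliation and of the orbit of `z`. -/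
def StrictAction.distribution (z : Y.Obj) : Submodule ℝ Y.Obj.Model :=
  Y.anchorImage z ⊔ LinearMap.range (b.infinitesimal z : G.Obj.Model →ₗ[ℝ] Y.Obj.Model)

variable {b}

theorem StrictAction.mem_distribution {z : Y.Obj} {v : Y.Obj.Model} :
    v ∈ b.distribution z ↔ ∃ ξ, v - b.infinitesimal z ξ ∈ Y.anchorImage z := by
  rw [StrictAction.distribution, Submodule.mem_sup]
  constructor
  · rintro ⟨q, hq, _, ⟨ξ, rfl⟩, rfl⟩
    refine ⟨ξ, ?_⟩
    have e : q + b.infinitesimal z ξ - b.infinitesimal z ξ = q := add_sub_cancel_right _ _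
    exact e.symm ▸ hq
  · rintro ⟨ξ, hξ⟩
    exact ⟨_, hξ, _, ⟨ξ, rfl⟩, sub_add_cancel _ _⟩

/-- The distribution is invariant under the action. -/
theorem StrictAction.tangentMap_mem_distribution (g : G.Obj) {x : Y.Obj} {v : Y.Obj.Model}
    (hv : v ∈ b.distribution x) : tangentMap (b.obj g) x v ∈ b.distribution (b.obj g x) := by
  obtain ⟨ξ, hξ⟩ := StrictAction.mem_distribution.1 hv
  refine StrictAction.mem_distribution.2 ⟨G.Ad g ξ, ?_⟩
  rw [← b.tangentMap_infinitesimal, ← map_sub]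
  exact b.tangentMap_mem_anchorImage g hξ

theorem StrictAction.tangentMap_inv_left (g : G.Obj) (x : Y.Obj) (v : Y.Obj.Model) :
    tangentMap (b.obj g⁻¹) (b.obj g x) (tangentMap (b.obj g) x v) = v := by
  rw [← tangentMap_comp_apply (b.smooth_left _) (b.smooth_left _)]
  have e : (fun y => b.obj g⁻¹ (b.obj g y)) = fun y => y := funext fun y => by
    rw [← b.mul_obj, inv_mul_cancel, b.one_obj]
  rw [e, tangentMap_id]
  rfl

theorem StrictAction.surjective_tangentMap_left (g : G.Obj) (x : Y.Obj) :
    Function.Surjective (tangentMap (b.obj g) x) :=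
  (LinearMap.injective_iff_surjective (f := (tangentMap (b.obj g) x : Y.Obj.Model →ₗ[ℝ] _))).1
    fun v w h => by
      rw [← b.tangentMap_inv_left g x v, ← b.tangentMap_inv_left g x w]
      exact congrArg _ h

theorem StrictAction.mem_distribution_of_tangentMap_mem {g : G.Obj} {x : Y.Obj} {v : Y.Obj.Model}
    (hv : tangentMap (b.obj g) x v ∈ b.distribution (b.obj g x)) : v ∈ b.distribution x := by
  have h := StrictAction.tangentMap_mem_distribution g⁻¹ hv
  rw [b.tangentMap_inv_left, ← b.mul_obj, inv_mul_cancel, b.one_obj] at h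
  exact h

/-- The distribution has constant rank if the fundamental vectors tangent to the foliation are at
each point those of the elements of `𝔥`. -/
theorem StrictAction.finrank_distribution (hY : Y.IsFoliation)
    (hA : ∀ z ξ, b.infinitesimal z ξ ∈ Y.anchorImage z ↔ ξ ∈ G.lieIdeal) (z : Y.Obj) :
    Module.finrank ℝ (b.distribution z) = Module.finrank ℝ Y.Arr.Model -
      Module.finrank ℝ Y.Obj.Model + Module.finrank ℝ G.Obj.Model -
        Module.finrank ℝ G.lieIdeal := by
  have h := finrank_sup_range_add (Y.anchorImage z)
    (b.infinitesimal z : G.Obj.Model →ₗ[ℝ] Y.Obj.Model)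
  have e : (Y.anchorImage z).comap (b.infinitesimal z : G.Obj.Model →ₗ[ℝ] Y.Obj.Model) =
    G.lieIdeal := Submodule.ext fun ξ => hA z ξ
  rw [e, hY.finrank_anchorImage] at h
  exact Nat.eq_sub_of_add_eq h

variable (b) in
/-- The map `G₀ × T → Y₀`, `(g, τ) ↦ g ⬝ ψ(τ)`. -/
def StrictAction.sweep (ψ : T → Y.Obj) (r : G.Obj.prod T) : Y.Obj := b.obj (fst r) (ψ (snd r))

theorem StrictAction.smooth_sweep {ψ : T → Y.Obj} (hψ : Smooth ψ) : Smooth (b.sweep ψ) :=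
  b.smooth_obj.comp smooth_fst (hψ.comp smooth_snd)

theorem LieTwoGroup.smooth_mul_right (g : G.Obj) : Smooth (fun g' : G.Obj => g' * g) :=
  contMDiff_mul_right

/-- The tangent map of an orbit map at `g` in terms of the infinitesimal action at `g ⬝ x`. -/
theorem StrictAction.tangentMap_orbit (x : Y.Obj) (g : G.Obj) (γ : G.Obj.Model) :
    tangentMap (fun g' => b.obj g' x) g γ =
      b.infinitesimal (b.obj g x) (tangentMap (fun g' : G.Obj => g' * g⁻¹) g γ) := by
  have e : (fun g' => b.obj g' x) = fun g' => b.obj (g' * g⁻¹) (b.obj g x) := funext fun g' => by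
    rw [← b.mul_obj, inv_mul_cancel_right]
  rw [e, tangentMap_comp_apply (b.smooth_orbit (b.obj g x)) (LieTwoGroup.smooth_mul_right _),
    mul_inv_cancel]
  rfl

theorem LieTwoGroup.bijective_tangentMap_mul_right (g x : G.Obj) :
    Function.Bijective (tangentMap (fun g' : G.Obj => g' * g) x) := by
  have h1 : ∀ v, tangentMap (fun g' : G.Obj => g' * g⁻¹) (x * g)
      (tangentMap (fun g' : G.Obj => g' * g) x v) = v := by
    intro v
    rw [← tangentMap_comp_apply (G.smooth_mul_right _) (G.smooth_mul_right _)]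
    simp only [mul_inv_cancel_right]
    rw [tangentMap_id]
    rfl
  have hi := Function.LeftInverse.injective h1
  exact ⟨hi, (LinearMap.injective_iff_surjective
    (f := (tangentMap (fun g' : G.Obj => g' * g) x : G.Obj.Model →ₗ[ℝ] _))).1 hi⟩

/-- The partial derivatives of the sweep, the vectors of `G₀` being translated to `𝔤`. -/
theorem StrictAction.tangentMap_sweep {ψ : T → Y.Obj} (hψ : Smooth ψ) (g : G.Obj) (τ : T)
    (γ : G.Obj.Model) (w : T.Model) : tangentMap (b.sweep ψ) (pair g τ) (tangentPair γ w) =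
      b.infinitesimal (b.obj g (ψ τ)) (tangentMap (fun g' : G.Obj => g' * g⁻¹) g γ) +
        tangentMap (b.obj g) (ψ τ) (tangentMap ψ τ w) := by
  rw [tangentMap_prod_apply (StrictAction.smooth_sweep hψ), ← StrictAction.tangentMap_orbit,
    ← tangentMap_comp_apply (b.smooth_left g) hψ]
  rfl

/-- A map `ψ` is transverse to the distribution at `τ`. -/
def StrictAction.TransverseAt (b : StrictAction G Y) (ψ : T → Y.Obj) (τ : T) : Prop :=
  ∀ v, ∃ w, v - tangentMap ψ τ w ∈ b.distribution (ψ τ)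

/-- A map transverse to the distribution has a sweep transverse to the foliation, as the orbit
directions are covered by `G₀`. -/
theorem StrictAction.TransverseAt.sweep {ψ : T → Y.Obj} (hψ : Smooth ψ) {τ : T}
    (h : b.TransverseAt ψ τ) (g : G.Obj) : Y.TransverseAt (b.sweep ψ) (pair g τ) := by
  intro v
  obtain ⟨v, rfl⟩ := b.surjective_tangentMap_left g (ψ τ) v
  obtain ⟨w, hw⟩ := h v
  obtain ⟨ξ, hξ⟩ := StrictAction.mem_distribution.1 hw
  obtain ⟨γ, hγ⟩ := (G.bijective_tangentMap_mul_right g⁻¹ g).2 (G.Ad g ξ)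
  refine ⟨tangentPair γ w, ?_⟩
  rw [StrictAction.tangentMap_sweep hψ, hγ, ← b.tangentMap_infinitesimal]
  have h1 := b.tangentMap_mem_anchorImage g hξ
  rw [map_sub, map_sub] at h1
  rwa [add_comm, ← sub_sub]

theorem StrictAction.transverseAt_of_sweep {ψ : T → Y.Obj} (hψ : Smooth ψ) {τ : T}
    (h : Y.TransverseAt (b.sweep ψ) (pair 1 τ)) : b.TransverseAt ψ τ := by
  intro v
  have e : b.sweep ψ (pair 1 τ) = ψ τ := b.one_obj _
  obtain ⟨x, hx⟩ := h v
  obtain ⟨γ, w, rfl⟩ := exists_eq_tangentPair x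
  rw [tangentMap_prod_apply (StrictAction.smooth_sweep hψ), e] at hx
  refine ⟨w, StrictAction.mem_distribution.2 ⟨γ, ?_⟩⟩
  have e2 : (fun y' => b.sweep ψ (pair (1 : G.Obj) y')) = ψ := funext fun y => b.one_obj _
  rw [e2] at hx
  rw [sub_sub, add_comm]
  exact hx

theorem StrictAction.isOpen_transverseAt {ψ : T → Y.Obj} (hψ : Smooth ψ) :
    IsOpen {τ | b.TransverseAt ψ τ} := by
  have h := (LieGroupoid.isOpen_transverseAt (b.smooth_sweep hψ)).preimage
    ((smooth_const (1 : G.Obj)).pair (smooth_id (M := T))).continuous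
  convert h using 1
  ext τ
  exact ⟨fun h => h.sweep hψ 1, b.transverseAt_of_sweep hψ⟩

end Slice

/-! ### Local maps from a vector space -/

section Shrink

variable {E : Type} [NormedAddCommGroup E] [InnerProductSpace ℝ E] [FiniteDimensional ℝ E]

theorem surjective_mfderiv_vecDown (x : vecMfd.{u} E) :
    Function.Surjective (mfderiv (vecMfd.{u} E).I 𝓘(ℝ, E) (vecDown : vecMfd.{u} E → E) x) := by
  have h := mfderiv_comp (vecDown x)
    (g := (vecDown : vecMfd.{u} E → E)) (f := (vecUp : E → vecMfd.{u} E))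
    ((contMDiff_vecDown.{u} (E := E) _).mdifferentiableAt (by simp))
    ((contMDiff_vecUp.{u} (E := E) _).mdifferentiableAt (by simp))
  have e : (vecDown : vecMfd.{u} E → E) ∘ (vecUp : E → vecMfd.{u} E) = id := rfl
  rw [e, mfderiv_id] at h
  intro w
  exact ⟨_, (DFunLike.congr_fun h w).symm⟩

theorem smooth_vecMfd {k : E → E} (hk : ContDiff ℝ ∞ k) :
    Smooth (fun x : vecMfd.{u} E => (vecUp (k (vecDown x)) : vecMfd.{u} E)) :=
  ContMDiff.comp (I' := 𝓘(ℝ, E)) contMDiff_vecUp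
    (ContMDiff.comp (I' := 𝓘(ℝ, E)) hk.contMDiff contMDiff_vecDown)

/-- The vector space `E` can be mapped into any neighbourhood of its origin by a local
diffeomorphism which fixes the origin. -/
theorem exists_shrink {U : Set (vecMfd.{u} E)} (hU : U ∈ 𝓝 (vecUp 0 : vecMfd.{u} E)) :
    ∃ k : vecMfd.{u} E → vecMfd.{u} E, Smooth k ∧ k (vecUp 0) = vecUp 0 ∧
      (∀ v, k v ∈ U) ∧ ∀ v, Function.Surjective (tangentMap k v) := by
  have hU' : (fun x : E => (vecUp x : vecMfd.{u} E)) ⁻¹' U ∈ 𝓝 (0 : E) :=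
    (contMDiff_vecUp (E := E)).continuous.continuousAt hU
  obtain ⟨r, hr, hrU⟩ := Metric.mem_nhds_iff.1 hU'
  let κ := OpenPartialHomeomorph.univBall (0 : E) r
  have hκ : ContDiff ℝ ∞ κ := OpenPartialHomeomorph.contDiff_univBall
  have hκb : ∀ v, κ v ∈ Metric.ball (0 : E) r := fun v => by
    rw [← OpenPartialHomeomorph.univBall_target (0 : E) hr]
    exact κ.map_source (by rw [OpenPartialHomeomorph.univBall_source]; trivial)
  have hl : ∀ v, κ.symm (κ v) = v := fun v =>
    κ.left_inv (by rw [OpenPartialHomeomorph.univBall_source]; trivial)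
  let k : vecMfd.{u} E → vecMfd.{u} E := fun x => vecUp (κ (vecDown x))
  let k' : vecMfd.{u} E → vecMfd.{u} E := fun x => vecUp (κ.symm (vecDown x))
  have hk : Smooth k := smooth_vecMfd hκ
  refine ⟨k, hk, congrArg vecUp (OpenPartialHomeomorph.univBall_apply_zero _ _),
    fun v => hrU (hκb _), fun v => ?_⟩
  refine (LinearMap.injective_iff_surjective
    (f := (tangentMap k v : (vecMfd.{u} E).Model →ₗ[ℝ] (vecMfd.{u} E).Model))).1 ?_
  -- The inverse is smooth near `k v`.
  have hs : MDifferentiableAt (vecMfd.{u} E).I (vecMfd.{u} E).I k' (k v) := by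
    have h1 : ContDiffAt ℝ ∞ κ.symm (κ (vecDown v)) :=
      (OpenPartialHomeomorph.contDiffOn_univBall_symm (c := (0 : E)) (r := r)).contDiffAt
        (Metric.isOpen_ball.mem_nhds (hκb _))
    have h2 : ContMDiffAt (vecMfd.{u} E).I 𝓘(ℝ, E) ∞
        (κ.symm ∘ (vecDown : vecMfd.{u} E → E)) (k v) :=
      ContMDiffAt.comp (I' := 𝓘(ℝ, E)) (k v) h1.contMDiffAt (contMDiff_vecDown _)
    exact (ContMDiffAt.comp (I' := 𝓘(ℝ, E)) (k v) (contMDiff_vecUp _) h2).mdifferentiableAt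
      (by simp)
  have hc := mfderiv_comp v hs (hk.mdiff v)
  have he : k' ∘ k = id := funext fun x => congrArg vecUp (hl (vecDown x))
  rw [he, mfderiv_id] at hc
  intro w w' h
  exact (DFunLike.congr_fun hc w).trans ((congrArg
    (mfderiv (vecMfd.{u} E).I (vecMfd.{u} E).I k' (k v)) h).trans (DFunLike.congr_fun hc w').symm)

/-- There are smooth maps from a vector space through a given point in given directions. -/
theorem exists_smooth_range_tangentMap {M : SmoothMfd.{u}} (z : M) (l : E →L[ℝ] M.Model) :
    ∃ ψ : vecMfd.{u} E → M, Smooth ψ ∧ ψ (vecUp 0) = z ∧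
      ∀ w, ∃ v, tangentMap ψ (vecUp 0 : vecMfd.{u} E) v = l w := by
  let c := chartAt M.Model z
  let A : M.Model →L[ℝ] M.Model := mfderiv 𝓘(ℝ, M.Model) M.I c.symm (c z)
  have hcz : c z ∈ c.target := c.map_source (mem_chart_source _ z)
  have hA : Function.Surjective A :=
    (mdifferentiable_chart (I := M.I) z).symm.mfderiv_surjective hcz
  obtain ⟨B, hB⟩ := LinearMap.exists_rightInverse_of_surjective
    (A : M.Model →ₗ[ℝ] M.Model) (LinearMap.range_eq_top.2 hA)
  let L : E →L[ℝ] M.Model := (LinearMap.toContinuousLinearMap B).comp l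
  let f : vecMfd.{u} E → M.Model := fun x => c z + L (vecDown x)
  have hL : ContDiff ℝ ∞ (fun x => c z + L x) := contDiff_const.add L.contDiff
  have hf : ContMDiff (vecMfd.{u} E).I 𝓘(ℝ, M.Model) ∞ f :=
    ContMDiff.comp (I' := 𝓘(ℝ, E)) (M' := E) hL.contMDiff contMDiff_vecDown
  have hf0 : f (vecUp 0) = c z := by
    change c z + L 0 = c z
    rw [map_zero, add_zero]
  obtain ⟨k, hk, hk0, hkU, hks⟩ := exists_shrink (E := E) (U := f ⁻¹' c.target)
    (hf.continuous.continuousAt (c.open_target.mem_nhds (hf0 ▸ hcz)))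
  have hfk : ContMDiff (vecMfd.{u} E).I 𝓘(ℝ, M.Model) ∞ (fun x => f (k x)) :=
    ContMDiff.comp (I' := (vecMfd.{u} E).I) (g := f) hf hk
  refine ⟨fun x => c.symm (f (k x)), ?_, ?_, fun w => ?_⟩
  · intro x
    exact ContMDiffAt.comp (I' := 𝓘(ℝ, M.Model)) x
      ((contMDiffOn_chart_symm (I := M.I) (n := ∞)).contMDiffAt (c.open_target.mem_nhds (hkU x)))
      (hfk x)
  · change c.symm (f (k (vecUp 0))) = z
    rw [hk0, hf0]
    exact c.left_inv (mem_chart_source _ z)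
  · obtain ⟨v₁, hv₁⟩ := surjective_mfderiv_vecDown (E := E) (vecUp.{u} 0) w
    obtain ⟨v, hv⟩ := hks (vecUp 0) v₁
    refine ⟨v, ?_⟩
    have h1 : HasMFDerivAt 𝓘(ℝ, E) 𝓘(ℝ, M.Model) (fun x => c z + L x) (0 : E) L :=
      (L.hasFDerivAt.const_add (c z)).hasMFDerivAt
    have h2 : HasMFDerivAt (vecMfd.{u} E).I 𝓘(ℝ, M.Model) f (vecUp 0) (L.comp
        (mfderiv (vecMfd.{u} E).I 𝓘(ℝ, E) (vecDown : vecMfd.{u} E → E) (vecUp 0))) :=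
      HasMFDerivAt.comp (I' := 𝓘(ℝ, E)) (g := fun x => c z + L x) (vecUp 0 : vecMfd.{u} E) h1
        ((contMDiff_vecDown.{u} (E := E) _).mdifferentiableAt (by simp)).hasMFDerivAt
    have h3 : HasMFDerivAt 𝓘(ℝ, M.Model) M.I c.symm (f (k (vecUp 0))) A := by
      rw [hk0, hf0]
      exact ((mdifferentiable_chart (I := M.I) z).symm.mdifferentiableAt hcz).hasMFDerivAt
    rw [← hk0] at h2
    have h4 := HasMFDerivAt.comp (vecUp 0 : vecMfd.{u} E) h3
      (HasMFDerivAt.comp (vecUp 0 : vecMfd.{u} E) h2 (hk.mdiff (vecUp 0)).hasMFDerivAt)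
    refine (DFunLike.congr_fun h4.mfderiv v).trans ?_
    change A (L (mfderiv (vecMfd.{u} E).I 𝓘(ℝ, E) (vecDown : vecMfd.{u} E → E) (k (vecUp 0))
      (tangentMap k (vecUp 0) v))) = l w
    rw [hv, hk0]
    refine (congrArg (fun y => A (L y)) hv₁).trans ?_
    exact DFunLike.congr_fun hB (l w)

end Shrink

/-! ### Complete slices -/

section CompleteSlice

open SmoothMfd

variable {G : LieTwoGroup.{u}} {Y : LieGroupoid.{u}} {b : StrictAction G Y}

/-- A slice through `z`: start from a map in the directions of a complement of the distribution at
`z` and restrict it to the open set on which it is transverse. -/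
theorem StrictAction.exists_slice (b : StrictAction G Y) {e : ℕ} (z : Y.Obj)
    (he : e = Module.finrank ℝ Y.Obj.Model - Module.finrank ℝ (b.distribution z)) :
    ∃ ψ : vecMfd.{u} (EuclideanSpace ℝ (Fin e)) → Y.Obj, Smooth ψ ∧ (∀ v, b.TransverseAt ψ v) ∧
      ψ (vecUp 0) = z := by
  obtain ⟨C, hC⟩ := (b.distribution z).exists_isCompl
  have hCe : Module.finrank ℝ (EuclideanSpace ℝ (Fin e)) = Module.finrank ℝ C := by
    have := Submodule.finrank_add_eq_of_isCompl hC
    rw [finrank_euclideanSpace_fin]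
    omega
  let l := C.subtype.comp (LinearEquiv.ofFinrankEq _ _ hCe : EuclideanSpace ℝ (Fin e) →ₗ[ℝ] C)
  obtain ⟨ψ, hψ, hψ0, hψl⟩ := exists_smooth_range_tangentMap z (LinearMap.toContinuousLinearMap l)
  have h0 : b.TransverseAt ψ (vecUp 0) := by
    intro v
    obtain ⟨d, hd, c, hc, rfl⟩ := Submodule.mem_sup.1
      (hC.sup_eq_top ▸ Submodule.mem_top : v ∈ b.distribution z ⊔ C)
    obtain ⟨w, hw⟩ := hψl ((LinearEquiv.ofFinrankEq _ _ hCe).symm ⟨c, hc⟩)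
    refine ⟨w, ?_⟩
    have e1 : tangentMap ψ (vecUp 0) w = c := by
      rw [hw]
      exact congrArg Subtype.val ((LinearEquiv.ofFinrankEq _ _ hCe).apply_symm_apply ⟨c, hc⟩)
    rw [e1, hψ0]
    have e2 : d + c - c = d := add_sub_cancel_right _ _
    exact e2.symm ▸ hd
  obtain ⟨k, hk, hk0, hkU, hks⟩ := exists_shrink
    ((StrictAction.isOpen_transverseAt (b := b) hψ).mem_nhds h0)
  refine ⟨fun x => ψ (k x), hψ.comp hk, fun x v => ?_, (congrArg ψ hk0).trans hψ0⟩
  obtain ⟨w, hw⟩ := hkU x v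
  obtain ⟨w, rfl⟩ := hks x w
  exact ⟨w, by rwa [tangentMap_comp_apply hψ hk]⟩

theorem smooth_discrete_prod {ι : Type u} [Countable ι] {M N : SmoothMfd.{u}} {ψ : ι → M → N}
    (hψ : ∀ i, Smooth (ψ i)) :
    Smooth (fun τ : (discreteMfd ι).prod M => ψ (fst τ : discreteMfd ι) (snd τ)) := by
  intro τ
  refine ((hψ (fst τ : discreteMfd ι)).comp smooth_snd τ).congr_of_eventuallyEq ?_
  have h : (fst : (discreteMfd ι).prod M → discreteMfd ι) ⁻¹' {fst τ} ∈ 𝓝 τ :=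
    smooth_fst.continuous.continuousAt ((isOpen_discrete _).mem_nhds rfl)
  filter_upwards [h] with τ' hτ'
  have e : (fst τ' : discreteMfd ι) = fst τ := hτ'
  rw [e]

/-- A map `ψ` whose image is a complete slice: it is transverse and complementary to the
distribution, and every object is isomorphic to a translate of a point of the slice. -/
structure StrictAction.IsCompleteSlice (b : StrictAction G Y) {T : SmoothMfd.{u}} (ψ : T → Y.Obj) :
    Prop where
  t2 : T2Space T
  smooth : Smooth ψ
  transverse : ∀ τ, b.TransverseAt ψ τ
  eq_zero : ∀ τ w, tangentMap ψ τ w ∈ b.distribution (ψ τ) → w = 0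
  complete : ∀ y, ∃ f r, Y.src f = b.sweep ψ r ∧ Y.tgt f = y

/-- Countably many slices suffice, as `Y₀` is second countable and the points isomorphic to points
of the sweep of a slice through `z` form a neighbourhood of `z`. -/
theorem StrictAction.exists_isCompleteSlice {d : ℕ}
    (hd : ∀ z, Module.finrank ℝ (b.distribution z) = d) :
    ∃ (T : SmoothMfd.{u}) (ψ : T → Y.Obj), b.IsCompleteSlice ψ := by
  let e := Module.finrank ℝ Y.Obj.Model - d
  let M := vecMfd.{u} (EuclideanSpace ℝ (Fin e))
  have hsl : ∀ z : Y.Obj, ∃ ψ : M → Y.Obj, Smooth ψ ∧ (∀ v, b.TransverseAt ψ v) ∧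
      ψ (vecUp 0) = z := fun z => b.exists_slice z (by rw [hd])
  choose ψ hψ hψt hψ0 using hsl
  -- The slices through the points of `s` suffice; a discrete copy of `s` indexes them.
  obtain ⟨s, hs, hsu⟩ := TopologicalSpace.countable_cover_nhds (fun z => by
    have h := ((hψt z (vecUp 0)).sweep (hψ z) 1).mem_nhds (StrictAction.smooth_sweep (hψ z))
    have e : b.sweep (ψ z) (pair 1 (vecUp 0)) = z := (b.one_obj _).trans (hψ0 z)
    rwa [e] at h)
  have := hs.to_subtype
  let χ : discreteMfd s → M → Y.Obj := fun i => ψ (Subtype.val (p := (· ∈ s)) i)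
  have hχt : ∀ i v, b.TransverseAt (χ i) v := fun i => hψt _
  let Ψ : (discreteMfd s).prod M → Y.Obj := fun τ => χ (fst τ) (snd τ)
  have hΨ : Smooth Ψ := smooth_discrete_prod (ι := s) (ψ := χ) (fun i => hψ _)
  have hdΨ : ∀ (i : discreteMfd s) (v : M) i' w,
      tangentMap Ψ (pair i v) (tangentPair i' w) = tangentMap (χ i) v w := by
    intro i v i' w
    rw [tangentMap_prod_apply hΨ, Subsingleton.elim i' 0, map_zero, zero_add]
    rfl
  refine ⟨(discreteMfd s).prod M, Ψ, ?_, hΨ, ?_, ?_, ?_⟩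
  · exact inferInstanceAs (T2Space (discreteMfd s × M))
  · intro τ v
    obtain ⟨w, hw⟩ := hχt (fst τ) (snd τ) v
    refine ⟨tangentPair 0 w, ?_⟩
    have h := hdΨ (fst τ) (snd τ) 0 w
    rw [pair_fst_snd] at h
    rw [h]
    exact hw
  · intro τ w hw
    obtain ⟨i', w, rfl⟩ := exists_eq_tangentPair w
    have h := hdΨ (fst τ) (snd τ) i' w
    rw [pair_fst_snd] at h
    rw [h] at hw
    have hd0 : w = 0 := by
      refine eq_zero_of_sup_range_eq_top (F := b.distribution (Ψ τ))
        (A := (tangentMap (χ (fst τ)) (snd τ) : M.Model →ₗ[ℝ] Y.Obj.Model))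
        ?_ ?_ hw
      · refine eq_top_iff.2 fun v _ => Submodule.mem_sup.2 ?_
        obtain ⟨w, hw⟩ := hχt (fst τ) (snd τ) v
        exact ⟨_, hw, _, ⟨w, rfl⟩, sub_add_cancel _ _⟩
      · have h1 : Module.finrank ℝ M.Model = e := finrank_euclideanSpace_fin
        have h2 := (b.distribution (Ψ τ)).finrank_le
        rw [hd] at h2 ⊢
        omega
    rw [hd0, Subsingleton.elim i' 0, tangentPair_zero]
  · intro y
    have hy : y ∈ ⋃ x ∈ s, {y | ∃ f r', Y.src f = b.sweep (ψ x) r' ∧ Y.tgt f = y} := by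
      rw [hsu]; trivial
    simp only [Set.mem_iUnion] at hy
    obtain ⟨x, hx, f, r, h1, h2⟩ := hy
    exact ⟨f, pair (fst r) (pair (⟨x, hx⟩ : s) (snd r) : (discreteMfd s).prod M), h1, h2⟩

end CompleteSlice

/-! ### Pullbacks along transverse maps -/

section TransversePullback

open SmoothMfd

variable {Y : LieGroupoid.{u}} {R : SmoothMfd.{u}} {φ : R → Y.Obj}

/-- The arrows of the pullback of `Y` along `φ`, as the equalizer of `(s, t)` and `φ × φ` in `Y₁ ×
(R × R)`. By transversality of `φ`, the source alone provides the missing directions at a fixed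
target. -/
theorem exists_pullbackArr (hφ : Smooth φ) (ht : ∀ r, Y.TransverseAt φ r) :
    ∃ (N : SmoothMfd.{u}) (i : N → Y.Arr.prod (R.prod R)),
      IsSubmanifold i {n | pair (Y.src (fst n)) (Y.tgt (fst n)) =
        (pair (φ (fst (snd n))) (φ (snd (snd n))) : Y.Obj.prod Y.Obj)} ∧
      ∀ x v w w', tangentMap Y.src (fst (i x)) v = tangentMap φ (fst (snd (i x))) w →
        tangentMap Y.tgt (fst (i x)) v = tangentMap φ (snd (snd (i x))) w' →
          tangentPair v (tangentPair w w') ∈ Set.range (tangentMap i x) := by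
  have h1 : Smooth fun n : Y.Arr.prod (R.prod R) => fst (snd n) := smooth_fst.comp smooth_snd
  have h2 : Smooth fun n : Y.Arr.prod (R.prod R) => snd (snd n) := smooth_snd.comp smooth_snd
  have hs : Smooth fun n : Y.Arr.prod (R.prod R) => Y.src (fst n) :=
    Y.src_submersion.1.comp smooth_fst
  have ht' : Smooth fun n : Y.Arr.prod (R.prod R) => Y.tgt (fst n) :=
    Y.tgt_submersion.1.comp smooth_fst
  have ha : ∀ (n : Y.Arr.prod (R.prod R)) v w w',
      tangentMap (fun n => pair (Y.src (fst n)) (Y.tgt (fst n))) n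
        (tangentPair v (tangentPair w w')) =
      tangentPair (tangentMap Y.src (fst n) v) (tangentMap Y.tgt (fst n) v) := by
    intro n v w w'
    rw [tangentMap_pair hs ht', tangentMap_comp_fst Y.src_submersion.1,
      tangentMap_comp_fst Y.tgt_submersion.1]
  have hb : ∀ (n : Y.Arr.prod (R.prod R)) v w w',
      tangentMap (fun n => pair (φ (fst (snd n))) (φ (snd (snd n)))) n
        (tangentPair v (tangentPair w w')) =
      tangentPair (tangentMap φ (fst (snd n)) w) (tangentMap φ (snd (snd n)) w') := by
    intro n v w w'
    rw [tangentMap_pair (hφ.comp h1) (hφ.comp h2), tangentMap_comp_apply hφ h1,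
      tangentMap_comp_apply hφ h2, tangentMap_comp_apply smooth_fst smooth_snd,
      tangentMap_comp_apply smooth_snd smooth_snd, tangentMap_snd, tangentMap_fst, tangentMap_snd]
  obtain ⟨N, i, hi, hti⟩ := exists_equalizer (hs.pair ht') ((hφ.comp h1).pair (hφ.comp h2)) (by
    intro n hn w
    obtain ⟨w₁, w₂, rfl⟩ := exists_eq_tangentPair w
    have hn1 : Y.src (fst n) = φ (fst (snd n)) := congrArg fst hn
    obtain ⟨v, rfl⟩ := Y.tgt_submersion.2 (fst n) w₂
    obtain ⟨x, hx⟩ := ht (fst (snd n)) (tangentMap Y.src (fst n) v - w₁)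
    rw [← hn1] at hx
    obtain ⟨v', hv', hv''⟩ := LieGroupoid.exists_of_mem_anchorImage_src hx
    refine ⟨tangentPair (v - v') (tangentPair x 0), ?_⟩
    rw [ha, hb, tangentPair_sub, map_sub, map_sub, hv', hv'', map_zero, sub_zero, sub_zero]
    congr 1
    abel)
  refine ⟨N, i, hi, fun x v w w' h h' => (hti x _).2 ?_⟩
  rw [ha, hb, h, h']

/-- The pullback of a groupoid along a map transverse to its foliation. -/
def transversePullback (hφ : Smooth φ) (ht : ∀ r, Y.TransverseAt φ r) : PullbackData Y :=
  let N := (exists_pullbackArr hφ ht).choose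
  let i := (exists_pullbackArr hφ ht).choose_spec.choose
  have hi := (exists_pullbackArr hφ ht).choose_spec.choose_spec.1
  have hti := (exists_pullbackArr hφ ht).choose_spec.choose_spec.2
  have hα : Smooth fun n : N => fst (i n) := smooth_fst.comp hi.smooth
  have hs : Smooth fun n : N => fst (snd (i n)) := smooth_fst.comp (smooth_snd.comp hi.smooth)
  have ht' : Smooth fun n : N => snd (snd (i n)) := smooth_snd.comp (smooth_snd.comp hi.smooth)
  have hsα : ∀ n : N, Y.src (fst (i n)) = φ (fst (snd (i n))) := fun n => congrArg fst (hi.mem n)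
  have htα : ∀ n : N, Y.tgt (fst (i n)) = φ (snd (snd (i n))) := fun n => congrArg snd (hi.mem n)
  have hex : ∀ (n : N) v w w', tangentMap Y.src (fst (i n)) v = tangentMap φ (fst (snd (i n))) w →
      tangentMap Y.tgt (fst (i n)) v = tangentMap φ (snd (snd (i n))) w' →
        ∃ y, tangentMap (fun n : N => fst (i n)) n y = v ∧
          tangentMap (fun n : N => fst (snd (i n))) n y = w ∧
            tangentMap (fun n : N => snd (snd (i n))) n y = w' := by
    intro n v w w' h h'
    obtain ⟨y, hy⟩ := hti n v w w' h h'
    refine ⟨y, ?_, ?_, ?_⟩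
    · rw [tangentMap_comp_apply smooth_fst hi.smooth]
      exact (congrArg _ hy).trans (tangentMap_fst _ _ _)
    · rw [tangentMap_comp_apply smooth_fst (smooth_snd.comp hi.smooth),
        tangentMap_comp_apply smooth_snd hi.smooth]
      exact (congrArg (fun y => tangentMap fst _ (tangentMap snd _ y)) hy).trans
        ((congrArg _ (tangentMap_snd _ _ _)).trans (tangentMap_fst _ _ _))
    · rw [tangentMap_comp_apply smooth_snd (smooth_snd.comp hi.smooth),
        tangentMap_comp_apply smooth_snd hi.smooth]
      exact (congrArg (fun y => tangentMap snd _ (tangentMap snd _ y)) hy).trans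
        ((congrArg _ (tangentMap_snd _ _ _)).trans (tangentMap_snd _ _ _))
  { Obj := R
    φ := φ
    smooth_φ := hφ
    Arr := N
    α := fun n => fst (i n)
    s := fun n => fst (snd (i n))
    t := fun n => snd (snd (i n))
    smooth_α := hα
    smooth_s := hs
    smooth_t := ht'
    src_α := hsα
    tgt_α := htα
    ext := fun n n' h h' h'' => hi.injective (Prod.ext h (Prod.ext h' h''))
    exists_arr := fun f r r' h h' => by
      obtain ⟨n, hn⟩ := hi.exists_eq (y := pair f (pair r r'))
        (congrArg₂ (pair (M := Y.Obj) (N := Y.Obj)) h h')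
      exact ⟨n, congrArg fst hn, congrArg (fun x => fst (snd x)) hn,
        congrArg (fun x => snd (snd x)) hn⟩
    lift := fun {_ _ _ _ _ _ _ _ _ _ _} h h' h'' => hi.lift
      (ContMDiffOn.prodMk (I' := Y.Arr.I) (J' := (R.prod R).I) h
        (ContMDiffOn.prodMk (I' := R.I) (J' := R.I) h' h''))
    exists_tangent := hex
    surjective_t := fun n u => by
      obtain ⟨v, hv⟩ := Y.tgt_submersion.2 (fst (i n)) (tangentMap φ (snd (snd (i n))) u)
      obtain ⟨x, hx⟩ := ht (fst (snd (i n))) (tangentMap Y.src (fst (i n)) v)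
      rw [← hsα] at hx
      obtain ⟨v', hv', hv''⟩ := LieGroupoid.exists_of_mem_anchorImage_src hx
      obtain ⟨y, -, -, hy⟩ := hex n (v - v') x u (by rw [map_sub, hv'']; exact sub_sub_cancel _ _)
        (by rw [map_sub, hv', sub_zero, hv])
      exact ⟨y, hy⟩ }

/-- The projection of the pullback along a transverse map that meets all isomorphism classes is
a Morita morphism. -/
theorem isMorita_hom_transversePullback (hφ : Smooth φ) (ht : ∀ r, Y.TransverseAt φ r)
    (hc : ∀ y, ∃ f r, Y.src f = φ r ∧ Y.tgt f = y) :
    (transversePullback hφ ht).hom.IsMorita := by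
  refine ⟨?_, (transversePullback hφ ht).fullyFaithful_hom⟩
  obtain ⟨P, p, q, hP, hPe, hPt⟩ := exists_fibredProduct Y.src_submersion hφ
  refine ⟨P, p, q, hP, ⟨Y.tgt_submersion.1.comp hP.smooth_fst, fun z =>
    LieGroupoid.TransverseAt.surjective hP hPt (ht _)⟩, fun y => ?_⟩
  obtain ⟨f, r, h, rfl⟩ := hc y
  obtain ⟨z, rfl, -⟩ := hPe f r h
  exact ⟨z, rfl⟩

end TransversePullback

/-! ### The sweep of a complete slice -/

section Sweep

open SmoothMfd

variable {G : LieTwoGroup.{u}} {Y : LieGroupoid.{u}} {b : StrictAction G Y} {T : SmoothMfd.{u}}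
  {ψ : T → Y.Obj}

/-- The action of `G₀` on `G₀ × T` by left multiplication. -/
def mulPair (T : SmoothMfd.{u}) (g : G.Obj) (r : G.Obj.prod T) : G.Obj.prod T :=
  pair (g * fst r) (snd r)

theorem smooth₂_mulPair : Smooth₂ (mulPair (G := G) T) := by
  have hm : Smooth₂ (fun g g' : G.Obj => g * g') := contMDiff_mul G.Obj.I ∞
  exact smooth₂_iff.2 ((hm.comp smooth_fst (smooth_fst.comp smooth_snd)).pair
    (smooth_snd.comp smooth_snd))

theorem sweep_mulPair (g : G.Obj) (r : G.Obj.prod T) :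
    b.sweep ψ (mulPair T g r) = b.obj g (b.sweep ψ r) := b.mul_obj _ _ _

theorem tangentMap_mulPair_orbit (g : G.Obj) (τ : T) (ξ : G.Obj.Model) :
    tangentMap (fun g' : G.Obj => mulPair T g' (pair g τ)) 1 ξ =
      tangentPair (tangentMap (fun g' : G.Obj => g' * g) 1 ξ) 0 := by
  have h := tangentMap_pair (G.smooth_mul_right g) (smooth_const (M := G.Obj) τ) 1 ξ
  rw [tangentMap_const] at h
  exact h

namespace StrictAction.IsCompleteSlice

theorem transverseAt_sweep (h : b.IsCompleteSlice ψ) (r : G.Obj.prod T) :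
    Y.TransverseAt (b.sweep ψ) r :=
  (h.transverse (snd r)).sweep h.smooth (fst r)

/-- The tangent map of the sweep maps exactly the tangent vectors of the orbits of `G₀` to the
distribution. -/
theorem tangentMap_sweep_mem_distribution_iff (h : b.IsCompleteSlice ψ) (g : G.Obj) (τ : T)
    (γ : G.Obj.Model) (w : T.Model) : tangentMap (b.sweep ψ) (pair g τ) (tangentPair γ w) ∈
      b.distribution (b.sweep ψ (pair g τ)) ↔ w = 0 := by
  have hr : b.infinitesimal (b.obj g (ψ τ)) (tangentMap (fun g' : G.Obj => g' * g⁻¹) g γ) ∈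
      b.distribution (b.obj g (ψ τ)) := Submodule.mem_sup_right ⟨_, rfl⟩
  rw [StrictAction.tangentMap_sweep h.smooth]
  refine (Submodule.add_mem_iff_right (b.distribution (b.obj g (ψ τ))) hr).trans ⟨fun hw => ?_, ?_⟩
  · exact h.eq_zero τ w (StrictAction.mem_distribution_of_tangentMap_mem hw)
  · rintro rfl
    rw [map_zero, map_zero]
    exact Submodule.zero_mem _

end StrictAction.IsCompleteSlice

end Sweep

/-! ### Smooth paths -/

section Paths

/-- A path with zero velocity is constant, even in a manifold that is not Hausdorff. -/
theorem eq_of_mfderiv_eq_zero {M : SmoothMfd.{u}} {γ : ℝ → M} (hγ : ContMDiff 𝓘(ℝ, ℝ) M.I ∞ γ)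
    (h0 : ∀ t, (mfderiv 𝓘(ℝ, ℝ) M.I γ t : ℝ →L[ℝ] M.Model) 1 = 0) (a b : ℝ) : γ a = γ b := by
  have h1 : ∀ t, (mfderiv 𝓘(ℝ, ℝ) M.I γ t : ℝ →L[ℝ] M.Model) = 0 := fun t =>
    ContinuousLinearMap.ext_ring (h0 t)
  have hl : IsLocallyConstant γ := by
    refine (IsLocallyConstant.iff_eventually_eq γ).2 fun t₀ => ?_
    let c := chartAt M.Model (γ t₀)
    obtain ⟨r, hr, hrU⟩ := Metric.isOpen_iff.1 (c.open_source.preimage hγ.continuous) t₀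
      (mem_chart_source _ (γ t₀))
    have hd : ∀ t ∈ Metric.ball t₀ r, HasFDerivAt (fun t => c (γ t)) (0 : ℝ →L[ℝ] M.Model) t := by
      intro t ht
      have h2 : HasMFDerivAt 𝓘(ℝ, ℝ) M.I γ t (0 : ℝ →L[ℝ] M.Model) :=
        h1 t ▸ ((hγ t).mdifferentiableAt (by simp)).hasMFDerivAt
      have h3 := (mdifferentiable_chart (I := M.I) (γ t₀)).mdifferentiableAt (hrU ht)
      have h4 := HasMFDerivAt.comp t h3.hasMFDerivAt h2
      have h5 := h4.hasFDerivAt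
      exact h5.congr_fderiv (ContinuousLinearMap.comp_zero _)
    filter_upwards [Metric.ball_mem_nhds t₀ hr] with t ht
    exact c.injOn (hrU ht) (mem_chart_source _ _) (Metric.isOpen_ball.is_const_of_fderiv_eq_zero
      (convex_ball t₀ r).isPreconnected
      (fun t ht => (hd t ht).differentiableAt.differentiableWithinAt)
      (fun t ht => (hd t ht).fderiv) ht (Metric.mem_ball_self hr))
  exact hl.apply_eq_of_isPreconnected isPreconnected_univ trivial trivial

/-- Every point near `x` is the end of a smooth path that starts from `x`. -/
theorem eventually_exists_smooth_path {M : SmoothMfd.{u}} (x : M) :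
    ∀ᶠ y in 𝓝 x, ∃ γ : ℝ → M, ContMDiff 𝓘(ℝ, ℝ) M.I ∞ γ ∧ γ 0 = x ∧ γ 1 = y := by
  let c := chartAt M.Model x
  have hx := mem_chart_source M.Model x
  obtain ⟨r, hr, hrU⟩ := Metric.isOpen_iff.1 c.open_target (c x) (c.map_source hx)
  have h1 : c ⁻¹' Metric.ball (c x) r ∈ 𝓝 x :=
    (c.continuousAt hx) (Metric.ball_mem_nhds _ hr)
  filter_upwards [h1, c.open_source.mem_nhds hx] with y hy hyc
  let f : ℝ → M.Model := fun t => c x + Real.smoothTransition t • (c y - c x)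
  have hf : ContDiff ℝ ∞ f :=
    contDiff_const.add (Real.smoothTransition.contDiff.smul contDiff_const)
  have hft : ∀ t, f t ∈ c.target := fun t => hrU ((convex_ball (c x) r).add_smul_sub_mem
    (Metric.mem_ball_self hr) hy ⟨Real.smoothTransition.nonneg t, Real.smoothTransition.le_one t⟩)
  refine ⟨fun t => c.symm (f t), fun t => ?_, ?_, ?_⟩
  · exact ContMDiffAt.comp (I' := 𝓘(ℝ, M.Model)) t
      ((contMDiffOn_chart_symm (I := M.I) (n := ∞)).contMDiffAt (c.open_target.mem_nhds (hft t)))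
      (hf.contMDiff t)
  · simp only [f, Real.smoothTransition.zero, zero_smul, add_zero]
    exact c.left_inv hx
  · simp only [f, Real.smoothTransition.one, one_smul, add_sub_cancel]
    exact c.left_inv hyc

/-- The elements of the identity component of a Lie group are the ends of smooth paths that start
from `1`: these ends form an open subgroup. -/
theorem LieTwoGroup.exists_smooth_path (G : LieTwoGroup.{u}) {g : G.Obj}
    (hg : g ∈ connectedComponent (1 : G.Obj)) :
    ∃ γ : ℝ → G.Obj, ContMDiff 𝓘(ℝ, ℝ) G.Obj.I ∞ γ ∧ γ 0 = 1 ∧ γ 1 = g := by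
  have : IsTopologicalGroup G.Obj := topologicalGroup_of_lieGroup G.Obj.I ∞
  let S : Subgroup G.Obj :=
    { carrier := {g | ∃ γ : ℝ → G.Obj, ContMDiff 𝓘(ℝ, ℝ) G.Obj.I ∞ γ ∧ γ 0 = 1 ∧ γ 1 = g}
      one_mem' := ⟨fun _ => 1, contMDiff_const, rfl, rfl⟩
      mul_mem' := by
        rintro _ _ ⟨γ, hγ, h0, rfl⟩ ⟨γ', hγ', h0', rfl⟩
        exact ⟨fun t => γ t * γ' t, hγ.mul hγ', by simp only [h0, h0', mul_one], rfl⟩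
      inv_mem' := by
        rintro _ ⟨γ, hγ, h0, rfl⟩
        exact ⟨fun t => (γ t)⁻¹, hγ.inv, by simp only [h0, inv_one], rfl⟩ }
  have ho : IsOpen (S : Set G.Obj) := S.isOpen_of_mem_nhds (eventually_exists_smooth_path 1)
  have hS : IsClopen (S : Set G.Obj) := ⟨S.isClosed_of_isOpen ho, ho⟩
  exact hS.connectedComponent_subset S.one_mem hg

end Paths

/-! ### The kernel of a pulled back form -/

section Forms

variable {M N R : SmoothMfd.{u}} (σ : PreForm M 2)

/-- The kernel of the pullback of a form along a map transverse to its kernel is the inverse image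
of the kernel. -/
theorem PreForm.mem_ker_pullback_iff {i : N → M} (hi : Smooth i) {φ : R → N} (hφ : Smooth φ)
    {r : R} (ht : ∀ w, ∃ v, w - tangentMap φ r v ∈ (σ.pullback i).ker (φ r)) {v : R.Model} :
    v ∈ (σ.pullback fun r => i (φ r)).ker r ↔ tangentMap φ r v ∈ (σ.pullback i).ker (φ r) := by
  have h : ∀ v w, (σ.pullback fun r => i (φ r)).bilin r v w =
      (σ.pullback i).bilin (φ r) (tangentMap φ r v) (tangentMap φ r w) := by
    intro v w
    rw [PreForm.bilin_pullback, PreForm.bilin_pullback, tangentMap_comp_apply hi hφ,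
      tangentMap_comp_apply hi hφ]
  rw [PreForm.mem_ker, PreForm.mem_ker]
  constructor
  · intro hv w
    obtain ⟨v', hv'⟩ := ht w
    have h1 : w = (w - tangentMap φ r v') + tangentMap φ r v' := (sub_add_cancel _ _).symm
    rw [h1, map_add, ← h, hv v', add_zero, PreForm.bilin_swap, (PreForm.mem_ker _).1 hv', neg_zero]
  · intro hv w
    rw [h, hv]

end Forms

/-! ### The regular form -/

section RegularForm

open SmoothMfd

variable {G : LieTwoGroup.{u}} {Y : LieGroupoid.{u}} {b : StrictAction G Y} {T : SmoothMfd.{u}}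
  {ψ : T → Y.Obj}

/-- The tangent spaces of the `G₀`-orbits in `G₀ × T` are those of the fibres of the projection to
`T`. -/
theorem tangentMap_snd_eq_zero_iff (r : G.Obj.prod T) (v : (G.Obj.prod T).Model) :
    tangentMap (snd : G.Obj.prod T → T) r v = 0 ↔
      ∃ ξ, tangentMap (fun g : G.Obj => mulPair T g r) 1 ξ = v := by
  obtain ⟨γ, w, rfl⟩ := exists_eq_tangentPair v
  rw [tangentMap_snd]
  have e : ∀ ξ, tangentMap (fun g : G.Obj => mulPair T g r) 1 ξ =
      tangentPair (tangentMap (fun g : G.Obj => g * fst r) 1 ξ) 0 :=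
    tangentMap_mulPair_orbit (fst r) (snd r)
  constructor
  · rintro rfl
    obtain ⟨ξ, rfl⟩ := (G.bijective_tangentMap_mul_right (fst r) 1).2 γ
    exact ⟨ξ, e ξ⟩
  · rintro ⟨ξ, hξ⟩
    exact (tangentPair_inj.1 ((e ξ).symm.trans hξ)).2.symm

theorem injective_tangentMap_mulPair (r : G.Obj.prod T) :
    Function.Injective (tangentMap (fun g : G.Obj => mulPair T g r) 1) := by
  have e : ∀ ξ, tangentMap (fun g : G.Obj => mulPair T g r) 1 ξ =
      tangentPair (tangentMap (fun g : G.Obj => g * fst r) 1 ξ) 0 :=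
    tangentMap_mulPair_orbit (fst r) (snd r)
  intro ξ ξ' h
  rw [e, e] at h
  exact (G.bijective_tangentMap_mul_right (fst r) 1).1 (tangentPair_inj.1 h).1

namespace StrictAction.IsCompleteSlice

/-- The pullback of a groupoid along the sweep of a complete slice. -/
def pullback (h : b.IsCompleteSlice ψ) : PullbackData Y :=
  transversePullback (StrictAction.smooth_sweep h.smooth) h.transverseAt_sweep

/-- The action by left multiplication on the pullback along the sweep. -/
def action (h : b.IsCompleteSlice ψ) : StrictAction G h.pullback.gpd :=
  h.pullback.action b (mulPair T) smooth₂_mulPair (fun _ => Prod.ext (one_mul _) rfl)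
    (fun _ _ _ => Prod.ext (mul_assoc _ _ _) rfl) sweep_mulPair

theorem equivariant (h : b.IsCompleteSlice ψ) : h.action.Equivariant b h.pullback.hom :=
  h.pullback.equivariant_hom

theorem isMorita (h : b.IsCompleteSlice ψ) : h.pullback.hom.IsMorita :=
  isMorita_hom_transversePullback _ _ h.complete

/-- The inverse image of the distribution under `φ₀` consists of the tangent spaces of the
`G₀`-orbits. -/
theorem tangentMap_mem_distribution_iff (h : b.IsCompleteSlice ψ) (r : h.pullback.gpd.Obj)
    (v : h.pullback.gpd.Obj.Model) :
    tangentMap h.pullback.hom.obj r v ∈ b.distribution (h.pullback.hom.obj r) ↔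
      ∃ ξ, h.action.infinitesimal r ξ = v := by
  have h1 : ∀ (r : G.Obj.prod T) (v : (G.Obj.prod T).Model),
      tangentMap (b.sweep ψ) r v ∈ b.distribution (b.sweep ψ r) ↔
        ∃ ξ, tangentMap (fun g : G.Obj => mulPair T g r) 1 ξ = v := by
    intro r v
    rw [← tangentMap_snd_eq_zero_iff]
    obtain ⟨γ, w, rfl⟩ := exists_eq_tangentPair v
    rw [tangentMap_snd]
    exact h.tangentMap_sweep_mem_distribution_iff (fst r) (snd r) γ w
  exact h1 r v

/-- Vectors mapped to the foliation of `Y` are fundamental vectors, and then they come from `𝔥`;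
hence the action is locally leafwise transitive. The other two properties hold since left
multiplication is free. -/
theorem isRegular (h : b.IsCompleteSlice ψ)
    (hA : ∀ z ξ, b.infinitesimal z ξ ∈ Y.anchorImage z ↔ ξ ∈ G.lieIdeal) :
    h.action.IsRegular := by
  have hfree : ∀ g x, h.action.obj g x = x → g = 1 := by
    intro g x hx
    have h1 : g * fst (x : G.Obj.prod T) = fst (x : G.Obj.prod T) := congrArg fst hx
    exact mul_eq_right.1 h1
  refine ⟨fun r => ?_, hfree, fun k _ f hf => ?_⟩
  · ext v
    rw [h.pullback.mem_anchorImage, Submodule.mem_map]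
    constructor
    · rintro ⟨ξ, hξ, rfl⟩
      refine Set.mem_of_eq_of_mem (h.equivariant.tangentMap_infinitesimal r ξ) ?_
      exact (hA _ _).2 hξ
    · intro hv
      obtain ⟨ξ, rfl⟩ := (h.tangentMap_mem_distribution_iff r v).1 (Submodule.mem_sup_left hv)
      rw [h.equivariant.tangentMap_infinitesimal] at hv
      exact ⟨ξ, (hA _ _).1 hv, rfl⟩
  · refine hfree _ (h.pullback.gpd.tgt f) ?_
    rw [← h.action.tgt_arr, hf]

/-- The null leaves of a form on `G₀ × T` whose kernel is tangent to the fibres of the projection to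
`T` are the orbits of the identity component of `G₀`. -/
theorem nullLeaf_eq {τ : PreForm (G.Obj.prod T) 2}
    (hτ : ∀ r v, v ∈ τ.ker r ↔ tangentMap (snd : G.Obj.prod T → T) r v = 0) (r : G.Obj.prod T) :
    τ.nullLeaf r = (fun g => mulPair T g r) '' connectedComponent (1 : G.Obj) := by
  have : IsTopologicalGroup G.Obj := topologicalGroup_of_lieGroup G.Obj.I ∞
  have hd : ∀ γ : ℝ → G.Obj.prod T, ContMDiff 𝓘(ℝ, ℝ) (G.Obj.prod T).I ∞ γ → ∀ t,
      (mfderiv 𝓘(ℝ, ℝ) T.I (fun t => snd (γ t)) t : ℝ →L[ℝ] T.Model) 1 =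
        tangentMap (snd : G.Obj.prod T → T) (γ t)
          ((mfderiv 𝓘(ℝ, ℝ) (G.Obj.prod T).I γ t : ℝ →L[ℝ] (G.Obj.prod T).Model) 1) := by
    intro γ hγ t
    have h := mfderiv_comp t ((smooth_snd (M := G.Obj) (N := T)).mdiff (γ t))
      ((hγ t).mdifferentiableAt (by simp))
    exact DFunLike.congr_fun h 1
  ext y
  constructor
  · rintro ⟨γ, hγ, hγk, rfl, rfl⟩
    have hT : ContMDiff 𝓘(ℝ, ℝ) T.I ∞ fun t => snd (γ t) :=
      ContMDiff.comp (I' := (G.Obj.prod T).I) (smooth_snd (M := G.Obj) (N := T)) hγ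
    have hG : Continuous fun t => fst (γ t) :=
      (smooth_fst (M := G.Obj) (N := T)).continuous.comp hγ.continuous
    have hc := eq_of_mfderiv_eq_zero hT (fun t => (hd γ hγ t).trans ((hτ _ _).1 (hγk t))) 0 1
    -- The component in `T` is constant; the one in `G₀` stays in one component of `G₀`.
    refine ⟨fst (γ 1) * (fst (γ 0))⁻¹, ?_, ?_⟩
    · have h1 : IsPreconnected (Set.range fun t => fst (γ t) * (fst (γ 0))⁻¹) :=
        isPreconnected_range (hG.mul continuous_const)
      exact h1.subset_connectedComponent ⟨0, mul_inv_cancel _⟩ ⟨1, rfl⟩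
    · exact Prod.ext (inv_mul_cancel_right _ _) hc
  · rintro ⟨g, hg, rfl⟩
    obtain ⟨γ, hγ, h0, rfl⟩ := G.exists_smooth_path hg
    have hγr : ContMDiff 𝓘(ℝ, ℝ) (G.Obj.prod T).I ∞ fun t => mulPair T (γ t) r :=
      ContMDiff.comp (I' := G.Obj.I)
        (smooth₂_mulPair.comp smooth_id (smooth_const (M := G.Obj) r)) hγ
    refine ⟨fun t => mulPair T (γ t) r, hγr, fun t => (hτ _ _).2 ?_, ?_, rfl⟩
    · rw [← hd _ hγr]
      exact DFunLike.congr_fun (mfderiv_const (I := 𝓘(ℝ, ℝ)) (I' := T.I) (c := snd r) (x := t)) 1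
    · exact Prod.ext ((congrArg (· * fst r) h0).trans (one_mul _)) rfl

theorem orbitsAreNullLeaves (h : b.IsCompleteSlice ψ) {τ : PreForm h.pullback.gpd.Obj 2}
    (hτ : ∀ r v, v ∈ τ.ker r ↔ ∃ ξ, h.action.infinitesimal r ξ = v) :
    OrbitsAreNullLeaves h.action τ := by
  have ht : ∀ r, τ.ker r = LinearMap.range (h.action.infinitesimal r :
      G.Obj.Model →ₗ[ℝ] h.pullback.gpd.Obj.Model) := fun r => Submodule.ext (hτ r)
  have hl : ∀ r, τ.nullLeaf r = (fun g => h.action.obj g r) '' connectedComponent (1 : G.Obj) :=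
    fun r => nullLeaf_eq (T := T) (τ := τ)
      (fun r v => (hτ r v).trans (tangentMap_snd_eq_zero_iff (T := T) r v).symm) r
  refine ⟨⟨Module.finrank ℝ G.Obj.Model, fun r => ?_⟩, ht, hl, fun hc r => ?_⟩
  · rw [ht]
    exact LinearMap.finrank_range_of_inj (injective_tangentMap_mulPair (T := T) r)
  · rw [hl, PreconnectedSpace.connectedComponent_eq_univ, Set.image_univ]

end StrictAction.IsCompleteSlice

end RegularForm
end HamGpd

end

theorem mainTheorem9
    (G : LieTwoGroup.{u}) (hG : G.IsFoliation) (hGconn : ConnectedSpace G.OrbitSpace)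
    (X : LieGroupoid.{u}) (hX : X.IsFoliation)
    (σ : PreForm X.Obj 2) (hσ : X.IsZeroSymplectic σ)
    (a : StrictAction G X) (μ : MomentMap σ a) (hμ : μ.ZeroIsRegularValue) :
    ∃ Z : ZeroFibre μ, Nonempty (RegularForm Z) := by
  obtain ⟨Z, hZ, hA, hker⟩ := μ.exists_zeroFibre hX hσ hμ
  obtain ⟨T, ψ, h⟩ := StrictAction.exists_isCompleteSlice (StrictAction.finrank_distribution hZ hA)
  have hT2 : T2Space h.pullback.Obj := by
    have := hG.1
    have := h.t2
    exact inferInstanceAs (T2Space (G.Obj × T))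
  refine ⟨Z, ⟨{
    gpd := h.pullback.gpd
    foliation := h.pullback.isFoliation hZ
    action := h.action
    regular := h.isRegular hA
    φ := h.pullback.hom
    equivariant := h.equivariant
    morita := h.isMorita
    nullLeaves := h.orbitsAreNullLeaves fun r v => ?_ }⟩⟩
  rw [← h.tangentMap_mem_distribution_iff]
  refine (σ.mem_ker_pullback_iff Z.incl.smooth_obj h.pullback.hom.smooth_obj (r := r)
    fun w => ?_).trans ?_
  · obtain ⟨v', hv'⟩ := h.transverseAt_sweep r w
    rw [hker]
    exact ⟨v', Submodule.mem_sup_left hv'⟩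
  · rw [hker]
    rfl
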